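/- Let $\mathbb Z_+=\{0,1,2,\dots\}$, $\mathbb N=\{1,2,\dots\}$, and let $\lambda:\mathbb Z_+\to(0,\infty)$ satisfy $0<\inf_x\lambda(x)\le\sup_x\lambda(x)<\infty$. For $N\in\mathbb N$, let $\mathsf{GT}_N$ be the set of arrays $(x^n_k)_{1\le k\le n\le N}$ in $\mathbb Z_+$ with $x^n_1<\dots<x^n_n$ for every $n\le N$ and $x^{n+1}_k\le x^n_k<x^{n+1}_{k+1}$ for $1\le k\le n<N$; let $\mathsf{GT}_\infty$ be the set of infinite arrays $(x^n_k)_{1\le k\le n}$ all of whose truncations $\pi_N(x)=(x^n_k)_{1\le k\le n\le N}$ lie in $\mathsf{GT}_N$, with the $\sigma$-algebra generated by the coordinates. The push-block dynamics on $\mathsf{GT}_N$ is the continuous-time Markov jump process in which each particle carries an independent exponential clock of rate $\lambda(x)$, where $x$ is its current position. When the clock of the particle $x^n_k$ rings, nothing happens if $k<n$ and $x^{n-1}_k=x^n_k$ (blocking); otherwise the particle moves from $x^n_k$ to $x^n_k+1$, and, if after this move it is no longer strictly to the left of $x^{n+1}_{k+1}$, the latter also moves to the right by one instantaneously, and so on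 up the levels (pushing). That is, its generator is the bounded operator $L_Nf(x)=\sum_{1\le k\le n\le N}\lambda(x^n_k)\,[f(x^{(n,k)})-f(x)]$, where $x^{(n,k)}$ is the array after the ring. The densely packed initial condition is $x^n_k=k-1$. A process on $\mathsf{GT}_\infty$ is called a push-block process if its projection by $\pi_N$ is a push-block process on $\mathsf{GT}_N$ for every $N$. Then there is a family $(P_t)_{t\ge0}$ of probability measures on $\mathsf{GT}_\infty$ which is the evolution of the densely packed initial condition under the dynamics: for all $N$, all bounded $f:\mathsf{GT}_N\to\mathbb R$ and all $t\ge0$, $\int f\circ\pi_N\,dP_t=f(\text{densely packed})+\int_0^t\int (L_Nf)\circ\pi_N\,dP_s\,ds$; for every $N$ and $t$ the law at time $t$ of any push-block process on $\mathsf{GT}_N$ started from the densely packed pattern is $(\pi_N)_*P_t$; and $P_t$ is the law at time $t$ of any push-block process on $\mathsf{GT}_\infty$ started from the densely packed pattern. Let $\mathsf P^t_\infty$ be the point process on $\mathbb N\times\mathbb Z_+$ of the points $(n,x^n_k)$, $1\le k\le n$, with $x$ distributed according to $P_t$. For every $t\ge 0$, it is determinantal: for all $k\ge1$ and distinct points $z_i=(n_i,x_i)\in\mathbb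 N\times\mathbb Z_+$, $1\le i\le k$, $$\mathsf P^t_\infty(\text{there are particles at }z_1,\dots,z_k)=\det\left[\mathsf K_t(z_i,z_j)\right]_{i,j=1}^k,$$ where, with $\psi_x(w)=\prod_{k=0}^{x}\frac{\lambda(k)}{\lambda(k)-w}$ and $p_x(w)=\prod_{k=0}^{x-1}\frac{\lambda(k)-w}{\lambda(k)}$ (so $p_0\equiv 1$), $$\mathsf K_t(n_1,x_1;n_2,x_2)=\frac{\mathbf 1(n_2>n_1)}{\lambda(x_1)}\frac1{2\pi \mathrm i}\oint_{\mathsf C_\lambda}\psi_{x_1}(w)\frac{p_{x_2}(w)}{w^{n_2-n_1}}\,dw-\frac1{\lambda(x_1)}\frac1{(2\pi \mathrm i)^2}\oint_{\mathsf C_\lambda}dw\oint_{\mathsf C_0}du\,\psi_{x_1}(w)\,p_{x_2}(u)\,e^{-t(w-u)}\,\frac{w^{n_1-n_2}}{u^{n_2}}\,\frac{w^{n_2}-u^{n_2}}{w-u}.$$ Here $\mathsf C_\lambda$ is any piecewise $C^1$ closed contour with winding number one around $0$ and around each point $\lambda(x)$, $x\ge0$, and $\mathsf C_0$ is any piecewise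 $C^1$ closed contour with winding number one around $0$ that does not meet $\mathsf C_\lambda$ (for example a small counter-clockwise circle around $0$). -/

import Mathlib

open MeasureTheory ProbabilityTheory Filter Topology
open scoped NNReal

/-- The rate function is uniformly bounded away from `0` and `∞`. -/
def UniformlyBounded (lam : ℕ → ℝ) : Prop :=
  ∃ s M : ℝ, 0 < s ∧ ∀ x, s ≤ lam x ∧ lam x ≤ M

/-! ### Gelfand–Tsetlin patterns

An array is a function `x : ℕ → ℕ → ℕ`, where `x n k` is the position of the `k`-th particle on
level `n`, for `1 ≤ k ≤ n`; the entries with other indices are fixed to be `0`. -/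

/-- Interlacing arrays with levels `1, …, N`. -/
structure IsGT (N : ℕ) (x : ℕ → ℕ → ℕ) : Prop where
  support : ∀ n k, ¬ (1 ≤ k ∧ k ≤ n ∧ n ≤ N) → x n k = 0
  strict : ∀ n k, 1 ≤ k → k + 1 ≤ n → n ≤ N → x n k < x n (k + 1)
  interlace : ∀ n k, 1 ≤ k → k ≤ n → n + 1 ≤ N → x (n + 1) k ≤ x n k ∧ x n k < x (n + 1) (k + 1)

/-- Interlacing arrays with levels `1, 2, 3, …`. -/
structure IsGTInf (x : ℕ → ℕ → ℕ) : Prop where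
  support : ∀ n k, ¬ (1 ≤ k ∧ k ≤ n) → x n k = 0
  strict : ∀ n k, 1 ≤ k → k + 1 ≤ n → x n k < x n (k + 1)
  interlace : ∀ n k, 1 ≤ k → k ≤ n → x (n + 1) k ≤ x n k ∧ x n k < x (n + 1) (k + 1)

/-- Gelfand–Tsetlin patterns of length `N`. -/
def GT (N : ℕ) : Type := {x : ℕ → ℕ → ℕ // IsGT N x}

/-- Infinite Gelfand–Tsetlin patterns. -/
def GTInf : Type := {x : ℕ → ℕ → ℕ // IsGTInf x}

/-- `GT N` is countable and carries the discrete `σ`-algebra. -/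
instance (N : ℕ) : MeasurableSpace (GT N) := ⊤

/-- `GTInf` carries the `σ`-algebra generated by the coordinates. -/
instance : MeasurableSpace GTInf :=
  MeasurableSpace.comap Subtype.val (inferInstance : MeasurableSpace (ℕ → ℕ → ℕ))

/-- The projection keeping the levels `1, …, N`. -/
def GTInf.trunc (N : ℕ) (x : GTInf) : GT N :=
  ⟨fun n k => if n ≤ N then x.1 n k else 0, by
    refine ⟨fun n k h => ?_, fun n k h1 h2 h3 => ?_, fun n k h1 h2 h3 => ?_⟩
    · by_cases hn : n ≤ N
      · simpa [hn] using x.2.support n k (fun h' => h ⟨h'.1, h'.2, hn⟩)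
      · simp [hn]
    · simpa [h3] using x.2.strict n k h1 h2
    · simpa [h3, (by omega : n ≤ N)] using x.2.interlace n k h1 h2⟩

/-- The densely packed pattern: level `n` is `(0, 1, …, n - 1)`. -/
def densePacked (N : ℕ) : GT N :=
  ⟨fun n k => if 1 ≤ k ∧ k ≤ n ∧ n ≤ N then k - 1 else 0, by
    refine ⟨fun n k h => if_neg h, fun n k h1 h2 h3 => ?_, fun n k h1 h2 h3 => ?_⟩
    · rw [if_pos (by omega), if_pos (by omega)]; omega
    · rw [if_pos (by omega), if_pos (by omega), if_pos (by omega)]; omega⟩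

/-! ### The push-block dynamics -/

/-- The particles which move when particle `k` on level `n` jumps: this particle itself, and,
whenever particle `j` on level `m` moves and its new position `x m j + 1` is no longer strictly
below particle `j + 1` on level `m + 1`, also that particle. -/
inductive Moves (N : ℕ) (x : ℕ → ℕ → ℕ) (n k : ℕ) : ℕ → ℕ → Prop
  | self : Moves N x n k n k
  | push {m j : ℕ} : Moves N x n k m j → m + 1 ≤ N → ¬ (x m j + 1 < x (m + 1) (j + 1)) →
      Moves N x n k (m + 1) (j + 1)

/-- Particle `k` on level `n` is blocked by particle `k` on level `n - 1` (which exists if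
`k < n`). -/
def Blocked (x : ℕ → ℕ → ℕ) (n k : ℕ) : Prop := k < n ∧ x (n - 1) k = x n k

open Classical in
/-- The array after an unblocked jump of particle `k` on level `n`. -/
noncomputable def pushArray (N : ℕ) (x : ℕ → ℕ → ℕ) (n k : ℕ) : ℕ → ℕ → ℕ :=
  fun m j => if Moves N x n k m j then x m j + 1 else x m j

theorem Moves.range {N : ℕ} {x : ℕ → ℕ → ℕ} {n k m j : ℕ} (hk : 1 ≤ k) (hkn : k ≤ n) (hn : n ≤ N)
    (h : Moves N x n k m j) : 1 ≤ j ∧ j ≤ m ∧ m ≤ N := by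
  induction h with
  | self => exact ⟨hk, hkn, hn⟩
  | push _ h2 _ ih => omega

theorem Moves.not_blocked {N : ℕ} {x : ℕ → ℕ → ℕ} (hx : IsGT N x) {n k m j : ℕ} (hk : 1 ≤ k)
    (hkn : k ≤ n) (hn : n ≤ N) (hb : ¬ Blocked x n k) (h : Moves N x n k m j) :
    j < m → x m j < x (m - 1) j := by
  induction h with
  | self =>
    intro hlt
    have h1 := (hx.interlace (n - 1) k hk (by omega) (by omega)).1
    rw [Nat.sub_add_cancel (by omega)] at h1
    exact lt_of_le_of_ne h1 fun e => hb ⟨hlt, e.symm⟩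
  | @push m j h1 h2 h3 ih =>
    intro hlt
    have hr := h1.range hk hkn hn
    have h4 := ih (by omega)
    have h5 := (hx.interlace (m - 1) j hr.1 (by omega) (by omega)).2
    rw [Nat.sub_add_cancel (by omega)] at h5
    simp only [Nat.add_sub_cancel]
    omega

/-- The push-block rule preserves the interlacing. -/
theorem isGT_pushArray {N : ℕ} {x : ℕ → ℕ → ℕ} (hx : IsGT N x) {n k : ℕ} (hk : 1 ≤ k)
    (hkn : k ≤ n) (hn : n ≤ N) (hb : ¬ Blocked x n k) : IsGT N (pushArray N x n k) := by
  have key : ∀ m j, 1 ≤ j → j ≤ m → m + 1 ≤ N →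
      pushArray N x n k (m + 1) j ≤ pushArray N x n k m j ∧
        pushArray N x n k m j < pushArray N x n k (m + 1) (j + 1) := by
    intro m j hj hjm hm
    have hi := hx.interlace m j hj hjm hm
    constructor
    · by_cases h1 : Moves N x n k (m + 1) j
      · have h2 := h1.not_blocked hx hk hkn hn hb (by omega)
        simp only [Nat.add_sub_cancel] at h2
        simp only [pushArray, if_pos h1]
        split_ifs <;> omega
      · simp only [pushArray, if_neg h1]
        split_ifs <;> omega
    · by_cases h1 : Moves N x n k m j
      · by_cases h2 : Moves N x n k (m + 1) (j + 1)
        · simp only [pushArray, if_pos h1, if_pos h2]; omega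
        · have h3 : x m j + 1 < x (m + 1) (j + 1) := by
            by_contra h3
            exact h2 (h1.push hm h3)
          simpa only [pushArray, if_pos h1, if_neg h2] using h3
      · simp only [pushArray, if_neg h1]
        split_ifs <;> omega
  refine ⟨fun m j h => ?_, fun m j h1 h2 h3 => ?_, key⟩
  · have : ¬ Moves N x n k m j := fun h' => h (h'.range hk hkn hn)
    simpa only [pushArray, if_neg this] using hx.support m j h
  · obtain ⟨m, rfl⟩ : ∃ m', m = m' + 1 := ⟨m - 1, by omega⟩
    have := key m j h1 (by omega) h3
    omega

open Classical in
/-- The pattern after the clock of particle `k` on level `n` has rung. -/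
noncomputable def GT.ring {N : ℕ} (x : GT N) (n k : ℕ) : GT N :=
  if h : (1 ≤ k ∧ k ≤ n ∧ n ≤ N) ∧ ¬ Blocked x.1 n k then
    ⟨pushArray N x.1 n k, isGT_pushArray x.2 h.1.1 h.1.2.1 h.1.2.2 h.2⟩
  else x

/-- The generator of the push-block dynamics on `GT N`: the clock of each particle rings with rate
`lam` evaluated at the current position of the particle. -/
noncomputable def generator (lam : ℕ → ℝ) (N : ℕ) (f : GT N → ℝ) (x : GT N) : ℝ :=
  ∑ n ∈ Finset.Icc 1 N, ∑ k ∈ Finset.Icc 1 n, lam (x.1 n k) * (f (x.ring n k) - f x)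

/-- `X` is a push-block process on `GT N` started from the densely packed pattern: a
right-continuous jump process, which is Markov with the above (bounded) generator with respect to
the filtration `ℱ`, in the sense of the martingale problem. -/
structure IsPushBlockProcess (lam : ℕ → ℝ) (N : ℕ) {Ω : Type*} [mΩ : MeasurableSpace Ω]
    (μ : Measure Ω) (ℱ : Filtration ℝ≥0 mΩ) (X : ℝ≥0 → Ω → GT N) : Prop where
  adapted : ∀ t, Measurable[ℱ t] (X t)
  right_continuous : ∀ ω t, ∀ᶠ s in 𝓝[≥] t, X s ω = X t ω
  start : ∀ᵐ ω ∂μ, X 0 ω = densePacked N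
  martingale : ∀ f : GT N → ℝ, (∃ C, ∀ x, |f x| ≤ C) →
    Martingale (fun (t : ℝ≥0) ω =>
      f (X t ω) - ∫ s in (0 : ℝ)..t, generator lam N f (X s.toNNReal ω)) ℱ μ

/-- `X` is a push-block process on `GTInf` started from the densely packed pattern: its
projections to all `GT N` are push-block processes. -/
def IsPushBlockProcessInf (lam : ℕ → ℝ) {Ω : Type*} [mΩ : MeasurableSpace Ω]
    (μ : Measure Ω) (ℱ : Filtration ℝ≥0 mΩ) (X : ℝ≥0 → Ω → GTInf) : Prop :=
  ∀ N, IsPushBlockProcess lam N μ ℱ (fun t ω => (X t ω).trunc N)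

/-- The evolution (Kolmogorov forward) equation of the push-block dynamics, from the densely packed
pattern, for a family of laws on `GTInf`. -/
def SolvesForwardEquation (lam : ℕ → ℝ) (P : ℝ≥0 → Measure GTInf) : Prop :=
  ∀ (N : ℕ) (f : GT N → ℝ), (∃ C, ∀ x, |f x| ≤ C) → ∀ t : ℝ≥0,
    ∫ x, f (x.trunc N) ∂(P t) = f (densePacked N) +
      ∫ s in (0 : ℝ)..t, ∫ x, generator lam N f (x.trunc N) ∂(P s.toNNReal)

/-- The particle configuration of a pattern: the set of pairs (level, position). -/
def GTInf.particles (x : GTInf) : Set (ℕ × ℕ) :=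
  {z | ∃ k, 1 ≤ k ∧ k ≤ z.1 ∧ x.1 z.1 k = z.2}

/-! ### Contours and the kernel -/

/-- A closed, piecewise continuously differentiable curve, parametrised by `[0, 1]` (in place of
piecewise continuity of the derivative only its integrability is asked for). -/
structure IsContour (γ : ℝ → ℂ) : Prop where
  continuousOn : ContinuousOn γ (Set.Icc 0 1)
  closed : γ 0 = γ 1
  differentiable : ∃ S : Set ℝ, S.Finite ∧ ∀ s ∈ Set.Ioo (0 : ℝ) 1 \ S, DifferentiableAt ℝ γ s
  integrable : IntervalIntegrable (deriv γ) volume 0 1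

/-- `∮_γ f(w) dw`. -/
noncomputable def contourIntegral (γ : ℝ → ℂ) (f : ℂ → ℂ) : ℂ :=
  ∫ s in (0 : ℝ)..1, f (γ s) * deriv γ s

/-- `γ` goes around `z` once, counter-clockwise (its winding number is one). -/
def Encircles (γ : ℝ → ℂ) (z : ℂ) : Prop :=
  z ∉ γ '' Set.Icc 0 1 ∧
    (2 * Real.pi * Complex.I)⁻¹ * contourIntegral γ (fun w => (w - z)⁻¹) = 1

/-- `C` is a contour around `0` and all the points `lam x`, and `C₀` is a contour around `0` which
does not meet `C` (for instance a small circle). -/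
structure AdmissibleContours (lam : ℕ → ℝ) (C C₀ : ℝ → ℂ) : Prop where
  isContour : IsContour C
  encircles_zero : Encircles C 0
  encircles : ∀ x, Encircles C (lam x)
  isContour₀ : IsContour C₀
  encircles₀ : Encircles C₀ 0
  disjoint : Disjoint (C '' Set.Icc 0 1) (C₀ '' Set.Icc 0 1)

/-- `ψ_x(w) = ∏_{k=0}^{x} λ(k) / (λ(k) - w)`. -/
noncomputable def psi (lam : ℕ → ℝ) (x : ℕ) (w : ℂ) : ℂ :=
  ∏ k ∈ Finset.range (x + 1), (lam k : ℂ) / (lam k - w)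

/-- `p_x(w) = ∏_{k=0}^{x-1} (λ(k) - w) / λ(k)`. -/
noncomputable def pPoly (lam : ℕ → ℝ) (x : ℕ) (w : ℂ) : ℂ :=
  ∏ k ∈ Finset.range x, ((lam k : ℂ) - w) / lam k

/-- The correlation kernel `K_t(n₁, x₁; n₂, x₂)`, with `z₁ = (n₁, x₁)` and `z₂ = (n₂, x₂)`. -/
noncomputable def corrKernel (lam : ℕ → ℝ) (C C₀ : ℝ → ℂ) (t : ℝ) (z₁ z₂ : ℕ × ℕ) : ℂ :=
  (if z₁.1 < z₂.1 then
    1 / (lam z₁.2 : ℂ) * (1 / (2 * Real.pi * Complex.I)) *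
      contourIntegral C (fun w => psi lam z₁.2 w * (pPoly lam z₂.2 w / w ^ (z₂.1 - z₁.1)))
  else 0) -
  1 / (lam z₁.2 : ℂ) * (1 / (2 * Real.pi * Complex.I) ^ 2) *
    contourIntegral C (fun w => contourIntegral C₀ (fun u =>
      psi lam z₁.2 w * pPoly lam z₂.2 u * Complex.exp (-(t : ℂ) * (w - u)) *
        (w ^ ((z₁.1 : ℤ) - (z₂.1 : ℤ)) / u ^ z₂.1) *
        ((w ^ z₂.1 - u ^ z₂.1) / (w - u))))

/-!
The law at time `t` of the first `N` levels is explicit: the probability of a pattern is the product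
of `λ⁻¹` over its particles times a determinant, evaluated at the top level, of functions obtained
from the transition function of a pure birth chain by differences and sums. This density solves the
forward equation because the terms in which a jump into a given pattern is prevented by blocking or
created by pushing can be matched along the diagonals of the array. Effective jumps increase the sum
of the positions, so the forward equation is triangular and has only one solution. Consistency in
`N`, and the identification of the law of any push-block process, both follow from this uniqueness;
the law on infinite patterns is a projective limit.

For the correlations, weight every particle at one of the points `z i` by a factor `1 + s`. Summing
the weighted density over the lower levels, one level at a time, gives a determinant of row
functions, and the Cauchy–Binet identity pairs these with the birth functions `B` in a single
determinant. If `A₀` denotes the Taylor coefficients of `p_x(u) e ^ (t u)`, which are biorthogonal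
to `B`, and `T` the transitions between levels, the row functions at the points solve
`A = A₀ + s A T`, and the determinant is `det (1 + s A B)`. Since `T` strictly raises the level,
`det (1 - s T) = 1`, so this equals `det (1 + s (B A₀ - T)) = det (1 + s K)`, where `K` is the
matrix `K_t(z i, z j)`: the geometric sum `(wⁿ - uⁿ) / (w - u)` in the kernel is the sum over the
inner index of `B A₀`. As `s → ∞`, the leading coefficient gives the probability that all points
are occupied.
-/

/-! ### Contour integrals -/

section ContourIntegral

variable {γ : ℝ → ℂ} {f g : ℂ → ℂ}

theorem IsContour.intervalIntegrable (hγ : IsContour γ)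
    (hf : ContinuousOn f (γ '' Set.Icc 0 1)) :
    IntervalIntegrable (fun s => f (γ s) * deriv γ s) volume 0 1 := by
  refine hγ.integrable.continuousOn_mul ?_
  rw [Set.uIcc_of_le zero_le_one]
  exact hf.comp hγ.continuousOn (Set.mapsTo_image _ _)

theorem contourIntegral_congr (h : Set.EqOn f g (γ '' Set.Icc 0 1)) :
    contourIntegral γ f = contourIntegral γ g := by
  refine intervalIntegral.integral_congr fun s hs => ?_
  rw [Set.uIcc_of_le zero_le_one] at hs
  simp only [h (Set.mem_image_of_mem γ hs)]

theorem contourIntegral_const_mul (γ : ℝ → ℂ) (c : ℂ) (f : ℂ → ℂ) :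
    contourIntegral γ (fun w => c * f w) = c * contourIntegral γ f := by
  rw [contourIntegral, contourIntegral, ← intervalIntegral.integral_const_mul]
  simp only [mul_assoc]

theorem IsContour.integral_add (hγ : IsContour γ)
    (hf : ContinuousOn f (γ '' Set.Icc 0 1)) (hg : ContinuousOn g (γ '' Set.Icc 0 1)) :
    contourIntegral γ (fun w => f w + g w) = contourIntegral γ f + contourIntegral γ g := by
  rw [contourIntegral, contourIntegral, contourIntegral,
    ← intervalIntegral.integral_add (hγ.intervalIntegrable hf) (hγ.intervalIntegrable hg)]
  simp only [add_mul]

theorem IsContour.integral_sum (hγ : IsContour γ) {ι : Type*} (s : Finset ι)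
    {f : ι → ℂ → ℂ} (hf : ∀ i ∈ s, ContinuousOn (f i) (γ '' Set.Icc 0 1)) :
    contourIntegral γ (fun w => ∑ i ∈ s, f i w) = ∑ i ∈ s, contourIntegral γ (f i) := by
  simp only [contourIntegral, Finset.sum_mul]
  exact intervalIntegral.integral_finsetSum fun i hi => hγ.intervalIntegrable (hf i hi)

theorem IsContour.integral_sum_const_mul (hγ : IsContour γ) {ι : Type*} (s : Finset ι)
    (c : ι → ℂ) {f : ι → ℂ → ℂ} (hf : ∀ i ∈ s, ContinuousOn (f i) (γ '' Set.Icc 0 1)) :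
    contourIntegral γ (fun w => ∑ i ∈ s, c i * f i w) = ∑ i ∈ s, c i * contourIntegral γ (f i) := by
  simp only [← contourIntegral_const_mul]
  exact hγ.integral_sum s fun i hi => continuousOn_const.mul (hf i hi)

theorem IsContour.integral_eq_zero_of_hasDerivAt (hγ : IsContour γ) {F : ℂ → ℂ}
    (hF : ∀ w ∈ γ '' Set.Icc 0 1, HasDerivAt F (f w) w) (hf : ContinuousOn f (γ '' Set.Icc 0 1)) :
    contourIntegral γ f = 0 := by
  obtain ⟨S, hS, hd⟩ := hγ.differentiable
  have hFc : ContinuousOn F (γ '' Set.Icc 0 1) :=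
    fun w hw => (hF w hw).continuousAt.continuousWithinAt
  have ftc := integral_eq_of_hasDerivAt_off_countable_of_le (fun s => F (γ s))
    (fun s => f (γ s) * deriv γ s) zero_le_one hS.countable
    (hFc.comp hγ.continuousOn (Set.mapsTo_image _ _)) (fun s hs => ?_) (hγ.intervalIntegrable hf)
  · rw [contourIntegral, ftc, hγ.closed, sub_self]
  · exact (hF (γ s) (Set.mem_image_of_mem γ (Set.Ioo_subset_Icc_self hs.1))).comp_of_eq s
      (hd s hs).hasDerivAt rfl |>.congr_deriv (by ring)

theorem IsContour.integral_entire (hγ : IsContour γ) (hf : Differentiable ℂ f) :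
    contourIntegral γ f = 0 := by
  obtain ⟨F, hF⟩ := hf.isExactOn_univ
  exact hγ.integral_eq_zero_of_hasDerivAt (fun w _ => hF w (Set.mem_univ w))
    hf.continuous.continuousOn

theorem Encircles.integral_sub_inv {z : ℂ} (h : Encircles γ z) :
    contourIntegral γ (fun w => (w - z)⁻¹) = 2 * Real.pi * Complex.I := by
  have := h.2
  rwa [inv_mul_eq_iff_eq_mul₀ Complex.two_pi_I_ne_zero, mul_one] at this

theorem sub_ne_zero_of_mem_of_notMem {S : Set ℂ} {w a : ℂ} (hw : w ∈ S) (ha : a ∉ S) : w - a ≠ 0 :=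
  fun h => ha (sub_eq_zero.1 h ▸ hw)

theorem IsContour.integral_sub_inv_pow (hγ : IsContour γ) {a : ℂ}
    (ha : a ∉ γ '' Set.Icc 0 1) (n : ℕ) :
    contourIntegral γ (fun w => ((w - a)⁻¹) ^ (n + 2)) = 0 := by
  have hne : ∀ w ∈ γ '' Set.Icc 0 1, w - a ≠ 0 := fun w hw => sub_ne_zero_of_mem_of_notMem hw ha
  refine hγ.integral_eq_zero_of_hasDerivAt
    (F := fun w => -((n : ℂ) + 1)⁻¹ * ((w - a)⁻¹) ^ (n + 1)) (fun w hw => ?_)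
    ((ContinuousOn.inv₀ (by fun_prop) hne).pow _)
  have hn : ((n : ℂ) + 1) ≠ 0 := Nat.cast_add_one_ne_zero n
  have hwa := hne w hw
  refine (((((hasDerivAt_id w).sub_const a).inv hwa).pow (n + 1)).const_mul
    (-((n : ℂ) + 1)⁻¹)).congr_deriv ?_
  simp only [id, Nat.add_sub_cancel, Nat.cast_add, Nat.cast_one, Pi.inv_apply, pow_add]
  generalize (w - a)⁻¹ ^ n = q
  field_simp

/-- The product of the simple poles `(w - a)⁻¹` over the points `a` of a multiset; the
denominators of the integrands are products of this kind. -/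
noncomputable def poleProd (s : Multiset ℂ) (w : ℂ) : ℂ := (s.map fun a => (w - a)⁻¹).prod

theorem poleProd_zero : poleProd 0 = fun _ => 1 := by
  funext _
  simp [poleProd]

theorem poleProd_cons (a : ℂ) (s : Multiset ℂ) (w : ℂ) :
    poleProd (a ::ₘ s) w = (w - a)⁻¹ * poleProd s w := by
  rw [poleProd, Multiset.map_cons, Multiset.prod_cons, poleProd]

theorem poleProd_add (s t : Multiset ℂ) (w : ℂ) :
    poleProd (s + t) w = poleProd s w * poleProd t w := by
  rw [poleProd, Multiset.map_add, Multiset.prod_add, poleProd, poleProd]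

theorem continuousOn_poleProd {S : Set ℂ} {s : Multiset ℂ} (hs : ∀ a ∈ s, a ∉ S) :
    ContinuousOn (poleProd s) S := by
  induction s using Multiset.induction with
  | empty => exact poleProd_zero ▸ continuousOn_const
  | cons a s ih =>
    simp only [funext (poleProd_cons a s)]
    exact (ContinuousOn.inv₀ (by fun_prop) fun w hw =>
      sub_ne_zero_of_mem_of_notMem hw (hs a (Multiset.mem_cons_self a s))).mul
      (ih fun b hb => hs b (Multiset.mem_cons_of_mem hb))

theorem differentiable_dslope {E : ℂ → ℂ} (hE : Differentiable ℂ E) (a : ℂ) :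
    Differentiable ℂ (dslope E a) := by
  rw [← differentiableOn_univ]
  exact (Complex.differentiableOn_dslope univ_mem).2 hE.differentiableOn

theorem IsContour.integral_mul_poleProd_cons (hγ : IsContour γ) {E : ℂ → ℂ}
    (hE : Differentiable ℂ E) {a : ℂ} {s : Multiset ℂ} (hs : ∀ b ∈ a ::ₘ s, b ∉ γ '' Set.Icc 0 1) :
    contourIntegral γ (fun w => E w * poleProd (a ::ₘ s) w) =
      E a * contourIntegral γ (poleProd (a ::ₘ s)) +
        contourIntegral γ (fun w => dslope E a w * poleProd s w) := by
  rw [← contourIntegral_const_mul, ← hγ.integral_add (f := fun w => E a * poleProd (a ::ₘ s) w)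
    (g := fun w => dslope E a w * poleProd s w)
    (continuousOn_const.mul (continuousOn_poleProd hs))
    ((differentiable_dslope hE a).continuous.continuousOn.mul
      (continuousOn_poleProd fun b hb => hs b (Multiset.mem_cons_of_mem hb)))]
  refine contourIntegral_congr fun w hw => ?_
  have hwa := sub_ne_zero_of_mem_of_notMem hw (hs a (Multiset.mem_cons_self a s))
  have taylor : E w = E a + (w - a) * dslope E a w := by
    rw [← smul_eq_mul, sub_smul_dslope]
    ring
  simp only [poleProd_cons, taylor]
  field_simp

theorem IsContour.integral_poleProd_cons_cons (hγ : IsContour γ) {a b : ℂ} (hab : a ≠ b)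
    {s : Multiset ℂ} (hs : ∀ c ∈ a ::ₘ b ::ₘ s, c ∉ γ '' Set.Icc 0 1) :
    contourIntegral γ (poleProd (a ::ₘ b ::ₘ s)) =
      (a - b)⁻¹ * contourIntegral γ (poleProd (a ::ₘ s)) +
        -(a - b)⁻¹ * contourIntegral γ (poleProd (b ::ₘ s)) := by
  simp only [Multiset.forall_mem_cons] at hs
  obtain ⟨ha, hb, hs⟩ := hs
  rw [← contourIntegral_const_mul, ← contourIntegral_const_mul, ← hγ.integral_add
    (f := fun w => (a - b)⁻¹ * poleProd (a ::ₘ s) w)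
    (g := fun w => -(a - b)⁻¹ * poleProd (b ::ₘ s) w)
    (continuousOn_const.mul (continuousOn_poleProd (Multiset.forall_mem_cons.2 ⟨ha, hs⟩)))
    (continuousOn_const.mul (continuousOn_poleProd (Multiset.forall_mem_cons.2 ⟨hb, hs⟩)))]
  refine contourIntegral_congr fun w hw => ?_
  have hwa := sub_ne_zero_of_mem_of_notMem hw ha
  have hwb := sub_ne_zero_of_mem_of_notMem hw hb
  have hab' := sub_ne_zero.2 hab
  simp only [poleProd_cons]
  field_simp
  ring

variable {γ' : ℝ → ℂ}

theorem IsContour.integral_poleProd_eq (hγ : IsContour γ) (hγ' : IsContour γ') (s : Multiset ℂ)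
    (h : ∀ a ∈ s, Encircles γ a) (h' : ∀ a ∈ s, Encircles γ' a) :
    contourIntegral γ (poleProd s) = contourIntegral γ' (poleProd s) := by
  induction hn : s.card using Nat.strong_induction_on generalizing s with
  | _ n ih =>
  induction s using Multiset.induction with
  | empty =>
    have hconst : Differentiable ℂ (poleProd 0) := poleProd_zero ▸ differentiable_const _
    rw [hγ.integral_entire hconst, hγ'.integral_entire hconst]
  | cons a s _ =>
    have ha := h a (Multiset.mem_cons_self a s)
    have ha' := h' a (Multiset.mem_cons_self a s)
    by_cases hall : ∀ b ∈ s, b = a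
    · obtain ⟨m, rfl⟩ : ∃ m, s = Multiset.replicate m a :=
        ⟨_, Multiset.eq_replicate.2 ⟨rfl, hall⟩⟩
      have hpow : poleProd (a ::ₘ Multiset.replicate m a) = fun w => ((w - a)⁻¹) ^ (m + 1) :=
        funext fun w => by rw [poleProd_cons, poleProd, Multiset.map_replicate,
          Multiset.prod_replicate, pow_succ']
      rw [hpow]
      cases m with
      | zero => simp only [zero_add, pow_one, ha.integral_sub_inv, ha'.integral_sub_inv]
      | succ m => rw [hγ.integral_sub_inv_pow ha.1, hγ'.integral_sub_inv_pow ha'.1]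
    · push Not at hall
      obtain ⟨b, hb, hba⟩ := hall
      obtain ⟨t, rfl⟩ := Multiset.exists_cons_of_mem hb
      rw [hγ.integral_poleProd_cons_cons hba.symm fun c hc => (h c hc).1,
        hγ'.integral_poleProd_cons_cons hba.symm fun c hc => (h' c hc).1]
      simp only [Multiset.forall_mem_cons, Multiset.card_cons] at h h' hn
      rw [ih (t.card + 1) (by omega) (a ::ₘ t) (Multiset.forall_mem_cons.2 ⟨h.1, h.2.2⟩)
          (Multiset.forall_mem_cons.2 ⟨h'.1, h'.2.2⟩) (Multiset.card_cons _ _),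
        ih (t.card + 1) (by omega) (b ::ₘ t) (Multiset.forall_mem_cons.2 h.2)
          (Multiset.forall_mem_cons.2 h'.2) (Multiset.card_cons _ _)]

theorem IsContour.integral_mul_poleProd_eq (hγ : IsContour γ) (hγ' : IsContour γ')
    (s : Multiset ℂ) (h : ∀ a ∈ s, Encircles γ a) (h' : ∀ a ∈ s, Encircles γ' a) {E : ℂ → ℂ}
    (hE : Differentiable ℂ E) :
    contourIntegral γ (fun w => E w * poleProd s w) =
      contourIntegral γ' (fun w => E w * poleProd s w) := by
  induction s using Multiset.induction generalizing E with
  | empty => simp [poleProd, hγ.integral_entire hE, hγ'.integral_entire hE]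
  | cons a s ih =>
    rw [hγ.integral_mul_poleProd_cons hE fun b hb => (h b hb).1,
      hγ'.integral_mul_poleProd_cons hE fun b hb => (h' b hb).1,
      hγ.integral_poleProd_eq hγ' _ h h',
      ih (fun b hb => h b (Multiset.mem_cons_of_mem hb))
        (fun b hb => h' b (Multiset.mem_cons_of_mem hb)) (differentiable_dslope hE a)]

end ContourIntegral

section CircleContour

/-- The circle with centre `c` and radius `R`, traversed once counter-clockwise over `[0, 1]`. -/
noncomputable def circleContour (c : ℂ) (R : ℝ) (s : ℝ) : ℂ := circleMap c R (2 * Real.pi * s)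

variable {c z : ℂ} {R : ℝ}

theorem hasDerivAt_circleContour (c : ℂ) (R s : ℝ) :
    HasDerivAt (circleContour c R)
      ((2 * Real.pi : ℝ) * deriv (circleMap c R) (2 * Real.pi * s)) s := by
  have h := (differentiable_circleMap c R (2 * Real.pi * s)).hasDerivAt.scomp s
    ((hasDerivAt_id s).const_mul (2 * Real.pi))
  simpa [Function.comp_def, funext (g := fun s => circleMap c R (2 * Real.pi * s))
    fun s => (rfl : circleContour c R s = _)] using h

theorem contourIntegral_circleContour (c : ℂ) (R : ℝ) (f : ℂ → ℂ) :
    contourIntegral (circleContour c R) f = ∮ z in C(c, R), f z := by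
  have h := intervalIntegral.smul_integral_comp_mul_left
    (f := fun θ => deriv (circleMap c R) θ • f (circleMap c R θ)) (a := 0) (b := 1)
    (2 * Real.pi)
  rw [mul_zero, mul_one] at h
  rw [contourIntegral, circleIntegral, ← h, ← intervalIntegral.integral_smul]
  refine intervalIntegral.integral_congr fun s _ => ?_
  simp only [(hasDerivAt_circleContour c R s).deriv, circleContour, smul_eq_mul,
    Complex.real_smul]
  ring

theorem isContour_circleContour (c : ℂ) (R : ℝ) : IsContour (circleContour c R) where
  continuousOn := fun s _ => (hasDerivAt_circleContour c R s).continuousAt.continuousWithinAt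
  closed := by simp [circleContour, circleMap]
  differentiable :=
    ⟨∅, Set.finite_empty, fun s _ => (hasDerivAt_circleContour c R s).differentiableAt⟩
  integrable := by
    rw [funext fun s => (hasDerivAt_circleContour c R s).deriv]
    refine Continuous.intervalIntegrable ?_ _ _
    simp only [deriv_circleMap]
    fun_prop

theorem image_circleContour_subset_sphere (hR : 0 ≤ R) :
    circleContour c R '' Set.Icc 0 1 ⊆ Metric.sphere c R := by
  rintro - ⟨s, -, rfl⟩
  exact circleMap_mem_sphere c hR _

theorem encircles_circleContour (hz : z ∈ Metric.ball c R) : Encircles (circleContour c R) z := by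
  have hR : 0 ≤ R := dist_nonneg.trans (Metric.mem_ball.1 hz).le
  refine ⟨fun h => (Metric.mem_ball.1 hz).ne (image_circleContour_subset_sphere hR h), ?_⟩
  rw [contourIntegral_circleContour, circleIntegral.integral_sub_inv_of_mem_ball hz]
  exact inv_mul_cancel₀ Complex.two_pi_I_ne_zero

end CircleContour

/-! ### Functions with prescribed poles -/

/-- Off `S`, the function `f` is the quotient of an entire function and a finite product of linear
factors vanishing at points of `S`; its values on `S` are arbitrary. -/
def HasPolesIn (S : Set ℂ) (f : ℂ → ℂ) : Prop :=
  ∃ (s : Multiset ℂ) (E : ℂ → ℂ), (∀ a ∈ s, a ∈ S) ∧ Differentiable ℂ E ∧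
    ∀ w ∉ S, f w = E w * poleProd s w

/-- `γ` is a contour going once around every point of `S`. -/
structure EncirclesAll (γ : ℝ → ℂ) (S : Set ℂ) : Prop where
  isContour : IsContour γ
  encircles : ∀ a ∈ S, Encircles γ a

theorem EncirclesAll.disjoint {γ : ℝ → ℂ} {S : Set ℂ} (hγ : EncirclesAll γ S) :
    Disjoint (γ '' Set.Icc 0 1) S :=
  Set.disjoint_left.2 fun w hw hS => (hγ.encircles w hS).1 hw

namespace HasPolesIn

variable {S T : Set ℂ} {f g : ℂ → ℂ}

theorem mono (hf : HasPolesIn S f) (hST : S ⊆ T) : HasPolesIn T f :=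
  let ⟨s, E, hs, hE, h⟩ := hf
  ⟨s, E, fun a ha => hST (hs a ha), hE, fun w hw => h w fun hwS => hw (hST hwS)⟩

theorem of_entire (hf : Differentiable ℂ f) : HasPolesIn S f :=
  ⟨0, f, by simp, hf, by simp [poleProd]⟩

theorem mul (hf : HasPolesIn S f) (hg : HasPolesIn S g) : HasPolesIn S (fun w => f w * g w) := by
  obtain ⟨s, E, hs, hE, h⟩ := hf
  obtain ⟨s', E', hs', hE', h'⟩ := hg
  refine ⟨s + s', fun w => E w * E' w, fun a ha => ?_, hE.mul hE', fun w hw => ?_⟩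
  · exact (Multiset.mem_add.1 ha).elim (hs a) (hs' a)
  · simp only [h w hw, h' w hw, poleProd_add]
    ring

theorem sub_inv {a : ℂ} (ha : a ∈ S) : HasPolesIn S (fun w => (w - a)⁻¹) :=
  ⟨{a}, fun _ => 1, by simpa using ha, differentiable_const _, by simp [poleProd]⟩

theorem const_mul (hf : HasPolesIn S f) (c : ℂ) : HasPolesIn S (fun w => c * f w) :=
  (of_entire (differentiable_const c)).mul hf

theorem inv (h0 : (0 : ℂ) ∈ S) : HasPolesIn S (fun w => w⁻¹) := by
  simpa only [sub_zero] using sub_inv h0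

theorem pow (hf : HasPolesIn S f) (n : ℕ) : HasPolesIn S (fun w => f w ^ n) := by
  induction n with
  | zero => simpa using of_entire (differentiable_const _)
  | succ n ih => simpa only [pow_succ] using ih.mul hf

theorem zpow (h0 : (0 : ℂ) ∈ S) (m : ℤ) : HasPolesIn S (fun w => w ^ m) := by
  rcases m with n | n
  · simpa using of_entire (f := fun w => w ^ n) (by fun_prop)
  · simpa only [zpow_negSucc, inv_pow] using (inv h0).pow (n + 1)

theorem const_div_sub {a : ℂ} (ha : a ∈ S) (c : ℂ) : HasPolesIn S (fun w => c / (a - w)) := by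
  simpa only [← div_eq_mul_inv, neg_div, ← div_neg, neg_sub] using (sub_inv ha).const_mul (-c)

theorem prod {ι : Type*} (s : Finset ι) {F : ι → ℂ → ℂ} (h : ∀ i ∈ s, HasPolesIn S (F i)) :
    HasPolesIn S (fun w => ∏ i ∈ s, F i w) := by
  classical
  induction s using Finset.induction_on with
  | empty => simpa using of_entire (differentiable_const _)
  | insert a s ha ih =>
    simp only [Finset.prod_insert ha]
    exact (h a (Finset.mem_insert_self a s)).mul
      (ih fun i hi => h i (Finset.mem_insert_of_mem hi))

variable {γ γ' : ℝ → ℂ}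

theorem continuousOn (hf : HasPolesIn S f) (hγ : EncirclesAll γ S) :
    ContinuousOn f (γ '' Set.Icc 0 1) := by
  obtain ⟨s, E, hs, hE, h⟩ := hf
  refine ContinuousOn.congr (f := fun w => E w * poleProd s w) ?_
    fun w hw => h w (Set.disjoint_left.1 hγ.disjoint hw)
  exact hE.continuous.continuousOn.mul
    (continuousOn_poleProd fun a ha => (hγ.encircles a (hs a ha)).1)

theorem contourIntegral_eq (hf : HasPolesIn S f) (hγ : EncirclesAll γ S)
    (hγ' : EncirclesAll γ' S) : contourIntegral γ f = contourIntegral γ' f := by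
  obtain ⟨s, E, hs, hE, h⟩ := hf
  rw [contourIntegral_congr fun w hw => h w (Set.disjoint_left.1 hγ.disjoint hw),
    contourIntegral_congr fun w hw => h w (Set.disjoint_left.1 hγ'.disjoint hw)]
  exact hγ.isContour.integral_mul_poleProd_eq hγ'.isContour s
    (fun a ha => hγ.encircles a (hs a ha)) (fun a ha => hγ'.encircles a (hs a ha)) hE

end HasPolesIn

/-! ### Residue sums -/

/-- The rates are positive and bounded above. -/
structure BoundedRates (lam : ℕ → ℝ) : Prop where
  pos : ∀ x, 0 < lam x
  bddAbove : BddAbove (Set.range lam)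

theorem UniformlyBounded.boundedRates {lam : ℕ → ℝ} (h : UniformlyBounded lam) :
    BoundedRates lam := by
  obtain ⟨s, M, hs, hM⟩ := h
  exact ⟨fun x => hs.trans_le (hM x).1, M, Set.forall_mem_range.2 fun x => (hM x).2⟩

/-- The points encircled by the contour `C_λ`: the origin and the rates. -/
def poles (lam : ℕ → ℝ) : Set ℂ := insert 0 (Set.range fun x => (lam x : ℂ))

/-- The supremum of the rates. -/
noncomputable def rateSup (lam : ℕ → ℝ) : ℝ := ⨆ x, lam x

/-- The sum of the residues at the points of `poles lam`, for functions with poles there. For a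
function with poles in `poles lam` any large circle gives the same value; the factor `3` is the one
for which `birthFun` decays faster than the growth allowed by `SlowGrowth`. -/
noncomputable def residueSum (lam : ℕ → ℝ) (f : ℂ → ℂ) : ℂ :=
  (2 * Real.pi * Complex.I)⁻¹ * contourIntegral (circleContour 0 (3 * rateSup lam)) f

section Poles

variable {lam : ℕ → ℝ}

theorem zero_mem_poles (lam : ℕ → ℝ) : (0 : ℂ) ∈ poles lam := Set.mem_insert _ _

theorem rate_mem_poles (lam : ℕ → ℝ) (x : ℕ) : (lam x : ℂ) ∈ poles lam :=
  Set.mem_insert_of_mem _ ⟨x, rfl⟩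

theorem ne_zero_of_notMem_poles {w : ℂ} (hw : w ∉ poles lam) : w ≠ 0 :=
  fun h => hw (h ▸ zero_mem_poles lam)

theorem rate_sub_ne_zero {w : ℂ} (hw : w ∉ poles lam) (x : ℕ) : (lam x : ℂ) - w ≠ 0 :=
  sub_ne_zero_of_mem_of_notMem (rate_mem_poles lam x) hw

namespace BoundedRates

theorem ne_zero (h : BoundedRates lam) (x : ℕ) : (lam x : ℂ) ≠ 0 :=
  Complex.ofReal_ne_zero.2 (h.pos x).ne'

theorem le_rateSup (h : BoundedRates lam) (x : ℕ) : lam x ≤ rateSup lam := le_ciSup h.bddAbove x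

theorem rateSup_pos (h : BoundedRates lam) : 0 < rateSup lam := (h.pos 0).trans_le (h.le_rateSup 0)

theorem norm_rate (h : BoundedRates lam) (x : ℕ) : ‖(lam x : ℂ)‖ = lam x := by
  rw [Complex.norm_real, Real.norm_eq_abs, abs_of_pos (h.pos x)]

theorem norm_le_rateSup (h : BoundedRates lam) {w : ℂ} (hw : w ∈ poles lam) :
    ‖w‖ ≤ rateSup lam := by
  rcases hw with rfl | ⟨x, rfl⟩
  · simpa only [norm_zero] using h.rateSup_pos.le
  · exact (h.norm_rate x).trans_le (h.le_rateSup x)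

theorem encirclesAll_circleContour (h : BoundedRates lam) {R : ℝ} (hR : rateSup lam < R) :
    EncirclesAll (circleContour 0 R) (poles lam) where
  isContour := isContour_circleContour 0 R
  encircles _ hw :=
    encircles_circleContour (mem_ball_zero_iff.2 ((h.norm_le_rateSup hw).trans_lt hR))

theorem encirclesAll_circleContour_three (h : BoundedRates lam) :
    EncirclesAll (circleContour 0 (3 * rateSup lam)) (poles lam) :=
  h.encirclesAll_circleContour (by linarith [h.rateSup_pos])

end BoundedRates

theorem HasPolesIn.contourIntegral_eq_residueSum (h : BoundedRates lam) {f : ℂ → ℂ}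
    (hf : HasPolesIn (poles lam) f) {γ : ℝ → ℂ} (hγ : EncirclesAll γ (poles lam)) :
    contourIntegral γ f = 2 * Real.pi * Complex.I * residueSum lam f := by
  rw [residueSum, mul_inv_cancel_left₀ Complex.two_pi_I_ne_zero,
    hf.contourIntegral_eq hγ h.encirclesAll_circleContour_three]

end Poles

section ResidueSum

variable {lam : ℕ → ℝ} {f g : ℂ → ℂ}

theorem residueSum_const_mul (c : ℂ) :
    residueSum lam (fun w => c * f w) = c * residueSum lam f := by
  rw [residueSum, contourIntegral_const_mul, residueSum, mul_left_comm]

theorem residueSum_add (h : BoundedRates lam) (hf : HasPolesIn (poles lam) f)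
    (hg : HasPolesIn (poles lam) g) :
    residueSum lam (fun w => f w + g w) = residueSum lam f + residueSum lam g := by
  rw [residueSum, (isContour_circleContour _ _).integral_add
    (hf.continuousOn h.encirclesAll_circleContour_three)
    (hg.continuousOn h.encirclesAll_circleContour_three), mul_add, residueSum, residueSum]

theorem residueSum_sub (h : BoundedRates lam) (hf : HasPolesIn (poles lam) f)
    (hg : HasPolesIn (poles lam) g) :
    residueSum lam (fun w => f w - g w) = residueSum lam f - residueSum lam g := by
  rw [sub_eq_add_neg, ← neg_one_mul (residueSum lam g), ← residueSum_const_mul,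
    ← residueSum_add h hf (hg.const_mul (-1))]
  simp only [neg_one_mul, sub_eq_add_neg]

theorem residueSum_congr (h : BoundedRates lam) (hfg : ∀ w ∉ poles lam, f w = g w) :
    residueSum lam f = residueSum lam g := by
  rw [residueSum, residueSum, contourIntegral_congr fun w hw => hfg w
    (Set.disjoint_left.1 h.encirclesAll_circleContour_three.disjoint hw)]

theorem residueSum_entire (hf : Differentiable ℂ f) : residueSum lam f = 0 := by
  rw [residueSum, (isContour_circleContour _ _).integral_entire hf, mul_zero]

theorem residueSum_inv (h : BoundedRates lam) : residueSum lam (fun w => w⁻¹) = 1 := by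
  simpa only [sub_zero, residueSum] using
    (h.encirclesAll_circleContour_three.encircles 0 (zero_mem_poles lam)).2

theorem residueSum_mul_inv (h : BoundedRates lam) (hf : Differentiable ℂ f) :
    residueSum lam (fun w => f w * w⁻¹) = f 0 := by
  have split : ∀ w ∉ poles lam, f w * w⁻¹ = f 0 * w⁻¹ + dslope f 0 w := by
    intro w hw
    have hw0 := ne_zero_of_notMem_poles hw
    rw [dslope_of_ne _ hw0, slope_def_field]
    field_simp
    ring
  have hd := differentiable_dslope hf 0
  rw [residueSum_congr h split, residueSum_add h
    ((HasPolesIn.inv (zero_mem_poles lam)).const_mul _) (.of_entire hd), residueSum_entire hd,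
    residueSum_const_mul, residueSum_inv h, add_zero, mul_one]

theorem norm_residueSum_le (h : BoundedRates lam) {R : ℝ} (hR : rateSup lam < R)
    (hf : HasPolesIn (poles lam) f) {B : ℝ} (hB : ∀ w : ℂ, ‖w‖ = R → ‖f w‖ ≤ B) :
    ‖residueSum lam f‖ ≤ R * B := by
  have circle : residueSum lam f = (2 * Real.pi * Complex.I)⁻¹ • ∮ z in C(0, R), f z := by
    rw [← contourIntegral_circleContour,
      hf.contourIntegral_eq_residueSum h (h.encirclesAll_circleContour hR), smul_eq_mul,
      inv_mul_cancel_left₀ Complex.two_pi_I_ne_zero]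
  rw [circle]
  exact circleIntegral.norm_two_pi_i_inv_smul_integral_le_of_norm_le_const
    (h.rateSup_pos.trans hR).le fun z hz => hB z (mem_sphere_zero_iff_norm.1 hz)

theorem residueSum_eq_zero_of_norm_le (h : BoundedRates lam) (hf : HasPolesIn (poles lam) f)
    (B : ℝ) (hB : ∀ w : ℂ, 2 * rateSup lam ≤ ‖w‖ → ‖f w‖ ≤ B / ‖w‖ ^ 2) :
    residueSum lam f = 0 := by
  have hM := h.rateSup_pos
  have bound : ∀ᶠ R : ℝ in atTop, ‖residueSum lam f‖ ≤ B / R := by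
    filter_upwards [eventually_ge_atTop (2 * rateSup lam)] with R hR
    have hR0 : 0 < R := by linarith
    refine (norm_residueSum_le h (by linarith) hf
      fun w hw => hw ▸ hB w (hw.symm ▸ hR)).trans_eq ?_
    field_simp
  exact norm_le_zero_iff.1 (ge_of_tendsto (tendsto_const_nhds.div_atTop tendsto_id) bound)

theorem residueSum_deriv_exp_mul_inv_pow (h : BoundedRates lam) (a : ℂ) (n : ℕ) :
    residueSum lam (fun w => a * (Complex.exp (a * w) * w⁻¹ ^ n) -
      n * (Complex.exp (a * w) * w⁻¹ ^ (n + 1))) = 0 := by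
  have hC := h.encirclesAll_circleContour_three
  have hpow (k : ℕ) : HasPolesIn (poles lam) fun w => Complex.exp (a * w) * w⁻¹ ^ k :=
    (HasPolesIn.of_entire (by fun_prop)).mul ((HasPolesIn.inv (zero_mem_poles lam)).pow k)
  refine mul_eq_zero_of_right _ (hC.isContour.integral_eq_zero_of_hasDerivAt
    (F := fun w => Complex.exp (a * w) * w⁻¹ ^ n) (fun w hw => ?_)
    ((((hpow n).const_mul a).continuousOn hC).sub (((hpow (n + 1)).const_mul n).continuousOn hC)))
  have hw0 := ne_zero_of_notMem_poles (Set.disjoint_left.1 hC.disjoint hw)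
  refine ((((hasDerivAt_id w).const_mul a).cexp).mul
    ((hasDerivAt_inv hw0).pow n)).congr_deriv ?_
  rcases n with _ | n
  · simp [mul_comm]
  · simp only [id, Nat.add_sub_cancel, Nat.cast_add, Nat.cast_one, pow_succ, Pi.pow_apply]
    generalize w⁻¹ ^ n = q
    field_simp
    ring

theorem residueSum_exp_mul_inv_pow (h : BoundedRates lam) (a : ℂ) (n : ℕ) :
    residueSum lam (fun w => Complex.exp (a * w) * w⁻¹ ^ (n + 1)) = a ^ n / n.factorial := by
  induction n with
  | zero => simpa using residueSum_mul_inv h (f := fun w => Complex.exp (a * w)) (by fun_prop)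
  | succ n ih =>
    have hpow (k : ℕ) : HasPolesIn (poles lam) fun w => Complex.exp (a * w) * w⁻¹ ^ k :=
      (HasPolesIn.of_entire (by fun_prop)).mul ((HasPolesIn.inv (zero_mem_poles lam)).pow k)
    have recursion := residueSum_deriv_exp_mul_inv_pow h a (n + 1)
    rw [residueSum_sub h ((hpow _).const_mul a) ((hpow _).const_mul _), residueSum_const_mul,
      residueSum_const_mul, ih, sub_eq_zero] at recursion
    rw [eq_div_iff (Nat.cast_ne_zero.2 (n + 1).factorial_ne_zero), Nat.factorial_succ,
      Nat.cast_mul, ← mul_assoc, mul_comm (residueSum _ _), ← recursion, mul_assoc,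
      div_mul_cancel₀ _ (Nat.cast_ne_zero.2 n.factorial_ne_zero), pow_succ']

end ResidueSum

/-! ### The functions entering the kernel -/

/-- The product `∏_{k < x} λ(k) / (λ(k) - w)`, which is `ψ_{x - 1}(w)`; the shift of the index
makes the empty product available at `x = 0`. -/
noncomputable def shiftedPsi (lam : ℕ → ℝ) (x : ℕ) (w : ℂ) : ℂ :=
  ∏ k ∈ Finset.range x, (lam k : ℂ) / (lam k - w)

/-- The residue sum of `-ψ_{x - 1}(w) w ^ m e ^ (-t w)`. Up to sign and a rate, `m = 0` gives the
transition function of the pure birth chain started from `0`; its differences and sums in `x` are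
given by the other values of `m`. -/
noncomputable def birthFun (lam : ℕ → ℝ) (m : ℤ) (t : ℝ) (x : ℕ) : ℂ :=
  -residueSum lam (fun w => shiftedPsi lam x w * w ^ m * Complex.exp (-(t : ℂ) * w))

/-- The coefficient of `u ^ i` in the Taylor expansion of `p_x(u) e ^ (t u)` at `0`. -/
noncomputable def taylorCoeff (lam : ℕ → ℝ) (t : ℝ) (i x : ℕ) : ℂ :=
  residueSum lam (fun u => pPoly lam x u * Complex.exp (t * u) * u⁻¹ ^ (i + 1))

/-- The `j`-step transition function `∮ ψ_y(w) p_x(w) w ^ (-j) dw / (2 π i)` between levels, as in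
the single integral of the correlation kernel. -/
noncomputable def transFun (lam : ℕ → ℝ) (j y x : ℕ) : ℂ :=
  residueSum lam (fun w => shiftedPsi lam (y + 1) w * pPoly lam x w * w⁻¹ ^ j)

section KernelFunctions

variable {lam : ℕ → ℝ}

theorem shiftedPsi_succ (lam : ℕ → ℝ) (x : ℕ) (w : ℂ) :
    shiftedPsi lam (x + 1) w = shiftedPsi lam x w * ((lam x : ℂ) / (lam x - w)) :=
  Finset.prod_range_succ _ _

theorem pPoly_succ (lam : ℕ → ℝ) (x : ℕ) (w : ℂ) :
    pPoly lam (x + 1) w = pPoly lam x w * (((lam x : ℂ) - w) / lam x) :=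
  Finset.prod_range_succ _ _

theorem pPoly_apply_zero (h : ∀ x, (lam x : ℂ) ≠ 0) (x : ℕ) : pPoly lam x 0 = 1 :=
  Finset.prod_eq_one fun k _ => by rw [sub_zero, div_self (h k)]

theorem differentiable_pPoly (lam : ℕ → ℝ) (x : ℕ) : Differentiable ℂ (pPoly lam x) := by
  unfold pPoly
  fun_prop

theorem differentiable_exp_mul (a : ℂ) : Differentiable ℂ fun w => Complex.exp (a * w) := by
  fun_prop

theorem hasPolesIn_shiftedPsi (lam : ℕ → ℝ) (x : ℕ) :
    HasPolesIn (poles lam) (shiftedPsi lam x) :=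
  HasPolesIn.prod _ fun k _ => .const_div_sub (rate_mem_poles lam k) _

theorem shiftedPsi_mul_pPoly (h : ∀ x, (lam x : ℂ) ≠ 0) {w : ℂ} (hw : w ∉ poles lam) (x : ℕ) :
    shiftedPsi lam x w * pPoly lam x w = 1 := by
  rw [shiftedPsi, pPoly, ← Finset.prod_mul_distrib]
  exact Finset.prod_eq_one fun k _ => by
    rw [div_mul_div_cancel₀ (rate_sub_ne_zero hw k), div_self (h k)]

namespace BoundedRates

theorem norm_rate_div_sub_le (h : BoundedRates lam) {w : ℂ} (hw : rateSup lam < ‖w‖) (k : ℕ) :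
    ‖(lam k : ℂ) / (lam k - w)‖ ≤ lam k / (‖w‖ - lam k) := by
  have hdist : ‖w‖ - lam k ≤ ‖(lam k : ℂ) - w‖ := by
    simpa only [h.norm_rate, norm_sub_rev] using norm_sub_norm_le w (lam k : ℂ)
  rw [norm_div, h.norm_rate]
  exact div_le_div_of_nonneg_left (h.pos k).le (sub_pos.2 ((h.le_rateSup k).trans_lt hw)) hdist

end BoundedRates

/-! #### Birth functions -/

theorem hasPolesIn_birthFun (lam : ℕ → ℝ) (m : ℤ) (t : ℝ) (x : ℕ) :
    HasPolesIn (poles lam) (fun w => shiftedPsi lam x w * w ^ m * Complex.exp (-(t : ℂ) * w)) :=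
  ((hasPolesIn_shiftedPsi lam x).mul (.zpow (zero_mem_poles lam) m)).mul
    (.of_entire (differentiable_exp_mul _))

theorem birthFun_succ (h : BoundedRates lam) (m : ℤ) (t : ℝ) (x : ℕ) :
    birthFun lam (m + 1) t (x + 1) =
      lam x * (birthFun lam m t (x + 1) - birthFun lam m t x) := by
  rw [birthFun, birthFun, birthFun, neg_sub_neg, ← residueSum_sub h (hasPolesIn_birthFun lam m t x)
    (hasPolesIn_birthFun lam m t (x + 1)), ← residueSum_const_mul, ← neg_one_mul,
    ← residueSum_const_mul]
  refine residueSum_congr h fun w hw => ?_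
  have hwx := rate_sub_ne_zero hw x
  rw [shiftedPsi_succ, zpow_add_one₀ (ne_zero_of_notMem_poles hw)]
  generalize w ^ m = q
  field_simp
  ring

theorem birthFun_sub (h : BoundedRates lam) (m : ℤ) (t : ℝ) (x : ℕ) :
    birthFun lam (m - 1) t (x + 1) - birthFun lam (m - 1) t x =
      birthFun lam m t (x + 1) / lam x := by
  rw [eq_div_iff (h.ne_zero x), mul_comm, ← birthFun_succ h, sub_add_cancel]

theorem birthFun_natCast_zero (lam : ℕ → ℝ) (n : ℕ) (t : ℝ) : birthFun lam n t 0 = 0 := by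
  rw [birthFun, residueSum_entire, neg_zero]
  simp only [shiftedPsi, Finset.range_zero, Finset.prod_empty, one_mul, zpow_natCast]
  fun_prop

theorem zpow_neg_natCast_sub_one (w : ℂ) (n : ℕ) : w ^ (-(n : ℤ) - 1) = w⁻¹ ^ (n + 1) := by
  rw [← neg_add', ← Nat.cast_succ, zpow_neg, zpow_natCast, inv_pow]

theorem birthFun_neg_sub_one_zero (h : BoundedRates lam) (n : ℕ) (t : ℝ) :
    birthFun lam (-(n : ℤ) - 1) t 0 = -((-(t : ℂ)) ^ n / n.factorial) := by
  simp only [birthFun, ← residueSum_exp_mul_inv_pow h, shiftedPsi, Finset.range_zero,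
    Finset.prod_empty, one_mul, zpow_neg_natCast_sub_one, mul_comm]

theorem norm_birthFun_le (h : BoundedRates lam) (m : ℤ) (t : ℝ) :
    ∃ B : ℝ, ∀ x, ‖birthFun lam m t x‖ ≤
      B * ∏ k ∈ Finset.range x, lam k / (3 * rateSup lam - lam k) := by
  have hM := h.rateSup_pos
  set R := 3 * rateSup lam
  refine ⟨R * (R ^ m * Real.exp (|t| * R)), fun x => ?_⟩
  rw [birthFun, norm_neg, mul_assoc]
  refine norm_residueSum_le h (by linarith) (hasPolesIn_birthFun lam m t x) fun w hw => ?_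
  have hpsi : ‖shiftedPsi lam x w‖ ≤ ∏ k ∈ Finset.range x, lam k / (R - lam k) := by
    rw [shiftedPsi, norm_prod, ← hw]
    exact Finset.prod_le_prod (fun _ _ => norm_nonneg _)
      fun k _ => h.norm_rate_div_sub_le (by linarith) k
  have hexp : ‖Complex.exp (-(t : ℂ) * w)‖ ≤ Real.exp (|t| * R) := by
    refine (Complex.norm_exp_le_exp_norm _).trans_eq ?_
    rw [norm_mul, norm_neg, Complex.norm_real, hw, Real.norm_eq_abs]
  rw [norm_mul, norm_mul, norm_zpow, hw, mul_assoc, mul_comm]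
  gcongr

theorem IsContour.hasDerivAt_contourIntegral_mul_exp {γ : ℝ → ℂ} (hγ : IsContour γ) {f : ℂ → ℂ}
    (hf : ContinuousOn f (γ '' Set.Icc 0 1)) (t : ℝ) :
    HasDerivAt (fun t : ℝ => contourIntegral γ fun w => f w * Complex.exp (-(t : ℂ) * w))
      (contourIntegral γ fun w => -w * f w * Complex.exp (-(t : ℂ) * w)) t := by
  have hf' : ContinuousOn (fun w => -w * f w) (γ '' Set.Icc 0 1) := by fun_prop
  have hint (g : ℂ → ℂ) (hg : ContinuousOn g (γ '' Set.Icc 0 1)) (t : ℝ) : IntervalIntegrable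
      (fun s => g (γ s) * Complex.exp (-(t : ℂ) * γ s) * deriv γ s) volume 0 1 :=
    hγ.intervalIntegrable (f := fun w => g w * Complex.exp (-(t : ℂ) * w)) (hg.mul (by fun_prop))
  obtain ⟨B, hB⟩ : ∃ B : ℝ, ∀ s ∈ Set.Icc (0 : ℝ) 1, ‖γ s‖ ≤ B :=
    isCompact_Icc.exists_bound_of_continuousOn hγ.continuousOn
  refine (intervalIntegral.hasDerivAt_integral_of_dominated_loc_of_deriv_le
    (F := fun (t : ℝ) s => f (γ s) * Complex.exp (-(t : ℂ) * γ s) * deriv γ s)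
    (F' := fun (t : ℝ) s => -γ s * f (γ s) * Complex.exp (-(t : ℂ) * γ s) * deriv γ s)
    (bound := fun s => ‖-γ s * f (γ s) * deriv γ s‖ * Real.exp ((|t| + 1) * B))
    (Metric.ball_mem_nhds t one_pos)
    (Eventually.of_forall fun t' => (hint f hf t').aestronglyMeasurable_restrict_uIoc) (hint f hf t)
    (hint _ hf' t).aestronglyMeasurable_restrict_uIoc ?_
    ((hγ.intervalIntegrable hf').norm.mul_const _) ?_).2
  · refine Eventually.of_forall fun s hs t' ht' => ?_
    rw [Set.uIoc_of_le zero_le_one] at hs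
    have hγs := hB s (Set.Ioc_subset_Icc_self hs)
    have ht : |t'| ≤ |t| + 1 := by
      have := abs_sub_abs_le_abs_sub t' t
      have := Real.dist_eq t' t ▸ Metric.mem_ball.1 ht'
      linarith
    rw [mul_right_comm, norm_mul]
    gcongr
    refine (Complex.norm_exp_le_exp_norm _).trans (Real.exp_le_exp.2 ?_)
    rw [norm_mul, norm_neg, Complex.norm_real, Real.norm_eq_abs]
    gcongr
  · refine Eventually.of_forall fun s _ t' _ => ?_
    have hexp : HasDerivAt (fun t : ℝ => Complex.exp (-(t : ℂ) * γ s))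
        (Complex.exp (-(t' : ℂ) * γ s) * (-1 * γ s)) t' :=
      (((Complex.ofRealCLM.hasDerivAt (x := t')).neg).mul_const (γ s)).cexp
    exact ((hexp.const_mul (f (γ s))).mul_const (deriv γ s)).congr_deriv (by ring)

theorem hasDerivAt_birthFun (h : BoundedRates lam) (m : ℤ) (x : ℕ) (t : ℝ) :
    HasDerivAt (fun t => birthFun lam m t x) (-birthFun lam (m + 1) t x) t := by
  have hC := h.encirclesAll_circleContour_three
  have hp : HasPolesIn (poles lam) (fun w => shiftedPsi lam x w * w ^ m) :=
    (hasPolesIn_shiftedPsi lam x).mul (.zpow (zero_mem_poles lam) m)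
  refine ((hC.isContour.hasDerivAt_contourIntegral_mul_exp
    (hp.continuousOn hC) t).const_mul _).neg.congr_deriv ?_
  rw [birthFun, ← residueSum, neg_inj, neg_eq_neg_one_mul (residueSum _ _), ← residueSum_const_mul]
  refine residueSum_congr h fun w hw => ?_
  rw [zpow_add_one₀ (ne_zero_of_notMem_poles hw)]
  ring

/-! #### Taylor coefficients -/

theorem hasPolesIn_taylorCoeff {S : Set ℂ} (h0 : (0 : ℂ) ∈ S) (lam : ℕ → ℝ) (t : ℝ) (i x : ℕ) :
    HasPolesIn S (fun u => pPoly lam x u * Complex.exp (t * u) * u⁻¹ ^ (i + 1)) :=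
  (HasPolesIn.of_entire ((differentiable_pPoly lam x).mul (differentiable_exp_mul _))).mul
    ((HasPolesIn.inv h0).pow _)

theorem taylorCoeff_zero (h : BoundedRates lam) (t : ℝ) (x : ℕ) : taylorCoeff lam t 0 x = 1 := by
  have := residueSum_mul_inv h ((differentiable_pPoly lam x).mul (differentiable_exp_mul (t : ℂ)))
  simpa [pPoly_apply_zero h.ne_zero, taylorCoeff] using this

theorem taylorCoeff_zero_right (h : BoundedRates lam) (t : ℝ) (i : ℕ) :
    taylorCoeff lam t i 0 = (t : ℂ) ^ i / i.factorial := by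
  simp [taylorCoeff, ← residueSum_exp_mul_inv_pow h, pPoly]

theorem taylorCoeff_succ (h : BoundedRates lam) (t : ℝ) (i x : ℕ) :
    taylorCoeff lam t (i + 1) (x + 1) =
      taylorCoeff lam t (i + 1) x - taylorCoeff lam t i x / lam x := by
  have hpoles := hasPolesIn_taylorCoeff (zero_mem_poles lam) lam t
  rw [div_eq_inv_mul, taylorCoeff, taylorCoeff, taylorCoeff, ← residueSum_const_mul,
    ← residueSum_sub h (hpoles _ _) ((hpoles _ _).const_mul _)]
  refine residueSum_congr h fun w hw => ?_
  have hx := h.ne_zero x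
  have hw0 := ne_zero_of_notMem_poles hw
  rw [pPoly_succ, pow_succ _ (i + 1)]
  generalize w⁻¹ ^ (i + 1) = q
  field_simp

/-! #### Transition functions -/

theorem hasPolesIn_transFun (lam : ℕ → ℝ) (j y x : ℕ) :
    HasPolesIn (poles lam) (fun w => shiftedPsi lam (y + 1) w * pPoly lam x w * w⁻¹ ^ j) :=
  ((hasPolesIn_shiftedPsi lam _).mul (.of_entire (differentiable_pPoly lam x))).mul
    ((HasPolesIn.inv (zero_mem_poles lam)).pow _)

theorem transFun_succ (h : BoundedRates lam) (j y x : ℕ) :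
    transFun lam (j + 1) y (x + 1) = transFun lam (j + 1) y x - transFun lam j y x / lam x := by
  rw [div_eq_inv_mul, transFun, transFun, transFun, ← residueSum_const_mul,
    ← residueSum_sub h (hasPolesIn_transFun ..) ((hasPolesIn_transFun ..).const_mul _)]
  refine residueSum_congr h fun w hw => ?_
  have hx := h.ne_zero x
  have hw0 := ne_zero_of_notMem_poles hw
  rw [pPoly_succ, pow_succ]
  generalize w⁻¹ ^ j = q
  field_simp

theorem BoundedRates.notMem_poles (h : BoundedRates lam) {w : ℂ} (hw : rateSup lam < ‖w‖) :
    w ∉ poles lam := fun hw' => (h.norm_le_rateSup hw').not_gt hw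

theorem norm_shiftedPsi_mul_pPoly_le (h : BoundedRates lam) {w : ℂ} (hw : rateSup lam < ‖w‖)
    (x d : ℕ) :
    ‖shiftedPsi lam (x + d) w * pPoly lam x w‖ ≤ (rateSup lam / (‖w‖ - rateSup lam)) ^ d := by
  have tail : shiftedPsi lam (x + d) w * pPoly lam x w =
      ∏ k ∈ Finset.range d, (lam (x + k) : ℂ) / (lam (x + k) - w) := by
    rw [shiftedPsi, Finset.prod_range_add, mul_right_comm, ← shiftedPsi,
      shiftedPsi_mul_pPoly h.ne_zero (h.notMem_poles hw), one_mul]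
  rw [tail, norm_prod, ← Finset.card_range d, ← Finset.prod_const, Finset.card_range]
  refine Finset.prod_le_prod (fun _ _ => norm_nonneg _)
    fun k _ => (h.norm_rate_div_sub_le hw _).trans ?_
  have := h.le_rateSup (x + k)
  exact div_le_div₀ h.rateSup_pos.le this (sub_pos.2 hw) (by linarith)

theorem transFun_eq_zero_of_le (h : BoundedRates lam) (j : ℕ) {y x : ℕ} (hxy : x ≤ y) :
    transFun lam (j + 1) y x = 0 := by
  have hM := h.rateSup_pos
  obtain ⟨d, rfl⟩ := Nat.exists_eq_add_of_le hxy
  refine residueSum_eq_zero_of_norm_le h (hasPolesIn_transFun ..)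
    (2 * rateSup lam * (2 * rateSup lam)⁻¹ ^ j) fun w hw => ?_
  have hw0 : 0 < ‖w‖ := by linarith
  have hpsi := norm_shiftedPsi_mul_pPoly_le h (by linarith : rateSup lam < ‖w‖) x (d + 1)
  have hratio : rateSup lam / (‖w‖ - rateSup lam) ≤ 2 * rateSup lam / ‖w‖ := by
    rw [div_le_div_iff₀ (by linarith) hw0]
    nlinarith
  have hratio' : 2 * rateSup lam / ‖w‖ ≤ 1 := (div_le_one hw0).2 hw
  have hratio0 : 0 ≤ rateSup lam / (‖w‖ - rateSup lam) := div_nonneg hM.le (by linarith)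
  have hfirst : ‖shiftedPsi lam (x + d + 1) w * pPoly lam x w‖ ≤ 2 * rateSup lam / ‖w‖ :=
    hpsi.trans <| (pow_succ' _ d).trans_le <| (mul_le_of_le_one_right hratio0
      (pow_le_one₀ hratio0 (hratio.trans hratio'))).trans hratio
  rw [norm_mul, norm_pow, norm_inv, pow_succ]
  calc _ ≤ 2 * rateSup lam / ‖w‖ * ((2 * rateSup lam)⁻¹ ^ j * ‖w‖⁻¹) := by gcongr
    _ = _ := by field_simp

theorem transFun_one (h : BoundedRates lam) (y x : ℕ) :
    transFun lam 1 y x = if y < x then 1 else 0 := by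
  split_ifs with hxy
  swap
  · exact transFun_eq_zero_of_le h 0 (not_lt.1 hxy)
  obtain ⟨d, rfl⟩ := Nat.exists_eq_add_of_le hxy
  set E : ℂ → ℂ := fun w => ∏ k ∈ Finset.range d,
    ((lam (y + 1 + k) : ℂ) - w) / lam (y + 1 + k)
  have hE0 : E 0 = 1 := Finset.prod_eq_one fun k _ => by rw [sub_zero, div_self (h.ne_zero _)]
  rw [transFun, ← hE0, ← residueSum_mul_inv h (f := E) (by fun_prop)]
  refine residueSum_congr h fun w hw => ?_
  rw [pow_one, pPoly, Finset.prod_range_add, ← mul_assoc, ← pPoly, Nat.succ_eq_add_one,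
    shiftedPsi_mul_pPoly h.ne_zero hw, one_mul]

theorem birthFun_neg_sub_one_apply_zero_succ (h : BoundedRates lam) (j x : ℕ) :
    birthFun lam (-(j : ℤ) - 1) 0 (x + 1) = 0 := by
  rw [birthFun, neg_eq_zero, ← transFun_eq_zero_of_le h j (Nat.zero_le x), transFun]
  simp [zpow_neg_natCast_sub_one, pPoly]

end KernelFunctions

/-! ### The kernel in biorthogonal form -/

section BiorthogonalForm

variable {lam : ℕ → ℝ} {C C₀ : ℝ → ℂ}

namespace AdmissibleContours

theorem encirclesAll_poles (hC : AdmissibleContours lam C C₀) : EncirclesAll C (poles lam) where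
  isContour := hC.isContour
  encircles := by
    rintro - (rfl | ⟨x, rfl⟩)
    exacts [hC.encircles_zero, hC.encircles x]

theorem encirclesAll_zero (hC : AdmissibleContours lam C C₀) : EncirclesAll C₀ {0} where
  isContour := hC.isContour₀
  encircles := by
    rintro - rfl
    exact hC.encircles₀

end AdmissibleContours

theorem contourIntegral_taylorCoeff (h : BoundedRates lam) {γ : ℝ → ℂ} (hγ : EncirclesAll γ {0})
    (t : ℝ) (i x : ℕ) :
    contourIntegral γ (fun u => pPoly lam x u * Complex.exp (t * u) * u⁻¹ ^ (i + 1)) =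
      2 * Real.pi * Complex.I * taylorCoeff lam t i x := by
  have hC := h.encirclesAll_circleContour_three
  rw [taylorCoeff, residueSum, mul_inv_cancel_left₀ Complex.two_pi_I_ne_zero]
  exact (hasPolesIn_taylorCoeff (Set.mem_singleton 0) lam t i x).contourIntegral_eq hγ
    ⟨hC.isContour, fun a ha => hC.encircles a (ha ▸ zero_mem_poles lam)⟩

/-- The integrand of the double integral of the correlation kernel. -/
noncomputable def kernelIntegrand (lam : ℕ → ℝ) (t : ℝ) (z₁ z₂ : ℕ × ℕ) (w u : ℂ) : ℂ :=
  psi lam z₁.2 w * pPoly lam z₂.2 u * Complex.exp (-(t : ℂ) * (w - u)) *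
    (w ^ ((z₁.1 : ℤ) - (z₂.1 : ℤ)) / u ^ z₂.1) * ((w ^ z₂.1 - u ^ z₂.1) / (w - u))

/-- Expanding `(wⁿ - uⁿ) / (w - u)` as a geometric sum separates the variables. -/
theorem kernelIntegrand_eq_sum (t : ℝ) (z₁ z₂ : ℕ × ℕ) {w u : ℂ} (hw : w ≠ 0) (hu : u ≠ 0)
    (hwu : w ≠ u) :
    kernelIntegrand lam t z₁ z₂ w u = ∑ i ∈ Finset.range z₂.1,
      (shiftedPsi lam (z₁.2 + 1) w * w ^ ((z₁.1 : ℤ) - z₂.1 + i) * Complex.exp (-(t : ℂ) * w)) *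
        (pPoly lam z₂.2 u * Complex.exp (t * u) * u⁻¹ ^ (i + 1)) := by
  rw [kernelIntegrand, ← (Commute.all w u).geom_sum₂ hwu, Finset.mul_sum]
  refine Finset.sum_congr rfl fun i hi => ?_
  have hpow : u ^ (z₂.1 - 1 - i) / u ^ z₂.1 = u⁻¹ ^ (i + 1) := by
    have hi := Finset.mem_range.1 hi
    rw [inv_pow, div_eq_iff (pow_ne_zero _ hu), eq_inv_mul_iff_mul_eq₀ (pow_ne_zero _ hu),
      ← pow_add]
    congr 1
    omega
  have hexp : Complex.exp (-(t : ℂ) * (w - u)) =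
      Complex.exp (-(t : ℂ) * w) * Complex.exp (t * u) := by
    rw [← Complex.exp_add]
    ring_nf
  rw [← hpow, hexp, zpow_add₀ hw, zpow_natCast, psi, shiftedPsi]
  ring

theorem contourIntegral_kernelIntegrand (h : BoundedRates lam) (hC : AdmissibleContours lam C C₀)
    (t : ℝ) (z₁ z₂ : ℕ × ℕ) :
    contourIntegral C (fun w => contourIntegral C₀ (kernelIntegrand lam t z₁ z₂ w)) =
      -(2 * Real.pi * Complex.I) ^ 2 * ∑ i ∈ Finset.range z₂.1,
        birthFun lam ((z₁.1 : ℤ) - z₂.1 + i) t (z₁.2 + 1) * taylorCoeff lam t i z₂.2 := by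
  have hCp := hC.encirclesAll_poles
  have inner : ∀ w ∈ C '' Set.Icc 0 1, contourIntegral C₀ (kernelIntegrand lam t z₁ z₂ w) =
      ∑ i ∈ Finset.range z₂.1, 2 * Real.pi * Complex.I * taylorCoeff lam t i z₂.2 *
        (shiftedPsi lam (z₁.2 + 1) w * w ^ ((z₁.1 : ℤ) - z₂.1 + i) *
          Complex.exp (-(t : ℂ) * w)) := by
    intro w hw
    have hw0 := ne_zero_of_notMem_poles (Set.disjoint_left.1 hCp.disjoint hw)
    rw [contourIntegral_congr fun u hu => kernelIntegrand_eq_sum t z₁ z₂ hw0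
        (Set.disjoint_left.1 hC.encirclesAll_zero.disjoint hu) (hC.disjoint.ne_of_mem hw hu),
      hC.isContour₀.integral_sum_const_mul _ _ fun i _ =>
        (hasPolesIn_taylorCoeff (Set.mem_singleton 0) lam t i z₂.2).continuousOn
          hC.encirclesAll_zero]
    refine Finset.sum_congr rfl fun i _ => ?_
    rw [contourIntegral_taylorCoeff h hC.encirclesAll_zero, mul_comm]
  rw [contourIntegral_congr inner, hC.isContour.integral_sum_const_mul _ _ fun i _ =>
    (hasPolesIn_birthFun lam _ t _).continuousOn hCp, Finset.mul_sum]
  refine Finset.sum_congr rfl fun i _ => ?_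
  rw [(hasPolesIn_birthFun lam _ t _).contourIntegral_eq_residueSum h hCp, birthFun]
  ring

theorem contourIntegral_psi_mul_pPoly_div (h : BoundedRates lam) {γ : ℝ → ℂ}
    (hγ : EncirclesAll γ (poles lam)) (j y x : ℕ) :
    contourIntegral γ (fun w => psi lam y w * (pPoly lam x w / w ^ j)) =
      2 * Real.pi * Complex.I * transFun lam j y x := by
  rw [transFun, ← (hasPolesIn_transFun lam j y x).contourIntegral_eq_residueSum h hγ]
  simp only [inv_pow, psi, shiftedPsi, mul_assoc, div_eq_mul_inv]

theorem corrKernel_eq (h : BoundedRates lam) (hC : AdmissibleContours lam C C₀)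
    (t : ℝ) (z₁ z₂ : ℕ × ℕ) :
    corrKernel lam C C₀ t z₁ z₂ = (lam z₁.2 : ℂ)⁻¹ *
      ((if z₁.1 < z₂.1 then transFun lam (z₂.1 - z₁.1) z₁.2 z₂.2 else 0) +
        ∑ i ∈ Finset.range z₂.1, birthFun lam ((z₁.1 : ℤ) - z₂.1 + i) t (z₁.2 + 1) *
          taylorCoeff lam t i z₂.2) := by
  have double := contourIntegral_kernelIntegrand h hC t z₁ z₂
  unfold kernelIntegrand at double
  rw [corrKernel, contourIntegral_psi_mul_pPoly_div h hC.encirclesAll_poles, double]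
  have hpi := Complex.two_pi_I_ne_zero
  generalize (2 * Real.pi * Complex.I : ℂ) = q at hpi ⊢
  split_ifs <;> field_simp <;> ring

end BiorthogonalForm

/-! ### Biorthogonality -/

/-- Growth at most like `∏_{k < x} (1 + M / (2 λ(k)))`, where `M` is the supremum of the rates. The
products of such a function with `birthFun` decay geometrically, even if the rates are not bounded
away from `0`. -/
def SlowGrowth (lam : ℕ → ℝ) (b : ℕ → ℂ) : Prop :=
  ∃ B : ℝ, ∀ x, ‖b x‖ ≤ B * ∏ k ∈ Finset.range x, (1 + rateSup lam / (2 * lam k))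

section Biorthogonality

variable {lam : ℕ → ℝ} {a b : ℕ → ℂ}

namespace SlowGrowth

theorem of_bounded (h : BoundedRates lam) {B : ℝ} (hb : ∀ x, ‖b x‖ ≤ B) : SlowGrowth lam b := by
  refine ⟨B, fun x => (hb x).trans
    (le_mul_of_one_le_right ((norm_nonneg _).trans (hb 0)) (Finset.one_le_prod fun k _ => ?_))⟩
  have := div_pos h.rateSup_pos (mul_pos two_pos (h.pos k))
  linarith

theorem of_sub_div (h : BoundedRates lam) (ha : SlowGrowth lam a)
    (hb : ∀ x, b (x + 1) = b x - a x / lam x) : SlowGrowth lam b := by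
  obtain ⟨B, hB⟩ := ha
  have hM := h.rateSup_pos
  have hB0 : 0 ≤ B := by simpa using (norm_nonneg _).trans (hB 0)
  refine ⟨‖b 0‖ + 2 * B / rateSup lam, fun x => ?_⟩
  induction x with
  | zero =>
    have : 0 ≤ 2 * B / rateSup lam := by positivity
    simpa using this
  | succ x ih =>
    have hx := h.pos x
    have ha : ‖a x / lam x‖ ≤
        B * (∏ k ∈ Finset.range x, (1 + rateSup lam / (2 * lam k))) / lam x := by
      rw [norm_div, h.norm_rate]
      gcongr
      exact hB x
    rw [hb, Finset.prod_range_succ]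
    set W := ∏ k ∈ Finset.range x, (1 + rateSup lam / (2 * lam k))
    have hW : 0 ≤ W := Finset.prod_nonneg fun k _ => by
      have := h.pos k
      positivity
    calc ‖b x - a x / lam x‖ ≤ ‖b x‖ + ‖a x / lam x‖ := norm_sub_le _ _
      _ ≤ (‖b 0‖ + 2 * B / rateSup lam) * W + B * W / lam x := add_le_add ih ha
      _ = (‖b 0‖ + 2 * B / rateSup lam) * (W * (1 + rateSup lam / (2 * lam x))) -
            ‖b 0‖ * W * rateSup lam / (2 * lam x) := by
        field_simp
        ring
      _ ≤ _ := sub_le_self _ (by positivity)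

theorem tendsto_mul_birthFun (h : BoundedRates lam) (hb : SlowGrowth lam b)
    (m : ℤ) (t : ℝ) : Tendsto (fun x => b x * birthFun lam m t x) atTop (𝓝 0) := by
  obtain ⟨B, hB⟩ := hb
  obtain ⟨B', hB'⟩ := norm_birthFun_le h m t
  have hM := h.rateSup_pos
  have hB0 : 0 ≤ B := by simpa using (norm_nonneg _).trans (hB 0)
  have hB0' : 0 ≤ B' := by simpa using (norm_nonneg _).trans (hB' 0)
  have ratio (k : ℕ) :
      (1 + rateSup lam / (2 * lam k)) * (lam k / (3 * rateSup lam - lam k)) ∈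
        Set.Icc 0 (3 / 4) := by
    have hk := h.pos k
    have hk' := h.le_rateSup k
    have hden : 0 < 3 * rateSup lam - lam k := by linarith
    refine ⟨by positivity, ?_⟩
    rw [show (1 + rateSup lam / (2 * lam k)) * (lam k / (3 * rateSup lam - lam k)) =
      (lam k + rateSup lam / 2) / (3 * rateSup lam - lam k) by field_simp, div_le_iff₀ hden]
    linarith
  refine squeeze_zero_norm (a := fun x => B * B' * (3 / 4) ^ x) (fun x => ?_) ?_
  · have hgeom := Finset.prod_le_prod (s := Finset.range x) (fun k _ => (ratio k).1)
      fun k _ => (ratio k).2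
    rw [Finset.prod_mul_distrib, Finset.prod_const, Finset.card_range] at hgeom
    rw [norm_mul]
    calc _ ≤ _ := mul_le_mul (hB x) (hB' x) (norm_nonneg _) ((norm_nonneg _).trans (hB x))
      _ = B * B' * _ := mul_mul_mul_comm _ _ _ _
      _ ≤ _ := by gcongr
  · simpa using (tendsto_pow_atTop_nhds_zero_of_lt_one (by norm_num : (0 : ℝ) ≤ 3 / 4)
      (by norm_num)).const_mul (B * B')

end SlowGrowth

theorem slowGrowth_taylorCoeff (h : BoundedRates lam) (t : ℝ) (i : ℕ) :
    SlowGrowth lam (taylorCoeff lam t i) := by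
  induction i with
  | zero => exact .of_bounded h (B := 1) fun x => by simp [taylorCoeff_zero h]
  | succ i ih => exact ih.of_sub_div h (taylorCoeff_succ h t i)

theorem slowGrowth_transFun (h : BoundedRates lam) (j y : ℕ) :
    SlowGrowth lam (transFun lam (j + 1) y) := by
  induction j with
  | zero =>
    refine .of_bounded h (B := 1) fun x => ?_
    rw [zero_add, transFun_one h]
    split_ifs <;> simp
  | succ j ih => exact ih.of_sub_div h (transFun_succ h (j + 1) y)

theorem sum_mul_birthFun (h : BoundedRates lam)
    (hb : ∀ x, b (x + 1) = b x - a x / lam x) (m : ℤ) (t : ℝ) (R : ℕ) :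
    ∑ x ∈ Finset.range R, b x * (birthFun lam m t (x + 1) / lam x) =
      b R * birthFun lam (m - 1) t R - b 0 * birthFun lam (m - 1) t 0 +
        ∑ x ∈ Finset.range R, a x * (birthFun lam (m - 1) t (x + 1) / lam x) := by
  induction R with
  | zero => simp
  | succ R ih =>
    rw [Finset.sum_range_succ, Finset.sum_range_succ, ih, hb, ← birthFun_sub h]
    ring

theorem tendsto_sum_mul_birthFun (h : BoundedRates lam) (hg : SlowGrowth lam b)
    (hb : ∀ x, b (x + 1) = b x - a x / lam x) (m : ℤ) (t : ℝ) {S : ℂ}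
    (ha : Tendsto (fun R => ∑ x ∈ Finset.range R,
      a x * (birthFun lam (m - 1) t (x + 1) / lam x)) atTop (𝓝 S)) :
    Tendsto (fun R => ∑ x ∈ Finset.range R, b x * (birthFun lam m t (x + 1) / lam x)) atTop
      (𝓝 (-(b 0 * birthFun lam (m - 1) t 0) + S)) := by
  simp_rw [sum_mul_birthFun h hb]
  simpa only [zero_sub] using
    ((hg.tendsto_mul_birthFun h (m - 1) t).sub_const (b 0 * birthFun lam (m - 1) t 0)).add ha

theorem transFun_one_succ (h : BoundedRates lam) (y x : ℕ) :
    transFun lam 1 y (x + 1) =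
      transFun lam 1 y x - (if x = y then -(lam y : ℂ) else 0) / lam x := by
  have hx := h.ne_zero x
  rw [transFun_one h, transFun_one h]
  rcases lt_trichotomy x y with hxy | rfl | hxy
  · simp [hxy.ne, hxy.not_gt, hxy]
  · simp [hx]
  · simp [hxy.ne', hxy, hxy.trans (Nat.lt_succ_self x)]

theorem tendsto_sum_transFun_mul_birthFun (h : BoundedRates lam) (j y : ℕ) (m : ℤ) (t : ℝ) :
    Tendsto (fun R => ∑ x ∈ Finset.range R,
      transFun lam (j + 1) y x * (birthFun lam m t (x + 1) / lam x)) atTop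
      (𝓝 (-birthFun lam (m - (j + 1)) t (y + 1))) := by
  induction j generalizing m with
  | zero =>
    have hdelta : Tendsto (fun R => ∑ x ∈ Finset.range R, (if x = y then -(lam y : ℂ) else 0) *
        (birthFun lam (m - 1) t (x + 1) / lam x)) atTop (𝓝 (-birthFun lam (m - 1) t (y + 1))) := by
      refine tendsto_const_nhds.congr' ?_
      filter_upwards [eventually_gt_atTop y] with R hR
      have hy := h.ne_zero y
      rw [Finset.sum_eq_single_of_mem y (Finset.mem_range.2 hR) fun x _ hx => by simp [hx],
        if_pos rfl]
      field_simp
    simpa [transFun_one h] using tendsto_sum_mul_birthFun h (slowGrowth_transFun h 0 y)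
      (transFun_one_succ h y) m t hdelta
  | succ j ih =>
    have hlim := tendsto_sum_mul_birthFun h (slowGrowth_transFun h (j + 1) y)
      (transFun_succ h (j + 1) y) m t (ih (m - 1))
    rw [transFun_eq_zero_of_le h _ (Nat.zero_le y), zero_mul, neg_zero, zero_add] at hlim
    convert hlim using 4
    push_cast
    ring

theorem tendsto_sum_taylorCoeff_mul_birthFun (h : BoundedRates lam) (i : ℕ) (m : ℤ) (t : ℝ) :
    Tendsto (fun R => ∑ x ∈ Finset.range R,
      taylorCoeff lam t i x * (birthFun lam m t (x + 1) / lam x)) atTop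
      (𝓝 (∑ j ∈ Finset.range (i + 1),
        -(taylorCoeff lam t (i - j) 0 * birthFun lam (m - 1 - j) t 0))) := by
  induction i generalizing m with
  | zero =>
    simpa using tendsto_sum_mul_birthFun h (slowGrowth_taylorCoeff h t 0) (a := fun _ => 0)
      (fun x => by simp [taylorCoeff_zero h]) m t (S := 0) (by simp)
  | succ i ih =>
    have hlim := tendsto_sum_mul_birthFun h (slowGrowth_taylorCoeff h t (i + 1))
      (taylorCoeff_succ h t i) m t (ih (m - 1))
    rw [Finset.sum_range_succ', add_comm (Finset.sum _ _)]
    convert hlim using 3 with R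
    · simp
    · refine Finset.sum_congr rfl fun j _ => ?_
      rw [Nat.add_sub_add_right, Nat.cast_succ, sub_add_eq_sub_sub_swap]

/-- The boundary values telescope by the binomial theorem for `(t - t) ^ i`. -/
theorem sum_taylorCoeff_mul_birthFun_neg_one (h : BoundedRates lam) (i : ℕ) (t : ℝ) :
    ∑ j ∈ Finset.range (i + 1), -(taylorCoeff lam t (i - j) 0 * birthFun lam (-(j : ℤ) - 1) t 0) =
      if i = 0 then 1 else 0 := by
  have hi : (i.factorial : ℂ) ≠ 0 := Nat.cast_ne_zero.2 i.factorial_ne_zero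
  have term : ∀ j ∈ Finset.range (i + 1),
      -(taylorCoeff lam t (i - j) 0 * birthFun lam (-(j : ℤ) - 1) t 0) =
        (i.factorial : ℂ)⁻¹ * ((-(t : ℂ)) ^ j * (t : ℂ) ^ (i - j) * i.choose j) := by
    intro j hj
    rw [birthFun_neg_sub_one_zero h, taylorCoeff_zero_right h,
      Nat.cast_choose ℂ (Nat.lt_succ_iff.1 (Finset.mem_range.1 hj))]
    field_simp
  rw [Finset.sum_congr rfl term, ← Finset.mul_sum, ← add_pow, neg_add_cancel]
  split_ifs with h0
  · simp [h0]
  · simp [zero_pow h0]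

theorem sum_taylorCoeff_mul_birthFun_zero (h : BoundedRates lam) (i k : ℕ) (t : ℝ) :
    ∑ j ∈ Finset.range (i + 1), -(taylorCoeff lam t (i - j) 0 * birthFun lam (k - 1 - j) t 0) =
      if i = k then 1 else 0 := by
  induction k generalizing i with
  | zero =>
    have hidx (j : ℕ) : ((0 : ℕ) : ℤ) - 1 - j = -(j : ℤ) - 1 := by
      push_cast
      ring
    simpa only [hidx] using sum_taylorCoeff_mul_birthFun_neg_one h i t
  | succ k ih =>
    have hidx (j : ℕ) : ((k + 1 : ℕ) : ℤ) - 1 - ((j + 1 : ℕ) : ℤ) = k - 1 - j := by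
      push_cast
      ring
    have hzero : birthFun lam (((k + 1 : ℕ) : ℤ) - 1 - ((0 : ℕ) : ℤ)) t 0 = 0 := by
      simpa using birthFun_natCast_zero lam k t
    rw [Finset.sum_range_succ', hzero, mul_zero, neg_zero, add_zero]
    simp only [hidx]
    cases i with
    | zero => simp
    | succ i => simpa using ih i

theorem tendsto_biorthogonal (h : BoundedRates lam) (i k : ℕ) (t : ℝ) :
    Tendsto (fun R => ∑ x ∈ Finset.range R,
      taylorCoeff lam t i x * (birthFun lam k t (x + 1) / lam x)) atTop
      (𝓝 (if i = k then 1 else 0)) :=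
  sum_taylorCoeff_mul_birthFun_zero h i k t ▸ tendsto_sum_taylorCoeff_mul_birthFun h i k t

end Biorthogonality

/-! ### Determinants -/

section Determinants

variable {R : Type*} [CommRing R]

theorem det_sum_eq_sum_piFinset {n α : Type*} [Fintype n] [DecidableEq n] (S : n → Finset α)
    (F : n → n → α → R) :
    (Matrix.of fun l k => ∑ y ∈ S k, F l k y).det =
      ∑ q ∈ Fintype.piFinset S, (Matrix.of fun l k => F l k (q k)).det := by
  simp only [Matrix.det_apply, Matrix.of_apply]
  rw [Finset.sum_comm]
  refine Finset.sum_congr rfl fun σ _ => ?_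
  rw [Finset.prod_univ_sum, Finset.smul_sum]

theorem det_mul_comp {n α : Type*} [Fintype n] [DecidableEq n] (a b : n → α → R) (q : n → α) :
    (Matrix.of fun l k => a l (q k) * b k (q k)).det =
      (∏ k, b k (q k)) * (Matrix.of fun l k => a l (q k)).det := by
  rw [← Matrix.det_mul_row]
  simp only [Matrix.of_apply, mul_comm]

section StrictTuples

variable {α : Type*} [LinearOrder α] {N : ℕ} {S : Finset α}

/-- The strictly increasing `N`-tuples with entries in `S`, which index the maximal minors in the
Cauchy–Binet formula. -/
def strictTuples (N : ℕ) (S : Finset α) : Finset (Fin N → α) :=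
  {r ∈ Fintype.piFinset fun _ => S | StrictMono r}

theorem mem_strictTuples {r : Fin N → α} :
    r ∈ strictTuples N S ↔ (∀ k, r k ∈ S) ∧ StrictMono r := by
  simp [strictTuples]

theorem eq_of_comp_perm_eq_of_strictMono {r r' : Fin N → α} (hr : StrictMono r)
    (hr' : StrictMono r') {σ σ' : Equiv.Perm (Fin N)} (h : r ∘ σ = r' ∘ σ') : r = r' ∧ σ = σ' := by
  have hrr' : r = r' := by
    rw [← hr.range_inj hr', ← σ.surjective.range_comp, h, σ'.surjective.range_comp]
  subst hrr'
  exact ⟨rfl, Equiv.ext fun k => hr.injective (congrFun h k)⟩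

theorem sum_piFinset_eq_sum_strictTuples_perm {M : Type*} [AddCommMonoid M]
    (F : (Fin N → α) → M) (hF : ∀ q, ¬ Function.Injective q → F q = 0) :
    ∑ q ∈ Fintype.piFinset (fun _ : Fin N => S), F q =
      ∑ r ∈ strictTuples N S, ∑ σ : Equiv.Perm (Fin N), F (r ∘ σ) := by
  classical
  rw [← Finset.sum_product', ← Finset.sum_filter_of_ne (p := Function.Injective) fun q _ hq =>
    not_imp_comm.1 (hF q) hq]
  symm
  refine Finset.sum_bij (fun p _ => p.1 ∘ p.2) (fun p hp => ?_) (fun p hp p' hp' hpp' => ?_)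
    (fun q hq => ?_) fun _ _ => rfl
  · obtain ⟨hmem, hmono⟩ := mem_strictTuples.1 (Finset.mem_product.1 hp).1
    exact Finset.mem_filter.2 ⟨Fintype.mem_piFinset.2 fun k => hmem _,
      hmono.injective.comp p.2.injective⟩
  · have hmono := (mem_strictTuples.1 (Finset.mem_product.1 hp).1).2
    have hmono' := (mem_strictTuples.1 (Finset.mem_product.1 hp').1).2
    obtain ⟨h₁, h₂⟩ := eq_of_comp_perm_eq_of_strictMono hmono hmono' hpp'
    exact Prod.ext h₁ h₂
  · obtain ⟨hmem, hinj⟩ := Finset.mem_filter.1 hq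
    refine ⟨(q ∘ Tuple.sort q, (Tuple.sort q)⁻¹), Finset.mem_product.2 ⟨mem_strictTuples.2
      ⟨fun k => Fintype.mem_piFinset.1 hmem _, ?_⟩, Finset.mem_univ _⟩, ?_⟩
    · exact (Tuple.monotone_sort q).strictMono_of_injective (hinj.comp (Tuple.sort q).injective)
    · ext k
      simp

theorem sum_strictTuples_det_mul_det (a b : Fin N → α → R) :
    ∑ r ∈ strictTuples N S,
        (Matrix.of fun l k => a l (r k)).det * (Matrix.of fun l k => b l (r k)).det =
      (Matrix.of fun l i => ∑ x ∈ S, a l x * b i x).det := by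
  rw [det_sum_eq_sum_piFinset (fun _ => S) fun l i x => a l x * b i x,
    sum_piFinset_eq_sum_strictTuples_perm]
  · refine Finset.sum_congr rfl fun r _ => ?_
    have perm (σ : Equiv.Perm (Fin N)) : (Matrix.of fun l k => a l ((r ∘ σ) k)).det =
        Equiv.Perm.sign σ * (Matrix.of fun l k => a l (r k)).det :=
      Matrix.det_permute' σ (Matrix.of fun l k => a l (r k))
    simp_rw [det_mul_comp, perm]
    rw [← Matrix.det_transpose (Matrix.of fun l k => b l (r k)),
      Matrix.det_apply' (Matrix.transpose _), Finset.mul_sum]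
    refine Finset.sum_congr rfl fun σ _ => ?_
    simp only [Function.comp_apply, Matrix.transpose_apply, Matrix.of_apply]
    ring
  · intro q hq
    obtain ⟨i, j, hij, hne⟩ := Function.not_injective_iff.1 hq
    rw [det_mul_comp, Matrix.det_zero_of_column_eq hne fun l => by simp [hij], mul_zero]

end StrictTuples

theorem det_of_last_row_eq_one {N : ℕ} (M : Matrix (Fin (N + 1)) (Fin (N + 1)) R)
    (hM : ∀ k, M (Fin.last N) k = 1) :
    M.det = (-1) ^ N * (Matrix.of fun (l k : Fin N) =>
      M l.castSucc k.succ - M l.castSucc k.castSucc).det := by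
  let B : Matrix (Fin (N + 1)) (Fin (N + 1)) R := Matrix.of fun l =>
    Fin.cons (M l 0) fun k => M l k.succ - M l k.castSucc
  have hMB : M.det = B.det :=
    Matrix.det_eq_of_forall_col_eq_smul_add_pred (fun _ => 1) (fun i => by simp [B])
      (fun i j => by simp [B])
  rw [hMB, Matrix.det_succ_row B (Fin.last N), Finset.sum_eq_single 0]
  · have hminor : B.submatrix (Fin.last N).succAbove (Fin.succAbove 0) = Matrix.of
        fun (l k : Fin N) => M l.castSucc k.succ - M l.castSucc k.castSucc := by
      ext l k
      simp [B]
    rw [hminor]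
    simp [B, hM]
  · intro k _ hk
    obtain ⟨j, rfl⟩ := Fin.exists_succ_eq.2 hk
    simp [B, hM]
  · simp

theorem sum_interlacing_det {N : ℕ} (a : Fin N → ℕ → R) (A : Fin (N + 1) → ℕ → R)
    (hlast : ∀ x, A (Fin.last N) x = 1)
    (hA : ∀ l x, A (Fin.castSucc l) x = A l.castSucc 0 - ∑ y ∈ Finset.range x, a l y)
    {r : Fin (N + 1) → ℕ} (hr : Monotone r) :
    ∑ q ∈ Fintype.piFinset fun k : Fin N => Finset.Ico (r k.castSucc) (r k.succ),
      (Matrix.of fun l k => a l (q k)).det = (Matrix.of fun l k => A l (r k)).det := by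
  have hdiff : (Matrix.of fun (l k : Fin N) =>
      A l.castSucc (r k.succ) - A l.castSucc (r k.castSucc)) =
      -Matrix.of fun (l k : Fin N) => ∑ y ∈ Finset.Ico (r k.castSucc) (r k.succ), a l y := by
    ext l k
    rw [Matrix.neg_apply, Matrix.of_apply, Matrix.of_apply, hA, hA l (r k.castSucc),
      Finset.sum_Ico_eq_sub _ (hr (Fin.castSucc_le_succ k))]
    ring
  rw [det_of_last_row_eq_one _ fun k => hlast (r k)]
  simp only [Matrix.of_apply]
  rw [hdiff, Matrix.det_neg, Fintype.card_fin, ← mul_assoc, ← mul_pow, neg_one_mul, neg_neg,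
    one_pow, one_mul, det_sum_eq_sum_piFinset _ fun l _ y => a l y]

section Perturbation

variable {ι κ α : Type*} [Fintype ι] [DecidableEq ι] [LinearOrder α] {lev : ι → α}

theorem det_one_sub_of_strictly_triangular {T : Matrix ι ι R}
    (hT : ∀ i j, lev j ≤ lev i → T i j = 0) : (1 - T).det = 1 := by
  have htri : (1 - T).BlockTriangular lev := fun i j hij => by
    have hne : i ≠ j := by
      rintro rfl
      exact lt_irrefl _ hij
    simp [hne, hT i j hij.le]
  have hblock (a : α) : (1 - T).toSquareBlock lev a = 1 := by
    ext i j
    change (1 - T) i.1 j.1 = _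
    simp [Matrix.one_apply, Subtype.ext_iff, hT i.1 j.1 (j.2.trans i.2.symm).le]
  rw [htri.det]
  exact Finset.prod_eq_one fun a _ => by rw [hblock, Matrix.det_one]

theorem det_one_add_mul_of_eq_add_mul [Fintype κ] [DecidableEq κ] {A c : Matrix κ ι R}
    (Γ : Matrix ι κ R) {T : Matrix ι ι R} (hT : ∀ i j, lev j ≤ lev i → T i j = 0)
    (hA : A = c + A * T) : (1 + A * Γ).det = (1 + (Γ * c - T)).det := by
  have hfactor : (1 + Γ * A) * (1 - T) = 1 + (Γ * c - T) := by
    rw [eq_sub_of_add_eq hA.symm]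
    simp only [Matrix.mul_sub, Matrix.add_mul, Matrix.one_mul, Matrix.mul_one, Matrix.mul_assoc]
    abel
  rw [Matrix.det_one_add_mul_comm, ← hfactor, Matrix.det_mul,
    det_one_sub_of_strictly_triangular hT, mul_one]

end Perturbation

end Determinants

/-! ### The tilted row functions -/

/-- The functions `A n l`, `l < n`, for which the sum of the products of the weights `w` over the
patterns below a row `r` of length `n` is `det [A n l (r k)]`; the constants of integration `κ` are
irrelevant for that determinant. -/
def rowFun {R : Type*} [CommRing R] (κ : ℕ → R) (w : ℕ → ℕ → R) : ℕ → ℕ → ℕ → R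
  | 0, _, _ => 0
  | n + 1, l, x => if l < n then κ (n - l) - ∑ y ∈ Finset.range x, rowFun κ w n l y * w n y
      else if l = n then 1 else 0

theorem rowFun_eq_zero_of_le {R : Type*} [CommRing R] (κ : ℕ → R) (w : ℕ → ℕ → R) {n l : ℕ}
    (hnl : n ≤ l) (x : ℕ) : rowFun κ w n l x = 0 := by
  cases n with
  | zero => rfl
  | succ n => rw [rowFun, if_neg (by omega), if_neg (by omega)]

/-- The rates `1 / λ`, multiplied by `1 + s` at the points `z i`. -/
noncomputable def tiltedWeight {ι : Type*} [Fintype ι] (lam : ℕ → ℝ) (s : ℂ) (z : ι → ℕ × ℕ)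
    (n y : ℕ) : ℂ :=
  (1 + s * ∑ i, if z i = (n, y) then 1 else 0) / lam y

/-- The row functions of the tilted weights, with the constants of integration for which they
reduce to `freeRowFun` at `s = 0`. -/
noncomputable def tiltedRowFun {ι : Type*} [Fintype ι] (lam : ℕ → ℝ) (t : ℝ) (s : ℂ)
    (z : ι → ℕ × ℕ) : ℕ → ℕ → ℕ → ℂ :=
  rowFun (fun i => taylorCoeff lam t i 0) (tiltedWeight lam s z)

/-- The row functions of the weights `1 / λ`. -/
noncomputable def freeRowFun (lam : ℕ → ℝ) (t : ℝ) (n l x : ℕ) : ℂ :=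
  if l < n then taylorCoeff lam t (n - 1 - l) x else 0

/-- The strictly triangular part of the correlation kernel. -/
noncomputable def levelKernel (lam : ℕ → ℝ) (z₁ z₂ : ℕ × ℕ) : ℂ :=
  if z₁.1 < z₂.1 then -transFun lam (z₂.1 - z₁.1) z₁.2 z₂.2 / lam z₁.2 else 0

section TiltedRowFunctions

variable {lam : ℕ → ℝ} {ι : Type*} [Fintype ι]

theorem mul_tiltedWeight_of_eq {s : ℂ} {z : ι → ℕ × ℕ} {f : ℕ → ℕ → ℂ} {n y : ℕ} {c : ℂ}
    {g : ι → ℂ} (hf : f n y = c + s * ∑ i, f (z i).1 (z i).2 * g i) :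
    f n y * tiltedWeight lam s z n y =
      c / lam y + s * ∑ i, f (z i).1 (z i).2 * ((g i + if z i = (n, y) then 1 else 0) / lam y) := by
  have hcount : f n y * ∑ i, (if z i = (n, y) then (1 : ℂ) else 0) =
      ∑ i, f (z i).1 (z i).2 * if z i = (n, y) then 1 else 0 := by
    rw [Finset.mul_sum]
    refine Finset.sum_congr rfl fun i _ => ?_
    split_ifs with hi
    · rw [hi]
    · simp
  rw [tiltedWeight, mul_div_assoc', mul_add, mul_one, mul_left_comm, hcount, hf]
  simp only [mul_add, Finset.sum_add_distrib, mul_div_assoc', ← Finset.sum_div]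
  ring

theorem taylorCoeff_eq_sub_sum (h : BoundedRates lam) (t : ℝ) (i x : ℕ) :
    taylorCoeff lam t (i + 1) x = taylorCoeff lam t (i + 1) 0 -
      ∑ y ∈ Finset.range x, taylorCoeff lam t i y / lam y := by
  induction x with
  | zero => simp
  | succ x ih =>
    rw [taylorCoeff_succ h, ih, Finset.sum_range_succ]
    ring

theorem transFun_eq_neg_sum (h : BoundedRates lam) (j y x : ℕ) :
    transFun lam (j + 2) y x = -∑ v ∈ Finset.range x, transFun lam (j + 1) y v / lam v := by
  induction x with
  | zero => simp [transFun_eq_zero_of_le h (j + 1) (Nat.zero_le y)]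
  | succ x ih =>
    rw [transFun_succ h, ih, Finset.sum_range_succ]
    ring

theorem levelKernel_succ (h : BoundedRates lam) (z : ℕ × ℕ) (n x : ℕ) :
    levelKernel lam z (n + 1, x) = -∑ y ∈ Finset.range x,
      (levelKernel lam z (n, y) + if z = (n, y) then 1 else 0) / lam y := by
  obtain ⟨k, y⟩ := z
  simp only [levelKernel, Prod.mk.injEq]
  rcases lt_trichotomy k n with hk | rfl | hk
  · obtain ⟨j, rfl⟩ := Nat.exists_eq_add_of_lt hk
    simp only [hk, hk.ne, hk.trans (Nat.lt_succ_self _), if_true, false_and, if_false, add_zero]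
    rw [show k + j + 1 + 1 - k = j + 2 by omega, show k + j + 1 - k = j + 1 by omega,
      transFun_eq_neg_sum h, neg_neg, Finset.sum_div, ← Finset.sum_neg_distrib]
    exact Finset.sum_congr rfl fun _ _ => by ring
  · rw [if_pos (Nat.lt_succ_self k), Nat.add_sub_cancel_left, transFun_one h, neg_div, neg_inj]
    simp [ite_div]
  · simp [hk.not_gt, hk.ne', hk.not_ge]

theorem tiltedRowFun_eq (h : BoundedRates lam) (t : ℝ) (s : ℂ) (z : ι → ℕ × ℕ) (n l x : ℕ) :
    tiltedRowFun lam t s z n l x = freeRowFun lam t n l x +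
      s * ∑ i, tiltedRowFun lam t s z (z i).1 l (z i).2 * levelKernel lam (z i) (n, x) := by
  induction n generalizing x with
  | zero => simp [tiltedRowFun, rowFun, freeRowFun, levelKernel]
  | succ n ih =>
    by_cases hl : l < n
    · have term (y : ℕ) := mul_tiltedWeight_of_eq (lam := lam)
        (f := fun n y => tiltedRowFun lam t s z n l y) (ih y)
      have hfree (y : ℕ) : freeRowFun lam t n l y = taylorCoeff lam t (n - 1 - l) y := if_pos hl
      have hidx : n - l = n - 1 - l + 1 := by omega
      have hrec : tiltedRowFun lam t s z (n + 1) l x = taylorCoeff lam t (n - l) 0 -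
          ∑ y ∈ Finset.range x, tiltedRowFun lam t s z n l y * tiltedWeight lam s z n y := by
        rw [tiltedRowFun, rowFun, if_pos hl]
      rw [hrec, Finset.sum_congr rfl fun y _ => term y, Finset.sum_add_distrib, ← Finset.mul_sum,
        Finset.sum_comm, freeRowFun, if_pos (hl.trans (Nat.lt_succ_self n)), Nat.add_sub_cancel,
        hidx, taylorCoeff_eq_sub_sum h t _ x]
      simp only [hfree, levelKernel_succ h, ← Finset.mul_sum, mul_neg, Finset.sum_neg_distrib]
      ring
    · have hzero (i : ι) :
          tiltedRowFun lam t s z (z i).1 l (z i).2 * levelKernel lam (z i) (n + 1, x) = 0 := by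
        by_cases hi : (z i).1 < n + 1
        · rw [tiltedRowFun, rowFun_eq_zero_of_le _ _ (by omega), zero_mul]
        · rw [levelKernel, if_neg hi, mul_zero]
      rw [Finset.sum_eq_zero fun i _ => hzero i, mul_zero, add_zero, tiltedRowFun, rowFun,
        if_neg hl, freeRowFun]
      by_cases hln : l = n
      · simp [hln, taylorCoeff_zero h]
      · rw [if_neg hln, if_neg (by omega)]

theorem tendsto_sum_levelKernel_mul_birthFun (h : BoundedRates lam) (t : ℝ) {z : ℕ × ℕ} {N : ℕ}
    (hz : z.1 ≤ N) (m : ℤ) :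
    Tendsto (fun R => ∑ x ∈ Finset.range R,
      (levelKernel lam z (N, x) + if z = (N, x) then 1 else 0) *
        (birthFun lam m t (x + 1) / lam x)) atTop
      (𝓝 (birthFun lam (m - (N - z.1)) t (z.2 + 1) / lam z.2)) := by
  obtain ⟨n, y⟩ := z
  simp only [levelKernel, Prod.mk.injEq] at hz ⊢
  rcases hz.lt_or_eq with hn | rfl
  · obtain ⟨d, rfl⟩ := Nat.exists_eq_add_of_lt hn
    have hlim := (tendsto_sum_transFun_mul_birthFun h d y m t).const_mul (-(lam y : ℂ)⁻¹)
    simp only [hn, hn.ne, if_true, false_and, if_false, add_zero]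
    convert hlim using 2 with R
    · rw [Finset.mul_sum, show n + d + 1 - n = d + 1 by omega]
      exact Finset.sum_congr rfl fun x _ => by ring
    · rw [show (m - ((n + d + 1 : ℕ) - n) : ℤ) = m - (d + 1) by push_cast; ring]
      ring
  · refine tendsto_const_nhds.congr' ?_
    filter_upwards [eventually_gt_atTop y] with R hR
    simp [hR]

theorem tendsto_sum_tiltedRowFun_mul_birthFun (h : BoundedRates lam) (t : ℝ) (s : ℂ)
    {z : ι → ℕ × ℕ} {N : ℕ} (hz : ∀ j, (z j).1 ≤ N) (l i : Fin N) :
    Tendsto (fun R => ∑ x ∈ Finset.range R, tiltedRowFun lam t s z N l x *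
        (birthFun lam (N - 1 - i) t (x + 1) * tiltedWeight lam s z N x)) atTop
      (𝓝 ((if l = i then 1 else 0) + s * ∑ j, tiltedRowFun lam t s z (z j).1 l (z j).2 *
        (birthFun lam ((z j).1 - 1 - i) t ((z j).2 + 1) / lam (z j).2))) := by
  have term (x : ℕ) : tiltedRowFun lam t s z N l x *
      (birthFun lam (N - 1 - i) t (x + 1) * tiltedWeight lam s z N x) =
      taylorCoeff lam t (N - 1 - l) x * (birthFun lam (N - 1 - i) t (x + 1) / lam x) +
        s * ∑ j, tiltedRowFun lam t s z (z j).1 l (z j).2 *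
          ((levelKernel lam (z j) (N, x) + if z j = (N, x) then 1 else 0) *
            (birthFun lam (N - 1 - i) t (x + 1) / lam x)) := by
    rw [mul_left_comm, mul_tiltedWeight_of_eq (f := fun n y => tiltedRowFun lam t s z n l y)
      (tiltedRowFun_eq h t s z N l x), freeRowFun, if_pos l.2]
    simp only [Finset.mul_sum, mul_add]
    exact congrArg₂ _ (by ring) (Finset.sum_congr rfl fun j _ => by ring)
  simp only [term, Finset.sum_add_distrib, ← Finset.mul_sum]
  refine Tendsto.add ?_ (Tendsto.const_mul s ?_)
  · have hidx : ((N - 1 - i : ℕ) : ℤ) = N - 1 - i := by omega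
    have hli : N - 1 - l = N - 1 - (i : ℕ) ↔ l = i := by
      rw [Fin.ext_iff]
      omega
    simpa only [hli, hidx] using tendsto_biorthogonal h (N - 1 - l) (N - 1 - i) t
  · simp only [Finset.sum_comm (s := Finset.range _), ← Finset.mul_sum]
    refine tendsto_finsetSum _ fun j _ => Tendsto.const_mul _ ?_
    convert tendsto_sum_levelKernel_mul_birthFun h t (hz j) (N - 1 - i) using 4
    ring

theorem corrKernel_eq_sum_sub_levelKernel (h : BoundedRates lam) {C C₀ : ℝ → ℂ}
    (hC : AdmissibleContours lam C C₀) (t : ℝ) (z₁ : ℕ × ℕ) {z₂ : ℕ × ℕ} {N : ℕ} (hN : z₂.1 ≤ N) :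
    corrKernel lam C C₀ t z₁ z₂ =
      ∑ l : Fin N, birthFun lam (z₁.1 - 1 - l) t (z₁.2 + 1) / lam z₁.2 *
        freeRowFun lam t z₂.1 l z₂.2 - levelKernel lam z₁ z₂ := by
  rw [corrKernel_eq h hC, mul_add, sub_eq_neg_add _ (levelKernel lam z₁ z₂), levelKernel]
  congr 1
  · split_ifs <;> ring
  · rw [Fin.sum_univ_eq_sum_range (fun l => birthFun lam (z₁.1 - 1 - l) t (z₁.2 + 1) / lam z₁.2 *
      freeRowFun lam t z₂.1 l z₂.2) N, ← Finset.sum_range_reflect _ z₂.1, Finset.mul_sum]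
    refine Finset.sum_subset_zero_on_sdiff (Finset.range_mono hN) (fun l hl => ?_) fun l hl => ?_
    · rw [freeRowFun, if_neg (by simpa using (Finset.mem_sdiff.1 hl).2), mul_zero]
    · have hl := Finset.mem_range.1 hl
      rw [freeRowFun, if_pos hl,
        show (z₁.1 : ℤ) - z₂.1 + (z₂.1 - 1 - l : ℕ) = z₁.1 - 1 - l by omega]
      ring

theorem tendsto_det_tiltedRowFun [DecidableEq ι] (h : BoundedRates lam) (t : ℝ) (s : ℂ)
    {z : ι → ℕ × ℕ} {N : ℕ} (hz : ∀ j, (z j).1 ≤ N) {C C₀ : ℝ → ℂ}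
    (hC : AdmissibleContours lam C C₀) :
    Tendsto (fun R => (Matrix.of fun l i : Fin N => ∑ x ∈ Finset.range R,
      tiltedRowFun lam t s z N l x *
        (birthFun lam (N - 1 - i) t (x + 1) * tiltedWeight lam s z N x)).det) atTop
      (𝓝 (1 + s • Matrix.of fun i j => corrKernel lam C C₀ t (z i) (z j)).det) := by
  let A : Matrix (Fin N) ι ℂ := Matrix.of fun l j => tiltedRowFun lam t s z (z j).1 l (z j).2
  let A₀ : Matrix (Fin N) ι ℂ := Matrix.of fun l j => freeRowFun lam t (z j).1 l (z j).2
  let B : Matrix ι (Fin N) ℂ := Matrix.of fun j i =>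
    birthFun lam ((z j).1 - 1 - i) t ((z j).2 + 1) / lam (z j).2
  let T : Matrix ι ι ℂ := Matrix.of fun i j => levelKernel lam (z i) (z j)
  have hA : A = A₀ + A * (s • T) := by
    ext l j
    simp only [A, A₀, T, Matrix.add_apply, Matrix.mul_smul, Matrix.smul_apply, Matrix.mul_apply,
      Matrix.of_apply, smul_eq_mul]
    exact tiltedRowFun_eq h t s z _ l _
  have hK : s • Matrix.of (fun i j => corrKernel lam C C₀ t (z i) (z j)) =
      s • B * A₀ - s • T := by
    rw [Matrix.smul_mul, ← smul_sub]
    congr 1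
    ext i j
    exact corrKernel_eq_sum_sub_levelKernel h hC t (z i) (hz j)
  rw [hK, ← det_one_add_mul_of_eq_add_mul (lev := fun i => (z i).1) (s • B)
    (fun i j hij => by simp [T, levelKernel, hij]) hA]
  refine ((continuous_id (X := Matrix (Fin N) (Fin N) ℂ)).matrix_det.tendsto _).comp
    (tendsto_pi_nhds.2 fun l => tendsto_pi_nhds.2 fun i => ?_)
  have entry : (1 + A * (s • B) : Matrix _ _ ℂ) l i = (if l = i then 1 else 0) + s * ∑ j,
      tiltedRowFun lam t s z (z j).1 l (z j).2 *
        (birthFun lam ((z j).1 - 1 - i) t ((z j).2 + 1) / lam (z j).2) := by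
    simp [A, B, Matrix.mul_apply, Matrix.one_apply, Finset.mul_sum, mul_left_comm]
  exact entry ▸ tendsto_sum_tiltedRowFun_mul_birthFun h t s hz l i

end TiltedRowFunctions

/-! ### Sums over patterns -/

section Patterns

variable {N : ℕ}

/-- The positions of the particles on the top level. -/
def GT.topRow (x : GT N) (k : Fin N) : ℕ := x.1 N (k + 1)

theorem GT.ext {x y : GT N} (h : ∀ n k, 1 ≤ k → k ≤ n → n ≤ N → x.1 n k = y.1 n k) : x = y := by
  refine Subtype.ext (funext fun n => funext fun k => ?_)
  by_cases hnk : 1 ≤ k ∧ k ≤ n ∧ n ≤ N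
  · exact h n k hnk.1 hnk.2.1 hnk.2.2
  · rw [x.2.support n k hnk, y.2.support n k hnk]

theorem IsGT.add_le_row {x : ℕ → ℕ → ℕ} (hx : IsGT N x) {n k d : ℕ} (hk : 1 ≤ k)
    (hkn : k + d ≤ n) (hn : n ≤ N) : x n k + d ≤ x n (k + d) := by
  induction d with
  | zero => exact le_rfl
  | succ d ih =>
    have hstrict := hx.strict n (k + d) (by omega) hkn hn
    have hprev := ih (by omega)
    rw [← add_assoc, ← add_assoc]
    omega

theorem IsGT.add_le_top {x : ℕ → ℕ → ℕ} (hx : IsGT N x) {n k d : ℕ} (hk : 1 ≤ k) (hkn : k ≤ n)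
    (hd : n + d = N) : x n k + d ≤ x N (k + d) := by
  induction d generalizing n k with
  | zero => exact hd ▸ le_rfl
  | succ d ih =>
    have hnext := (hx.interlace n k hk hkn (by omega)).2
    have htop := ih (n := n + 1) (k := k + 1) (by omega) (by omega) (by omega)
    rw [add_right_comm] at htop
    rw [← add_assoc, ← add_assoc]
    omega

theorem GT.lt_of_topRow_lt (x : GT N) {R : ℕ} (hR : ∀ k, x.topRow k < R) {n k : ℕ} (hk : 1 ≤ k)
    (hkn : k ≤ n) (hn : n ≤ N) : x.1 n k < R := by
  have htop := x.2.add_le_top (d := N - n) hk hkn (by omega)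
  have hlt := hR ⟨k + (N - n) - 1, by omega⟩
  rw [GT.topRow, Nat.sub_add_cancel (by omega)] at hlt
  exact (Nat.le_of_add_right_le htop).trans_lt hlt

theorem GT.eq_densePacked (x : GT N) (hx : x.1 N N < N) : x = densePacked N := by
  refine GT.ext fun n k hk hkn hn => ?_
  obtain ⟨i, rfl⟩ := Nat.exists_eq_add_of_le hk
  obtain ⟨d, rfl⟩ := Nat.exists_eq_add_of_le hkn
  obtain ⟨e, rfl⟩ := Nat.exists_eq_add_of_le hn
  have hleft := x.2.add_le_row (n := 1 + i + d) (k := 1) (d := i) le_rfl (by omega) hn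
  have hright := x.2.add_le_row (n := 1 + i + d) (k := 1 + i) (d := d) hk le_rfl hn
  have htop := x.2.add_le_top (n := 1 + i + d) (k := 1 + i + d) (d := e) (by omega) le_rfl rfl
  have hdense : (densePacked (1 + i + d + e)).1 (1 + i + d) (1 + i) = i :=
    (if_pos ⟨hk, hkn, hn⟩).trans (Nat.add_sub_cancel_left 1 i)
  omega

theorem GT.strictMono_topRow (x : GT N) : StrictMono x.topRow := by
  cases N with
  | zero => exact Subsingleton.strictMono _
  | succ N =>
    exact Fin.strictMono_iff_lt_succ.2 fun i =>
      x.2.strict (N + 1) (i + 1) (by omega) (by omega) le_rfl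

theorem GT.finite_topRow_lt (N R : ℕ) : {x : GT N | ∀ k, x.topRow k < R}.Finite := by
  refine Set.Finite.of_injOn (f := fun (x : GT N) (n k : Fin (N + 1)) => x.1 n k)
    (t := Set.pi Set.univ fun _ => Set.pi Set.univ fun _ => Set.Iio (R + 1))
    (fun x hx n _ k _ => ?_) (fun x _ y _ hxy => GT.ext fun n k _ hkn hn => ?_)
    (Set.Finite.pi fun _ => Set.Finite.pi fun _ => Set.finite_Iio _)
  · by_cases hnk : 1 ≤ (k : ℕ) ∧ (k : ℕ) ≤ n ∧ (n : ℕ) ≤ N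
    · exact (x.lt_of_topRow_lt hx hnk.1 hnk.2.1 hnk.2.2).trans (Nat.lt_succ_self R)
    · simp [x.2.support _ _ hnk]
  · exact congrFun (congrFun hxy ⟨n, by omega⟩) ⟨k, by omega⟩

/-- The finitely many patterns with all entries below `R`. -/
noncomputable def patternsBelow (N R : ℕ) : Finset (GT N) := (GT.finite_topRow_lt N R).toFinset

theorem mem_patternsBelow {R : ℕ} {x : GT N} : x ∈ patternsBelow N R ↔ ∀ k, x.topRow k < R := by
  simp [patternsBelow]

theorem exists_mem_patternsBelow (x : GT N) : ∃ R, x ∈ patternsBelow N R :=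
  ⟨Finset.univ.sup x.topRow + 1, mem_patternsBelow.2 fun k =>
    Nat.lt_succ_of_le (Finset.le_sup (f := x.topRow) (Finset.mem_univ k))⟩

theorem patternsBelow_mono : Monotone (patternsBelow N) := fun _ _ hR _ hx =>
  mem_patternsBelow.2 fun k => (mem_patternsBelow.1 hx k).trans_le hR

instance : Countable (GT N) := by
  have hunion : (Set.univ : Set (GT N)) = ⋃ R, (patternsBelow N R : Set (GT N)) := by
    ext x
    simpa using exists_mem_patternsBelow x
  rw [← Set.countable_univ_iff, hunion]
  exact Set.countable_iUnion fun R => (patternsBelow N R).countable_toSet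

/-- The pattern without its top row. -/
def GT.dropRow (x : GT (N + 1)) : GT N :=
  ⟨fun n k => if n ≤ N then x.1 n k else 0,
    { support := fun n k hnk => by
        split_ifs with hn
        · exact x.2.support n k (by omega)
        · rfl
      strict := fun n k hk hkn hn => by
        simpa only [if_pos hn] using x.2.strict n k hk hkn (by omega)
      interlace := fun n k hk hkn hn => by
        simpa only [if_pos hn, if_pos (Nat.le_of_succ_le hn)] using
          x.2.interlace n k hk hkn (by omega) }⟩

theorem GT.dropRow_apply (x : GT (N + 1)) {n : ℕ} (hn : n ≤ N) (k : ℕ) :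
    x.dropRow.1 n k = x.1 n k :=
  if_pos hn

theorem GT.topRow_dropRow (x : GT (N + 1)) (k : Fin N) : x.dropRow.topRow k = x.1 N (k + 1) :=
  x.dropRow_apply le_rfl _

theorem GT.topRow_interlace (x : GT (N + 1)) (k : Fin N) :
    x.topRow k.castSucc ≤ x.dropRow.topRow k ∧ x.dropRow.topRow k < x.topRow k.succ := by
  rw [GT.topRow_dropRow]
  exact x.2.interlace N (k + 1) (by omega) k.2 le_rfl

theorem IsGT.of_interlace {x : ℕ → ℕ → ℕ}
    (hsupp : ∀ n k, ¬ (1 ≤ k ∧ k ≤ n ∧ n ≤ N) → x n k = 0)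
    (hinter : ∀ n k, 1 ≤ k → k ≤ n → n + 1 ≤ N → x (n + 1) k ≤ x n k ∧ x n k < x (n + 1) (k + 1)) :
    IsGT N x := by
  refine ⟨hsupp, fun n k hk hkn hn => ?_, hinter⟩
  obtain ⟨m, rfl⟩ : ∃ m, n = m + 1 := ⟨n - 1, by omega⟩
  obtain ⟨hle, hlt⟩ := hinter m k hk (by omega) hn
  exact hle.trans_lt hlt

theorem IsGT.update {x : ℕ → ℕ → ℕ} (hx : IsGT N x) {r : ℕ → ℕ}
    (hsupp : ∀ k, ¬ (1 ≤ k ∧ k ≤ N + 1) → r k = 0)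
    (hr : ∀ k, 1 ≤ k → k ≤ N → r k ≤ x N k ∧ x N k < r (k + 1)) :
    IsGT (N + 1) (Function.update x (N + 1) r) := by
  refine .of_interlace (fun n k hnk => ?_) fun n k hk hkn hn => ?_
  · rcases eq_or_ne n (N + 1) with rfl | hne
    · rw [Function.update_self, hsupp k (by omega)]
    · rw [Function.update_of_ne hne, hx.support n k (by omega)]
  · rw [Function.update_of_ne (show n ≠ N + 1 by omega)]
    rcases hn.lt_or_eq with hlt | heq
    · rw [Function.update_of_ne hlt.ne]
      exact hx.interlace n k hk hkn (by omega)
    · obtain rfl : n = N := by omega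
      rw [Function.update_self]
      exact hr k hk hkn

/-- The pattern with a new top row. -/
def GT.addRow (x : GT N) (r : Fin (N + 1) → ℕ)
    (hr : ∀ k : Fin N, r k.castSucc ≤ x.topRow k ∧ x.topRow k < r k.succ) : GT (N + 1) :=
  ⟨Function.update x.1 (N + 1) fun k =>
      if hk : 1 ≤ k ∧ k ≤ N + 1 then r ⟨k - 1, by omega⟩ else 0,
    x.2.update (fun _ hk => dif_neg hk) fun k hk hkN => by
      obtain ⟨j, rfl⟩ : ∃ j, k = j + 1 := ⟨k - 1, by omega⟩
      rw [dif_pos ⟨hk, hkN.trans (Nat.le_succ N)⟩, dif_pos ⟨by omega, by omega⟩]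
      exact hr ⟨j, hkN⟩⟩

theorem GT.topRow_addRow (x : GT N) (r : Fin (N + 1) → ℕ)
    (hr : ∀ k : Fin N, r k.castSucc ≤ x.topRow k ∧ x.topRow k < r k.succ) :
    (x.addRow r hr).topRow = r := by
  ext k
  simp [GT.topRow, GT.addRow, Nat.le_of_lt_succ k.2]

theorem GT.dropRow_addRow (x : GT N) (r : Fin (N + 1) → ℕ)
    (hr : ∀ k : Fin N, r k.castSucc ≤ x.topRow k ∧ x.topRow k < r k.succ) :
    (x.addRow r hr).dropRow = x :=
  GT.ext fun n k _ _ hn =>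
    ((x.addRow r hr).dropRow_apply hn k).trans
      (congrFun (Function.update_of_ne (by omega : n ≠ N + 1) _ _) k)

theorem GT.eq_of_topRow_eq_of_dropRow_eq {x y : GT (N + 1)} (htop : x.topRow = y.topRow)
    (hdrop : x.dropRow = y.dropRow) : x = y := by
  refine GT.ext fun n k hk hkn hn => ?_
  rcases hn.lt_or_eq with hlt | rfl
  · rw [← x.dropRow_apply (Nat.le_of_lt_succ hlt), hdrop, y.dropRow_apply (Nat.le_of_lt_succ hlt)]
  · simpa [GT.topRow, Nat.sub_add_cancel hk] using congrFun htop ⟨k - 1, by omega⟩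

theorem GT.finite_topRow_eq (r : Fin N → ℕ) : {x : GT N | x.topRow = r}.Finite :=
  (GT.finite_topRow_lt N (Finset.univ.sup r + 1)).subset fun x (hx : x.topRow = r) k =>
    hx ▸ Nat.lt_succ_of_le (Finset.le_sup (f := x.topRow) (Finset.mem_univ k))

/-- The finitely many patterns with top row `r`. -/
noncomputable def patternsUnder (r : Fin N → ℕ) : Finset (GT N) :=
  (GT.finite_topRow_eq r).toFinset

theorem mem_patternsUnder {r : Fin N → ℕ} {x : GT N} : x ∈ patternsUnder r ↔ x.topRow = r := by
  simp [patternsUnder]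

theorem patternsUnder_zero (r : Fin 0 → ℕ) : patternsUnder r = {densePacked 0} := by
  ext x
  rw [mem_patternsUnder, Finset.mem_singleton]
  exact iff_of_true (Subsingleton.elim _ _) (GT.ext fun _ _ _ _ _ => by omega)

/-- The product of the weights `w` of the particles on the levels below `N`. -/
def lowerWeight {R : Type*} [CommMonoid R] (w : ℕ → ℕ → R) (N : ℕ) (x : ℕ → ℕ → ℕ) : R :=
  ∏ n ∈ Finset.range N, ∏ k ∈ Finset.range n, w n (x n (k + 1))

theorem lowerWeight_succ {R : Type*} [CommMonoid R] (w : ℕ → ℕ → R) (x : GT N) :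
    lowerWeight w (N + 1) x.1 = (∏ k, w N (x.topRow k)) * lowerWeight w N x.1 := by
  rw [lowerWeight, Finset.prod_range_succ, mul_comm, ← lowerWeight,
    ← Fin.prod_univ_eq_prod_range fun k => w N (x.1 N (k + 1))]
  rfl

theorem lowerWeight_dropRow {R : Type*} [CommMonoid R] (w : ℕ → ℕ → R) (x : GT (N + 1)) :
    lowerWeight w (N + 1) x.dropRow.1 = lowerWeight w (N + 1) x.1 :=
  Finset.prod_congr rfl fun n hn => Finset.prod_congr rfl fun k _ => by
    rw [x.dropRow_apply (Nat.le_of_lt_succ (Finset.mem_range.1 hn))]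

theorem sum_patternsUnder_succ {M : Type*} [AddCommMonoid M] (F : GT N → M)
    (r : Fin (N + 1) → ℕ) :
    ∑ x ∈ patternsUnder r, F x.dropRow =
      ∑ q ∈ Fintype.piFinset fun k : Fin N => Finset.Ico (r k.castSucc) (r k.succ),
        ∑ x ∈ patternsUnder q, F x := by
  rw [Finset.sum_sigma']
  refine Finset.sum_bij (fun x _ => ⟨x.dropRow.topRow, x.dropRow⟩) (fun x hx => ?_)
    (fun x hx y hy hxy => ?_) (fun p hp => ?_) fun x _ => rfl
  · rw [Finset.mem_sigma, Fintype.mem_piFinset, mem_patternsUnder, ← mem_patternsUnder.1 hx]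
    exact ⟨fun k => Finset.mem_Ico.2 (x.topRow_interlace k), rfl⟩
  · exact GT.eq_of_topRow_eq_of_dropRow_eq
      ((mem_patternsUnder.1 hx).trans (mem_patternsUnder.1 hy).symm)
      (eq_of_heq (Sigma.mk.inj_iff.1 hxy).2)
  · obtain ⟨q, x⟩ := p
    rw [Finset.mem_sigma, Fintype.mem_piFinset, mem_patternsUnder] at hp
    obtain ⟨hq, rfl : x.topRow = q⟩ := hp
    refine ⟨x.addRow r fun k => Finset.mem_Ico.1 (hq k), ?_, ?_⟩
    · exact mem_patternsUnder.2 (x.topRow_addRow r _)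
    · rw [GT.dropRow_addRow]

theorem strictMono_of_interlace {α : Type*} [Preorder α] {q : Fin N → α} {r : Fin (N + 1) → α}
    (hqr : ∀ k, r k.castSucc ≤ q k ∧ q k < r k.succ) : StrictMono q := by
  cases N with
  | zero => exact Subsingleton.strictMono _
  | succ N => exact Fin.strictMono_iff_lt_succ.2 fun i => (hqr i.castSucc).2.trans_le (hqr i.succ).1

variable {R : Type*} [CommRing R] (κ : ℕ → R) (w : ℕ → ℕ → R)

theorem sum_patternsUnder_lowerWeight {r : Fin N → ℕ} (hr : StrictMono r) :
    ∑ x ∈ patternsUnder r, lowerWeight w N x.1 =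
      (Matrix.of fun l k : Fin N => rowFun κ w N l (r k)).det := by
  induction N with
  | zero => simp [patternsUnder_zero, lowerWeight]
  | succ N ih =>
    rw [← sum_interlacing_det (fun l y => rowFun κ w N l y * w N y)
      (fun l => rowFun κ w (N + 1) l) (fun x => by simp [rowFun]) (fun l x => by simp [rowFun])
      hr.monotone]
    simp only [← lowerWeight_dropRow w]
    rw [sum_patternsUnder_succ fun x => lowerWeight w (N + 1) x.1]
    refine Finset.sum_congr rfl fun q hq => ?_
    rw [det_mul_comp (fun (l : Fin N) y => rowFun κ w N l y) fun _ y => w N y, ← ih <|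
      strictMono_of_interlace fun k => Finset.mem_Ico.1 (Fintype.mem_piFinset.1 hq k),
      Finset.mul_sum]
    refine Finset.sum_congr rfl fun x hx => ?_
    rw [lowerWeight_succ, mem_patternsUnder.1 hx]

theorem sum_patternsBelow_lowerWeight_mul_det (b : Fin N → ℕ → R) (m : ℕ) :
    ∑ x ∈ patternsBelow N m,
        lowerWeight w (N + 1) x.1 * (Matrix.of fun i k => b i (x.topRow k)).det =
      (Matrix.of fun l i : Fin N => ∑ x ∈ Finset.range m,
        rowFun κ w N l x * (b i x * w N x)).det := by
  classical
  rw [← sum_strictTuples_det_mul_det (fun l : Fin N => rowFun κ w N l) fun i x => b i x * w N x,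
    ← Finset.sum_fiberwise_of_maps_to (g := GT.topRow) (t := strictTuples N (Finset.range m))
      fun x hx => mem_strictTuples.2
        ⟨fun k => Finset.mem_range.2 (mem_patternsBelow.1 hx k), x.strictMono_topRow⟩]
  refine Finset.sum_congr rfl fun r hr => ?_
  obtain ⟨hrange, hmono⟩ := mem_strictTuples.1 hr
  have hfiber : {x ∈ patternsBelow N m | x.topRow = r} = patternsUnder r := by
    ext x
    rw [Finset.mem_filter, mem_patternsBelow, mem_patternsUnder, and_iff_right_iff_imp]
    exact fun hx k => hx ▸ Finset.mem_range.1 (hrange k)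
  rw [hfiber, ← sum_patternsUnder_lowerWeight κ w hmono, Finset.sum_mul,
    det_mul_comp b fun _ y => w N y]
  refine Finset.sum_congr rfl fun x hx => ?_
  rw [lowerWeight_succ, mem_patternsUnder.1 hx]
  ring

end Patterns

/-! ### Push chains -/

/-- If particle `k` on level `n` jumps, it pushes exactly the particles above it on its diagonal, up
to level `n + r`. -/
structure PushChain (N : ℕ) (y : ℕ → ℕ → ℕ) (n k r : ℕ) : Prop where
  le : n + r ≤ N
  eq : ∀ i < r, y (n + i) (k + i) + 1 = y (n + i + 1) (k + i + 1)
  unpushed : n + r < N → y (n + r) (k + r) + 1 < y (n + r + 1) (k + r + 1)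

/-- `x` arises from `y` by an unblocked jump of particle `k` on level `n`, which pushes the
particles up to level `n + r`. -/
structure IsPush (N : ℕ) (y : ℕ → ℕ → ℕ) (n k r : ℕ) (x : ℕ → ℕ → ℕ) : Prop where
  one_le : 1 ≤ k
  le : k ≤ n
  chain : PushChain N y n k r
  not_blocked : ¬ Blocked y n k
  apply : ∀ a b, x a b = if n ≤ a ∧ a ≤ n + r ∧ a + k = b + n then y a b + 1 else y a b

/-- Particle `j` on level `m` may have been the last one to move. -/
def Removable (N : ℕ) (x : ℕ → ℕ → ℕ) (m j : ℕ) : Prop :=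
  (m < N → x (m + 1) j < x m j) ∧ (m = N → 0 < x N j ∧ (1 < j → x N (j - 1) + 1 < x N j))

/-- A maximal run of particles, up the diagonal from particle `k` on level `n`, each of which is
just about to push the next one. If particle `k + r` on level `n + r` was the last one to move,
then the jump which moved it was a jump of particle `k` on level `n`. -/
structure PullChain (x : ℕ → ℕ → ℕ) (n k r : ℕ) : Prop where
  eq : ∀ i < r, x (n + i) (k + i) + 1 = x (n + i + 1) (k + i + 1)
  start : 1 < k → x (n - 1) (k - 1) + 1 < x n k

/-- The array before the jump of particle `k` on level `n` which moved the particles on its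
diagonal up to level `n + r`. -/
def pullArray (x : ℕ → ℕ → ℕ) (n k r : ℕ) : ℕ → ℕ → ℕ :=
  fun a b => if n ≤ a ∧ a ≤ n + r ∧ a + k = b + n then x a b - 1 else x a b

section PushChains

variable {N n k r : ℕ} {x y : ℕ → ℕ → ℕ}

theorem exists_pushChain (hy : IsGT N y) (hk : 1 ≤ k) (hkn : k ≤ n) (hn : n ≤ N) :
    ∃ r, PushChain N y n k r := by
  obtain ⟨d, hd⟩ := Nat.exists_eq_add_of_le hn
  induction d generalizing n k with
  | zero => exact ⟨0, hn, by omega, by omega⟩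
  | succ d ih =>
    have hinter := (hy.interlace n k hk hkn (by omega)).2
    rcases Nat.lt_or_ge (y n k + 1) (y (n + 1) (k + 1)) with hlt | hge
    · exact ⟨0, hn, by omega, fun _ => hlt⟩
    · obtain ⟨r, hr⟩ := ih (n := n + 1) (k := k + 1) (by omega) (by omega) (by omega) (by omega)
      have shift (m i : ℕ) : m + (i + 1) = m + 1 + i := by omega
      refine ⟨r + 1, shift n r ▸ hr.le, fun i hi => ?_, fun hlt => ?_⟩
      · cases i with
        | zero => exact le_antisymm hinter hge
        | succ i =>
          rw [shift n i, shift k i]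
          exact hr.eq i (Nat.lt_of_succ_lt_succ hi)
      · rw [shift n r] at hlt
        rw [shift n r, shift k r]
        exact hr.unpushed hlt

theorem PushChain.unique {r' : ℕ} (h : PushChain N y n k r) (h' : PushChain N y n k r') :
    r = r' := by
  wlog hlt : r < r' generalizing r r'
  · rcases (not_lt.1 hlt).eq_or_lt with heq | hgt
    · exact heq.symm
    · exact (this h' h hgt).symm
  · have hpushed := h'.eq r hlt
    have hunpushed := h.unpushed ((Nat.add_lt_add_left hlt n).trans_le h'.le)
    omega

theorem PushChain.moves_iff (h : PushChain N y n k r) (a b : ℕ) :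
    Moves N y n k a b ↔ n ≤ a ∧ a ≤ n + r ∧ a + k = b + n := by
  constructor
  · intro hmoves
    induction hmoves with
    | self => omega
    | @push m j _ _ hpush ih =>
      have hne : m ≠ n + r := by
        rintro rfl
        obtain rfl : j = k + r := by omega
        exact hpush (h.unpushed (by omega))
      omega
  · rintro ⟨hna, har, hab⟩
    obtain ⟨i, rfl⟩ := Nat.exists_eq_add_of_le hna
    obtain rfl : b = k + i := by omega
    clear hna hab
    induction i with
    | zero => exact Moves.self
    | succ i ih =>
      have hle := h.le
      exact .push (ih (by omega)) (show n + i + 1 ≤ N by omega) (h.eq i (by omega)).not_lt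

theorem IsPush.apply_diag (h : IsPush N y n k r x) {i : ℕ} (hi : i ≤ r) :
    x (n + i) (k + i) = y (n + i) (k + i) + 1 := by
  rw [h.apply, if_pos (by omega)]

theorem IsPush.apply_of_not_diag (h : IsPush N y n k r x) {a b : ℕ}
    (hab : ¬ (n ≤ a ∧ a ≤ n + r ∧ a + k = b + n)) : x a b = y a b := by
  rw [h.apply, if_neg hab]

theorem IsPush.removable (hy : IsGT N y) (h : IsPush N y n k r x) :
    Removable N x (n + r) (k + r) := by
  have hk := h.one_le
  have hkn := h.le
  have hlast := h.apply_diag le_rfl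
  refine ⟨fun hlt => ?_, fun heq => ?_⟩
  · have hinter := (hy.interlace (n + r) (k + r) (by omega) (by omega) hlt).1
    rw [h.apply_of_not_diag (by omega)]
    omega
  · rw [← heq, hlast]
    refine ⟨Nat.succ_pos _, fun hj => ?_⟩
    have hstrict := hy.strict (n + r) (k + r - 1) (by omega) (by omega) heq.le
    rw [Nat.sub_add_cancel (by omega)] at hstrict
    rw [h.apply_of_not_diag (by omega)]
    omega

theorem IsPush.length_le {n' k' r' : ℕ} {y' : ℕ → ℕ → ℕ} (hy : IsGT N y)
    (h : IsPush N y n k r x) (h' : IsPush N y' n' k' r' x) (hn : n + r = n' + r')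
    (hk : k + r = k' + r') : r' ≤ r := by
  by_contra hlt
  obtain ⟨d, rfl⟩ := Nat.exists_eq_add_of_lt (not_le.1 hlt)
  obtain rfl : n = n' + (d + 1) := by omega
  obtain rfl : k = k' + (d + 1) := by omega
  have hle := h.le
  have hk' := h'.one_le
  have hN := h.chain.le
  have hchain := h'.chain.eq d (by omega)
  have hfirst := h.apply_diag (Nat.zero_le r)
  have hfirst' := h'.apply_diag (i := d + 1) (by omega)
  have hbelow := h.apply_of_not_diag (a := n' + d) (b := k' + d) (by omega)
  have hbelow' := h'.apply_diag (i := d) (by omega)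
  have hinter := (hy.interlace (n' + d) (k' + d) (by omega) (by omega) (by omega)).2
  simp only [add_zero, ← add_assoc] at *
  omega

theorem exists_pullChain (hx : IsGT N x) {m j : ℕ} (hj : 1 ≤ j) (hjm : j ≤ m) (hm : m ≤ N) :
    ∃ n k r, 1 ≤ k ∧ k ≤ n ∧ m = n + r ∧ j = k + r ∧ PullChain x n k r := by
  induction j generalizing m with
  | zero => omega
  | succ j ih =>
    rcases Nat.eq_zero_or_pos j with rfl | hpos
    · exact ⟨m, 1, 0, le_rfl, hjm, rfl, rfl, by omega, by omega⟩
    · obtain ⟨m, rfl⟩ : ∃ m', m = m' + 1 := ⟨m - 1, by omega⟩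
      have hinter := (hx.interlace m j hpos (by omega) hm).2
      rcases Nat.lt_or_ge (x m j + 1) (x (m + 1) (j + 1)) with hlt | hge
      · exact ⟨m + 1, j + 1, 0, hj, hjm, rfl, rfl, by omega, fun _ => hlt⟩
      · obtain ⟨n, k, r, hk, hkn, rfl, rfl, hchain⟩ := ih (m := m) hpos (by omega) (by omega)
        refine ⟨n, k, r + 1, hk, hkn, rfl, rfl, fun i hi => ?_, hchain.start⟩
        rcases (Nat.le_of_lt_succ hi).lt_or_eq with hlt | rfl
        · exact hchain.eq i hlt
        · exact le_antisymm hinter hge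

section Pull

variable (hx : IsGT N x) (hk : 1 ≤ k) (hkn : k ≤ n) (hN : n + r ≤ N) (hchain : PullChain x n k r)
  (hlast : Removable N x (n + r) (k + r))
include hx hk hkn hN hchain hlast

theorem PullChain.succ_lt_of_removable {i : ℕ} (hi : i ≤ r) (hlt : n + i < N) :
    x (n + i + 1) (k + i) < x (n + i) (k + i) := by
  obtain ⟨d, hd⟩ := Nat.exists_eq_add_of_le hi
  induction d generalizing i with
  | zero =>
    obtain rfl : r = i := hd
    exact hlast.1 hlt
  | succ d ih =>
    have hstep := hchain.eq i (by omega)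
    suffices hgap : x (n + i + 1) (k + i) + 1 < x (n + i + 1) (k + i + 1) by omega
    rcases (Nat.succ_le_of_lt hlt).lt_or_eq with hlt' | heq
    · have hinter := (hx.interlace (n + i + 1) (k + i) (by omega) (by omega) hlt').2
      have hnext := ih (i := i + 1) (by omega) hlt' (by omega)
      simp only [← add_assoc] at hnext
      omega
    · obtain rfl : r = i + 1 := by omega
      subst heq
      exact (hlast.2 rfl).2 (by omega)

theorem PullChain.pos_of_removable {i : ℕ} (hi : i ≤ r) : 0 < x (n + i) (k + i) := by
  rcases (show n + i ≤ N by omega).lt_or_eq with hlt | heq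
  · exact Nat.zero_lt_of_lt (hchain.succ_lt_of_removable hx hk hkn hN hlast hi hlt)
  · obtain rfl : i = r := by omega
    rw [heq]
    exact (hlast.2 heq).1

theorem PullChain.isGT_pullArray : IsGT N (pullArray x n k r) := by
  refine .of_interlace (fun a b hab => ?_) fun a b hb hba ha => ?_
  · rw [pullArray, if_neg (by omega), hx.support a b hab]
  have hinter := hx.interlace a b hb hba ha
  by_cases hdiag : n ≤ a ∧ a ≤ n + r ∧ a + k = b + n
  · obtain ⟨i, rfl⟩ := Nat.exists_eq_add_of_le hdiag.1
    obtain rfl : b = k + i := by omega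
    have hpos := hchain.pos_of_removable hx hk hkn hN hlast (i := i) (by omega)
    have hlt := hchain.succ_lt_of_removable hx hk hkn hN hlast (i := i) (by omega) ha
    simp only [pullArray, if_pos hdiag]
    rw [if_neg (by omega)]
    exact ⟨by omega, by split_ifs <;> omega⟩
  · simp only [pullArray, if_neg hdiag]
    refine ⟨by split_ifs <;> omega, ?_⟩
    split_ifs with hnext
    · obtain rfl : n = a + 1 := by omega
      obtain rfl : k = b + 1 := by omega
      have hstart : x a b + 1 < x (a + 1) (b + 1) := hchain.start (by omega)
      omega
    · exact hinter.2

theorem PullChain.isPush_pullArray : IsPush N (pullArray x n k r) n k r x := by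
  have hpos (i : ℕ) (hi : i ≤ r) := hchain.pos_of_removable hx hk hkn hN hlast hi
  refine ⟨hk, hkn, ⟨hN, fun i hi => ?_, fun hlt => ?_⟩, fun hblocked => ?_, fun a b => ?_⟩
  · have hstep := hchain.eq i hi
    have hpos_i := hpos i hi.le
    simp only [pullArray]
    rw [if_pos (by omega), if_pos (by omega)]
    omega
  · have hinter := (hx.interlace (n + r) (k + r) (by omega) (by omega) hlt).2
    have hpos_r := hpos r le_rfl
    simp only [pullArray]
    rw [if_pos (by omega), if_neg (by omega)]
    omega
  · obtain ⟨hkn, heq⟩ := hblocked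
    obtain ⟨m, rfl⟩ : ∃ m, n = m + 1 := ⟨n - 1, by omega⟩
    have hinter := (hx.interlace m k hk (by omega) (by omega)).1
    have hpos_zero := hpos 0 (Nat.zero_le r)
    simp only [pullArray, Nat.add_sub_cancel] at heq
    rw [if_neg (by omega), if_pos (by omega)] at heq
    simp only [add_zero] at hpos_zero
    omega
  · unfold pullArray
    split_ifs with hdiag
    · obtain ⟨i, rfl⟩ := Nat.exists_eq_add_of_le hdiag.1
      obtain rfl : b = k + i := by omega
      exact (Nat.sub_add_cancel (hpos i (by omega))).symm
    · rfl

end Pull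

theorem Removable.exists_isPush (hx : IsGT N x) {m j : ℕ} (hj : 1 ≤ j) (hjm : j ≤ m) (hm : m ≤ N)
    (h : Removable N x m j) :
    ∃ (y : GT N) (n k r : ℕ), IsPush N y.1 n k r x ∧ m = n + r ∧ j = k + r := by
  obtain ⟨n, k, r, hk, hkn, rfl, rfl, hchain⟩ := exists_pullChain hx hj hjm hm
  exact ⟨⟨pullArray x n k r, hchain.isGT_pullArray hx hk hkn hm h⟩, n, k, r,
    hchain.isPush_pullArray hx hk hkn hm h, rfl, rfl⟩

theorem GT.ring_of_not_blocked (y : GT N) (hk : 1 ≤ k) (hkn : k ≤ n) (hn : n ≤ N)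
    (hb : ¬ Blocked y.1 n k) :
    y.ring n k = ⟨pushArray N y.1 n k, isGT_pushArray y.2 hk hkn hn hb⟩ := by
  unfold GT.ring
  exact dif_pos (⟨⟨hk, hkn, hn⟩, hb⟩ : (1 ≤ k ∧ k ≤ n ∧ n ≤ N) ∧ ¬ Blocked y.1 n k)

theorem GT.ring_eq_iff {x y : GT N} (hk : 1 ≤ k) (hkn : k ≤ n) (hn : n ≤ N)
    (hb : ¬ Blocked y.1 n k) : y.ring n k = x ↔ ∃ r, IsPush N y.1 n k r x.1 := by
  have apply_pushArray {r : ℕ} (hr : PushChain N y.1 n k r) (a b : ℕ) : pushArray N y.1 n k a b =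
      if n ≤ a ∧ a ≤ n + r ∧ a + k = b + n then y.1 a b + 1 else y.1 a b := by
    simp only [pushArray, hr.moves_iff]
  rw [y.ring_of_not_blocked hk hkn hn hb]
  constructor
  · rintro rfl
    obtain ⟨r, hr⟩ := exists_pushChain y.2 hk hkn hn
    exact ⟨r, hk, hkn, hr, hb, apply_pushArray hr⟩
  · rintro ⟨r, hr⟩
    refine Subtype.ext (funext fun a => funext fun b => ?_)
    rw [hr.apply]
    exact apply_pushArray hr.chain a b

end PushChains

/-! ### The density and its evolution -/

/-- The indices `(n, k)` of the particles of a pattern with `N` levels. -/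
def gtIndex (N : ℕ) : Finset (ℕ × ℕ) :=
  {p ∈ Finset.range (N + 1) ×ˢ Finset.range (N + 1) | 1 ≤ p.2 ∧ p.2 ≤ p.1}

theorem mem_gtIndex {N : ℕ} {p : ℕ × ℕ} : p ∈ gtIndex N ↔ 1 ≤ p.2 ∧ p.2 ≤ p.1 ∧ p.1 ≤ N := by
  rw [gtIndex, Finset.mem_filter, Finset.mem_product, Finset.mem_range, Finset.mem_range]
  omega

theorem sum_gtIndex {M : Type*} [AddCommMonoid M] (N : ℕ) (f : ℕ → ℕ → M) :
    ∑ p ∈ gtIndex N, f p.1 p.2 = ∑ n ∈ Finset.Icc 1 N, ∑ k ∈ Finset.Icc 1 n, f n k := by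
  refine Finset.sum_finset_product' _ _ _ fun p => ?_
  rw [mem_gtIndex, Finset.mem_Icc, Finset.mem_Icc]
  omega

theorem sum_gtIndex_eq_sum_top {M : Type*} [AddCommMonoid M] {N : ℕ} {f : ℕ × ℕ → M}
    (hf : ∀ p, p.1 < N → f p = 0) : ∑ p ∈ gtIndex N, f p = ∑ k : Fin N, f (N, k + 1) := by
  symm
  refine Finset.sum_of_injOn (fun k => (N, (k : ℕ) + 1)) (fun k _ l _ hkl => ?_) (fun k _ => ?_)
    (fun p hp hnot => hf p ?_) fun k _ => rfl
  · exact Fin.ext (Nat.succ_injective (Prod.mk.inj hkl).2)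
  · exact mem_gtIndex.2 ⟨Nat.succ_pos _, k.2, le_rfl⟩
  · obtain ⟨hk, hkn, hn⟩ := mem_gtIndex.1 hp
    refine hn.lt_of_ne fun heq => hnot ?_
    exact ⟨⟨p.2 - 1, by omega⟩, Finset.mem_coe.2 (Finset.mem_univ _),
      Prod.ext heq.symm (Nat.sub_add_cancel hk)⟩

theorem lowerWeight_eq_prod {R : Type*} [CommMonoid R] (w : ℕ → ℕ → R) (N : ℕ)
    (x : ℕ → ℕ → ℕ) : lowerWeight w (N + 1) x = ∏ p ∈ gtIndex N, w p.1 (x p.1 p.2) := by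
  have shift (n : ℕ) : ∏ k ∈ Finset.range n, w n (x n (k + 1)) =
      ∏ k ∈ Finset.Ico 1 (n + 1), w n (x n k) := by
    rw [Finset.range_eq_Ico, Finset.prod_Ico_add' (fun k => w n (x n k)), zero_add]
  simp only [lowerWeight, shift]
  symm
  refine Finset.prod_finset_product' (f := fun n k => w n (x n k)) _ _ _ fun p => ?_
  rw [mem_gtIndex, Finset.mem_range, Finset.mem_Ico]
  omega

section Jumps

variable {N n k r : ℕ} {x y : ℕ → ℕ → ℕ}

theorem IsPush.eq_of_last_eq {n' k' r' : ℕ} {y y' : GT N} (h : IsPush N y.1 n k r x)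
    (h' : IsPush N y'.1 n' k' r' x) (hn : n + r = n' + r') (hk : k + r = k' + r') :
    (y, n, k) = (y', n', k') := by
  obtain rfl : r = r' := le_antisymm
    (h'.length_le y'.2 h hn.symm hk.symm) (h.length_le y.2 h' hn hk)
  obtain rfl : n = n' := Nat.add_right_cancel hn
  obtain rfl : k = k' := Nat.add_right_cancel hk
  obtain rfl : y = y' := by
    refine Subtype.ext (funext fun a => funext fun b => ?_)
    have happly := h.apply a b
    rw [h'.apply] at happly
    split_ifs at happly <;> omega
  rfl

open Classical in
theorem sum_jumps_eq_sum_removable {M : Type*} [AddCommMonoid M] (x : GT N) {S : Finset (GT N)}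
    (hS : ∀ y n k, GT.ring y n k = x → y ∈ S) {F : GT N → ℕ × ℕ → M} {G : ℕ × ℕ → M}
    (hFG : ∀ (y : GT N) n k r, IsPush N y.1 n k r x.1 → F y (n, k) = G (n + r, k + r)) :
    (∑ y ∈ S, ∑ p ∈ gtIndex N, if ¬ Blocked y.1 p.1 p.2 ∧ y.ring p.1 p.2 = x then F y p else 0) =
      ∑ p ∈ gtIndex N, if Removable N x.1 p.1 p.2 then G p else 0 := by
  rw [← Finset.sum_product', ← Finset.sum_filter, ← Finset.sum_filter]
  set jumps := (S ×ˢ gtIndex N).filter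
    (fun q => ¬ Blocked q.1.1 q.2.1 q.2.2 ∧ q.1.ring q.2.1 q.2.2 = x)
  have exists_isPush (q) (hq : q ∈ jumps) : ∃ r, IsPush N q.1.1 q.2.1 q.2.2 r x.1 := by
    obtain ⟨hq, hb, hring⟩ := Finset.mem_filter.1 hq
    obtain ⟨hk, hkn, hn⟩ := mem_gtIndex.1 (Finset.mem_product.1 hq).2
    exact (GT.ring_eq_iff hk hkn hn hb).1 hring
  choose! len hlen using exists_isPush
  refine Finset.sum_bij (fun q _ => (q.2.1 + len q, q.2.2 + len q)) (fun q hq => ?_)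
    (fun q hq q' hq' heq => ?_) (fun p hp => ?_) (fun q hq => hFG _ _ _ _ (hlen q hq))
  · have hpush := hlen q hq
    have hk := hpush.one_le
    have hkn := hpush.le
    exact Finset.mem_filter.2 ⟨mem_gtIndex.2 ⟨Nat.le_add_right_of_le hk,
      Nat.add_le_add_right hkn _, hpush.chain.le⟩, hpush.removable q.1.2⟩
  · exact (hlen q hq).eq_of_last_eq (hlen q' hq') (Prod.mk.inj heq).1 (Prod.mk.inj heq).2
  · obtain ⟨hp, hremovable⟩ := Finset.mem_filter.1 hp
    obtain ⟨hj, hjm, hm⟩ := mem_gtIndex.1 hp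
    obtain ⟨y, n, k, r, hpush, hn, hk⟩ := hremovable.exists_isPush x.2 hj hjm hm
    have hnN : n ≤ N := (Nat.le_add_right n r).trans hpush.chain.le
    have hring : y.ring n k = x :=
      (GT.ring_eq_iff hpush.one_le hpush.le hnN hpush.not_blocked).2 ⟨r, hpush⟩
    have hmem : (y, (n, k)) ∈ jumps := Finset.mem_filter.2
      ⟨Finset.mem_product.2 ⟨hS y n k hring, mem_gtIndex.2 ⟨hpush.one_le, hpush.le, hnN⟩⟩,
        hpush.not_blocked, hring⟩
    refine ⟨_, hmem, ?_⟩
    rw [(hlen _ hmem).chain.unique hpush.chain]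
    exact Prod.ext hn.symm hk.symm

open Classical in
theorem sum_stopped_eq_sum_blocked {M : Type*} [AddCommMonoid M] (f : ℕ → M) :
    (∑ p ∈ gtIndex N with p.1 < N ∧ x (p.1 + 1) p.2 = x p.1 p.2, f (x p.1 p.2)) =
      ∑ p ∈ gtIndex N with Blocked x p.1 p.2, f (x p.1 p.2) := by
  refine Finset.sum_bij (fun p _ => (p.1 + 1, p.2)) (fun p hp => ?_) (fun p _ q _ hpq => ?_)
    (fun q hq => ?_) fun p hp => ?_
  · obtain ⟨hp, hn, heq⟩ := Finset.mem_filter.1 hp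
    obtain ⟨hk, hkn, -⟩ := mem_gtIndex.1 hp
    exact Finset.mem_filter.2 ⟨mem_gtIndex.2 ⟨hk, Nat.le_succ_of_le hkn, hn⟩,
      Nat.lt_succ_of_le hkn, heq.symm⟩
  · obtain ⟨hfst, hsnd⟩ := Prod.mk.inj hpq
    exact Prod.ext (Nat.succ_injective hfst) hsnd
  · obtain ⟨⟨n, k⟩, rfl⟩ : ∃ p : ℕ × ℕ, (p.1 + 1, p.2) = q := by
      obtain ⟨-, hlt, -⟩ := Finset.mem_filter.1 hq
      exact ⟨(q.1 - 1, q.2), Prod.ext (Nat.sub_add_cancel (Nat.one_le_of_lt hlt)) rfl⟩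
    obtain ⟨hq, hlt, heq⟩ := Finset.mem_filter.1 hq
    obtain ⟨hk, -, hn⟩ := mem_gtIndex.1 hq
    exact ⟨(n, k), Finset.mem_filter.2 ⟨mem_gtIndex.2 ⟨hk, Nat.le_of_lt_succ hlt,
      Nat.le_of_succ_le hn⟩, hn, heq.symm⟩, rfl⟩
  · rw [(Finset.mem_filter.1 hp).2.2]

open Classical in
theorem sum_not_stopped_eq_sum_not_blocked {M : Type*} [AddCommGroup M] (f : ℕ → M) :
    (∑ p ∈ gtIndex N with ¬ (p.1 < N ∧ x (p.1 + 1) p.2 = x p.1 p.2), f (x p.1 p.2)) =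
      ∑ p ∈ gtIndex N with ¬ Blocked x p.1 p.2, f (x p.1 p.2) := by
  rw [← add_right_inj, Finset.sum_filter_add_sum_filter_not, sum_stopped_eq_sum_blocked,
    Finset.sum_filter_add_sum_filter_not]

/-- The product of the inverse rates of all particles. -/
noncomputable def invRateProd (lam : ℕ → ℝ) (N : ℕ) (x : ℕ → ℕ → ℕ) : ℂ :=
  ∏ p ∈ gtIndex N, (lam (x p.1 p.2) : ℂ)⁻¹

/-- The indices of the `r + 1` particles on the diagonal upwards from particle `k` on level `n`. -/
def diagonalIndex (n k r : ℕ) : Finset (ℕ × ℕ) :=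
  (Finset.range (r + 1)).image fun i => (n + i, k + i)

theorem mem_diagonalIndex {p : ℕ × ℕ} :
    p ∈ diagonalIndex n k r ↔ n ≤ p.1 ∧ p.1 ≤ n + r ∧ p.1 + k = p.2 + n := by
  simp only [diagonalIndex, Finset.mem_image, Finset.mem_range, Prod.ext_iff]
  exact ⟨by rintro ⟨i, hi, h₁, h₂⟩; omega, fun h => ⟨p.1 - n, by omega, by omega, by omega⟩⟩

theorem prod_diagonalIndex {M : Type*} [CommMonoid M] (f : ℕ × ℕ → M) :
    ∏ p ∈ diagonalIndex n k r, f p = ∏ i ∈ Finset.range (r + 1), f (n + i, k + i) :=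
  Finset.prod_image fun _ _ _ _ h => Nat.add_left_cancel (Prod.mk.inj h).1

/- Along the chain, the new position of each particle is the old position of the next one. -/
theorem IsPush.mul_invRateProd_eq {lam : ℕ → ℝ} (hlam : ∀ x, (lam x : ℂ) ≠ 0)
    (h : IsPush N y n k r x) :
    lam (y n k) * invRateProd lam N y = lam (x (n + r) (k + r)) * invRateProd lam N x := by
  have hdiag : diagonalIndex n k r ⊆ gtIndex N := fun p hp => by
    have := h.one_le
    have := h.le
    have := h.chain.le
    rw [mem_diagonalIndex] at hp
    exact mem_gtIndex.2 (by omega)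
  have hchain : ∏ i ∈ Finset.range r, (lam (y (n + (i + 1)) (k + (i + 1))) : ℂ)⁻¹ =
      ∏ i ∈ Finset.range r, (lam (x (n + i) (k + i)) : ℂ)⁻¹ := by
    refine Finset.prod_congr rfl fun i hi => ?_
    have hi := Finset.mem_range.1 hi
    rw [h.apply_diag hi.le, h.chain.eq i hi, add_assoc, add_assoc]
  have hrest : ∏ p ∈ gtIndex N \ diagonalIndex n k r, (lam (y p.1 p.2) : ℂ)⁻¹ =
      ∏ p ∈ gtIndex N \ diagonalIndex n k r, (lam (x p.1 p.2) : ℂ)⁻¹ := by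
    refine Finset.prod_congr rfl fun p hp => ?_
    rw [h.apply_of_not_diag (mem_diagonalIndex.not.1 (Finset.mem_sdiff.1 hp).2)]
  rw [invRateProd, invRateProd, ← Finset.prod_sdiff hdiag, ← Finset.prod_sdiff hdiag, hrest,
    prod_diagonalIndex, prod_diagonalIndex, Finset.prod_range_succ', hchain,
    Finset.prod_range_succ, add_zero, add_zero]
  field_simp [hlam]

end Jumps

/-- The Karlin–McGregor type determinant of a row. -/
noncomputable def rowDet (lam : ℕ → ℝ) (N : ℕ) (t : ℝ) (r : Fin N → ℕ) : ℂ :=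
  (Matrix.of fun i k : Fin N => birthFun lam (N - 1 - i) t (r k)).det

/-- The probability of the pattern `x` at time `t`; see `gtLaw_real_singleton`. -/
noncomputable def gtDensity (lam : ℕ → ℝ) (N : ℕ) (t : ℝ) (x : GT N) : ℂ :=
  invRateProd lam N x.1 * rowDet lam N t fun k => x.topRow k + 1

theorem hasDerivAt_det {n : ℕ} {M M' : ℝ → Matrix (Fin n) (Fin n) ℂ} {t : ℝ}
    (h : ∀ i k, HasDerivAt (fun t => M t i k) (M' t i k) t) :
    HasDerivAt (fun t => (M t).det) (∑ k, ((M t).updateCol k fun i => M' t i k).det) t := by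
  simp only [Matrix.det_apply]
  rw [Finset.sum_comm]
  refine HasDerivAt.fun_sum fun σ _ => ?_
  rw [← Finset.smul_sum]
  refine HasDerivAt.const_smul _ ?_
  refine (HasDerivAt.fun_finsetProd (u := Finset.univ) fun k _ => h (σ k) k).congr_deriv ?_
  refine Finset.sum_congr rfl fun k _ => ?_
  rw [← Finset.mul_prod_erase _ _ (Finset.mem_univ k), smul_eq_mul, mul_comm]
  congr 1
  · simp
  · refine Finset.prod_congr rfl fun j hj => ?_
    rw [Matrix.updateCol_ne (Finset.ne_of_mem_erase hj)]

section RowDet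

variable {lam : ℕ → ℝ} {N : ℕ}

theorem rowDet_update (t : ℝ) (r : Fin N → ℕ) (k : Fin N) (v : ℕ) :
    rowDet lam N t (Function.update r k v) =
      ((Matrix.of fun i k : Fin N => birthFun lam (N - 1 - i) t (r k)).updateCol k
        fun i => birthFun lam (N - 1 - i) t v).det := by
  rw [rowDet]
  congr 1
  ext i j
  rcases eq_or_ne j k with rfl | hjk
  · simp
  · simp [hjk]

theorem hasDerivAt_rowDet (h : BoundedRates lam) (r : Fin N → ℕ) (t : ℝ) :
    HasDerivAt (fun t => rowDet lam N t fun k => r k + 1)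
      (∑ k, lam (r k) * (rowDet lam N t (Function.update (fun k => r k + 1) k (r k)) -
        rowDet lam N t fun k => r k + 1)) t := by
  refine (hasDerivAt_det (M := fun t => Matrix.of fun i k : Fin N =>
    birthFun lam (N - 1 - i) t (r k + 1)) (M' := fun t => Matrix.of fun i k : Fin N =>
    -birthFun lam (N - 1 - i + 1) t (r k + 1)) fun i k =>
    hasDerivAt_birthFun h _ _ t).congr_deriv ?_
  refine Finset.sum_congr rfl fun k _ => ?_
  set M : Matrix (Fin N) (Fin N) ℂ := Matrix.of fun i k : Fin N =>
    birthFun lam (N - 1 - i) t (r k + 1) with hM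
  have hcol : (fun i => Matrix.of (fun i k : Fin N =>
      -birthFun lam (N - 1 - i + 1) t (r k + 1)) i k) =
      (lam (r k) : ℂ) • ((fun i : Fin N => birthFun lam (N - 1 - i) t (r k)) +
        (-1 : ℂ) • fun i => M i k) := by
    ext i
    simp only [Matrix.of_apply, birthFun_succ h, hM, Pi.smul_apply, Pi.add_apply, smul_eq_mul]
    ring
  rw [hcol, Matrix.det_updateCol_smul, Matrix.det_updateCol_add, Matrix.det_updateCol_smul,
    Matrix.updateCol_eq_self, neg_one_mul, ← sub_eq_add_neg, rowDet_update]
  rfl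

theorem rowDet_eq_zero_of_apply_eq_zero (t : ℝ) {r : Fin N → ℕ} {k : Fin N} (hk : r k = 0) :
    rowDet lam N t r = 0 := by
  refine Matrix.det_eq_zero_of_column_eq_zero k fun i => ?_
  have hi : (N : ℤ) - 1 - i = ((N - 1 - i : ℕ) : ℤ) := by omega
  rw [Matrix.of_apply, hk, hi, birthFun_natCast_zero]

theorem rowDet_eq_zero_of_apply_eq (t : ℝ) {r : Fin N → ℕ} {k l : Fin N} (hkl : k ≠ l)
    (heq : r k = r l) : rowDet lam N t r = 0 :=
  Matrix.det_zero_of_column_eq hkl fun i => by rw [Matrix.of_apply, Matrix.of_apply, heq]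

/- The determinant vanishes on a row which is not strictly increasing or has a particle at `0`. -/
theorem rowDet_update_eq_zero_of_not_removable (t : ℝ) (x : GT N) {k : Fin N}
    (hk : ¬ Removable N x.1 N (k + 1)) :
    rowDet lam N t (Function.update (fun k => x.topRow k + 1) k (x.topRow k)) = 0 := by
  rcases Nat.eq_zero_or_pos (x.topRow k) with hzero | hpos
  · exact rowDet_eq_zero_of_apply_eq_zero t (k := k) (by rw [Function.update_self, hzero])
  · obtain ⟨hk_pos, hle⟩ : 0 < (k : ℕ) ∧ x.1 N (k + 1) ≤ x.1 N k + 1 := by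
      by_contra hcon
      exact hk ⟨fun hlt => absurd hlt (lt_irrefl _), fun _ => ⟨hpos, fun hk => by
        rw [Nat.add_sub_cancel]; omega⟩⟩
    have hstrict := x.2.strict N k hk_pos k.2 le_rfl
    have hne : (⟨k - 1, by omega⟩ : Fin N) ≠ k := fun heq => by
      have := Fin.val_eq_of_eq heq
      simp only at this
      omega
    refine rowDet_eq_zero_of_apply_eq t hne ?_
    rw [Function.update_of_ne hne, Function.update_self]
    simp only [GT.topRow, Nat.sub_add_cancel hk_pos]
    omega

end RowDet

/-! ### The forward equation for the density -/

section ForwardEquation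

variable {lam : ℕ → ℝ} {N : ℕ}

open Classical in
/-- The indicator function of a pattern. -/
noncomputable def GT.ind (x y : GT N) : ℝ := if y = x then 1 else 0

theorem GT.ring_of_blocked (x : GT N) {n k : ℕ} (h : Blocked x.1 n k) : x.ring n k = x := by
  unfold GT.ring
  exact dif_neg fun hring => hring.2 h

theorem GT.le_ring (x : GT N) (n k a b : ℕ) : x.1 a b ≤ (x.ring n k).1 a b := by
  by_cases hring : (1 ≤ k ∧ k ≤ n ∧ n ≤ N) ∧ ¬ Blocked x.1 n k
  · rw [x.ring_of_not_blocked hring.1.1 hring.1.2.1 hring.1.2.2 hring.2]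
    simp only [pushArray]
    split_ifs
    exacts [Nat.le_succ _, le_rfl]
  · have hsame : x.ring n k = x := by
      unfold GT.ring
      exact dif_neg hring
    rw [hsame]

theorem mem_patternsBelow_of_ring {R : ℕ} {x y : GT N} {n k : ℕ} (hx : x ∈ patternsBelow N R)
    (h : y.ring n k = x) : y ∈ patternsBelow N R :=
  mem_patternsBelow.2 fun j =>
    (h ▸ y.le_ring n k N (j + 1) : y.topRow j ≤ x.topRow j).trans_lt (mem_patternsBelow.1 hx j)

/-- The sum of the positions of all particles; every effective jump increases it. -/
def GT.size (x : GT N) : ℕ := ∑ p ∈ gtIndex N, x.1 p.1 p.2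

theorem GT.size_lt_of_ring {x y : GT N} {n k : ℕ} (h : y.ring n k = x) (hne : y ≠ x) :
    y.size < x.size := by
  subst h
  refine Finset.sum_lt_sum (fun p _ => y.le_ring n k p.1 p.2) ?_
  by_contra! hle
  exact hne (GT.ext fun a b hb hba ha =>
    le_antisymm (y.le_ring n k a b) (hle (a, b) (mem_gtIndex.2 ⟨hb, hba, ha⟩)))

theorem generator_eq_sum_gtIndex (f : GT N → ℝ) (x : GT N) : generator lam N f x =
    ∑ p ∈ gtIndex N, lam (x.1 p.1 p.2) * (f (x.ring p.1 p.2) - f x) := by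
  rw [generator, ← sum_gtIndex N fun n k => lam (x.1 n k) * (f (x.ring n k) - f x)]

open Classical in
theorem generator_ind (x y : GT N) : generator lam N x.ind y =
    (∑ p ∈ gtIndex N, if ¬ Blocked y.1 p.1 p.2 ∧ y.ring p.1 p.2 = x then
      lam (y.1 p.1 p.2) else 0) -
    if y = x then ∑ p ∈ gtIndex N with ¬ Blocked x.1 p.1 p.2, lam (x.1 p.1 p.2) else 0 := by
  have hloss : (if y = x then ∑ p ∈ gtIndex N with ¬ Blocked x.1 p.1 p.2, lam (x.1 p.1 p.2)
      else 0) = ∑ p ∈ gtIndex N, if ¬ Blocked y.1 p.1 p.2 ∧ y = x then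
        lam (y.1 p.1 p.2) else 0 := by
    by_cases hyx : y = x
    · simp [hyx, Finset.sum_filter]
    · simp [hyx]
  rw [hloss, ← Finset.sum_sub_distrib, generator_eq_sum_gtIndex]
  refine Finset.sum_congr rfl fun p _ => ?_
  by_cases hb : Blocked y.1 p.1 p.2
  · simp [y.ring_of_blocked hb, hb]
  · simp only [hb, not_false_eq_true, true_and, GT.ind]
    split_ifs <;> ring

theorem generator_ind_eq_zero {x y : GT N} (hne : y ≠ x) (h : x.size ≤ y.size) :
    generator lam N x.ind y = 0 := by
  rw [generator_ind, if_neg hne, sub_zero]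
  exact Finset.sum_eq_zero fun p _ =>
    if_neg fun hring => (GT.size_lt_of_ring hring.2 hne).not_ge h

theorem generator_ind_nonneg (hlam : ∀ x, 0 ≤ lam x) {x y : GT N} (hne : y ≠ x) :
    0 ≤ generator lam N x.ind y := by
  rw [generator_ind, if_neg hne, sub_zero]
  refine Finset.sum_nonneg fun p _ => ?_
  split_ifs
  exacts [hlam _, le_rfl]

/-- The numbers `x N 1 + 1, …, x N N + 1` before the jump which led to `x`, if particle `p` was the
last one to move. -/
def GT.rowBefore (x : GT N) (p : ℕ × ℕ) (k : Fin N) : ℕ :=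
  if p = (N, (k : ℕ) + 1) then x.topRow k else x.topRow k + 1

theorem GT.rowBefore_of_lt (x : GT N) {p : ℕ × ℕ} (hp : p.1 < N) :
    x.rowBefore p = fun k => x.topRow k + 1 :=
  funext fun _ => if_neg fun heq => hp.ne (congrArg Prod.fst heq)

theorem GT.rowBefore_top (x : GT N) (k : Fin N) :
    x.rowBefore (N, k + 1) = Function.update (fun k => x.topRow k + 1) k (x.topRow k) := by
  ext j
  rcases eq_or_ne j k with rfl | hjk
  · simp [GT.rowBefore]
  · simp [GT.rowBefore, hjk, Fin.val_inj, hjk.symm]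

theorem IsPush.rowBefore_eq {x y : GT N} {n k r : ℕ} (h : IsPush N y.1 n k r x.1) :
    x.rowBefore (n + r, k + r) = fun j => y.topRow j + 1 := by
  ext j
  have := h.chain.le
  have happly := h.apply N (j + 1)
  simp only [GT.rowBefore, GT.topRow, Prod.mk.injEq]
  split_ifs at happly ⊢ <;> omega

open Classical in
theorem sum_removable_rowDet (x : GT N) (t : ℝ) (c : ℂ) :
    (∑ p ∈ gtIndex N, if Removable N x.1 p.1 p.2 then
        (lam (x.1 p.1 p.2) : ℂ) * (c * rowDet lam N t (x.rowBefore p)) else 0) =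
      ∑ p ∈ gtIndex N with ¬ (p.1 < N ∧ x.1 (p.1 + 1) p.2 = x.1 p.1 p.2),
        (lam (x.1 p.1 p.2) : ℂ) * (c * rowDet lam N t (x.rowBefore p)) := by
  rw [← Finset.sum_filter]
  refine Finset.sum_subset (fun p hp => ?_) fun p hp hnot => ?_
  · obtain ⟨hp, hremovable⟩ := Finset.mem_filter.1 hp
    exact Finset.mem_filter.2 ⟨hp, fun hstopped => (hremovable.1 hstopped.1).ne hstopped.2⟩
  · obtain ⟨hp, hfree⟩ := Finset.mem_filter.1 hp
    have hremovable : ¬ Removable N x.1 p.1 p.2 :=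
      fun hremovable => hnot (Finset.mem_filter.2 ⟨hp, hremovable⟩)
    obtain ⟨hk, hkn, hn⟩ := mem_gtIndex.1 hp
    rcases hn.lt_or_eq with hlt | heq
    · have hle := (x.2.interlace p.1 p.2 hk hkn hlt).1
      exact absurd ⟨fun _ => hle.lt_of_ne fun heq => hfree ⟨hlt, heq⟩,
        fun heq => absurd heq hlt.ne⟩ hremovable
    · obtain ⟨k, rfl⟩ : ∃ k : Fin N, (N, (k : ℕ) + 1) = p :=
        ⟨⟨p.2 - 1, by omega⟩, Prod.ext heq.symm (Nat.sub_add_cancel hk)⟩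
      rw [x.rowBefore_top, rowDet_update_eq_zero_of_not_removable t x hremovable, mul_zero,
        mul_zero]

theorem sum_generator_ind_mul_gtDensity (hlam : ∀ x, (lam x : ℂ) ≠ 0) {x : GT N} {R : ℕ}
    (hx : x ∈ patternsBelow N R) (t : ℝ) :
    ∑ y ∈ patternsBelow N R, (generator lam N x.ind y : ℂ) * gtDensity lam N t y =
      invRateProd lam N x.1 * ∑ k, lam (x.topRow k) *
        (rowDet lam N t (Function.update (fun k => x.topRow k + 1) k (x.topRow k)) -
          rowDet lam N t fun k => x.topRow k + 1) := by
  classical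
  have hgain := sum_jumps_eq_sum_removable x (fun y n k => mem_patternsBelow_of_ring hx)
    (F := fun y p => (lam (y.1 p.1 p.2) : ℂ) * gtDensity lam N t y)
    (G := fun p => (lam (x.1 p.1 p.2) : ℂ) *
      (invRateProd lam N x.1 * rowDet lam N t (x.rowBefore p))) fun y n k r hpush => by
        simp only [gtDensity, hpush.rowBefore_eq]
        rw [← mul_assoc, ← mul_assoc, hpush.mul_invRateProd_eq hlam]
  have hloss := sum_not_stopped_eq_sum_not_blocked (N := N) (x := x.1)
    fun v => (lam v : ℂ) * gtDensity lam N t x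
  calc ∑ y ∈ patternsBelow N R, (generator lam N x.ind y : ℂ) * gtDensity lam N t y
      = (∑ y ∈ patternsBelow N R, ∑ p ∈ gtIndex N,
          if ¬ Blocked y.1 p.1 p.2 ∧ y.ring p.1 p.2 = x then
            (lam (y.1 p.1 p.2) : ℂ) * gtDensity lam N t y else 0) -
        ∑ p ∈ gtIndex N with ¬ Blocked x.1 p.1 p.2,
          (lam (x.1 p.1 p.2) : ℂ) * gtDensity lam N t x := by
        simp only [generator_ind, Complex.ofReal_sub, Complex.ofReal_sum, sub_mul,
          apply_ite Complex.ofReal, Complex.ofReal_zero, ite_mul, zero_mul, Finset.sum_mul,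
          Finset.sum_sub_distrib, Finset.sum_ite_eq', if_pos hx]
    _ = ∑ p ∈ gtIndex N with ¬ (p.1 < N ∧ x.1 (p.1 + 1) p.2 = x.1 p.1 p.2),
          (lam (x.1 p.1 p.2) : ℂ) * (invRateProd lam N x.1 * (rowDet lam N t (x.rowBefore p) -
            rowDet lam N t fun k => x.topRow k + 1)) := by
        rw [hgain, ← hloss, sum_removable_rowDet, ← Finset.sum_sub_distrib]
        simp only [gtDensity, mul_sub]
    _ = _ := by
        rw [Finset.sum_filter, sum_gtIndex_eq_sum_top fun p hp => ?_, Finset.mul_sum]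
        · refine Finset.sum_congr rfl fun k _ => ?_
          rw [if_pos fun hlt => lt_irrefl N hlt.1, x.rowBefore_top, mul_left_comm]
          rfl
        · rw [x.rowBefore_of_lt hp, sub_self, mul_zero, mul_zero, ite_self]

theorem hasDerivAt_gtDensity (h : BoundedRates lam) {x : GT N} {R : ℕ}
    (hx : x ∈ patternsBelow N R) (t : ℝ) :
    HasDerivAt (fun t => gtDensity lam N t x)
      (∑ y ∈ patternsBelow N R, (generator lam N x.ind y : ℂ) * gtDensity lam N t y) t := by
  rw [sum_generator_ind_mul_gtDensity h.ne_zero hx]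
  exact (hasDerivAt_rowDet h x.topRow t).const_mul _

end ForwardEquation

/-! ### Normalisation and initial condition -/

section Normalisation

variable {lam : ℕ → ℝ} {N : ℕ}

theorem lowerWeight_tiltedWeight {ι : Type*} [Fintype ι] (s : ℂ) (z : ι → ℕ × ℕ)
    (x : ℕ → ℕ → ℕ) :
    lowerWeight (tiltedWeight lam s z) (N + 1) x = invRateProd lam N x *
      ∏ p ∈ gtIndex N, (1 + s * ∑ i, if z i = (p.1, x p.1 p.2) then 1 else 0) := by
  rw [lowerWeight_eq_prod, invRateProd, ← Finset.prod_mul_distrib]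
  refine Finset.prod_congr rfl fun p _ => ?_
  rw [tiltedWeight]
  ring

theorem tendsto_sum_gtDensity_mul {ι : Type*} [Fintype ι] [DecidableEq ι]
    (h : BoundedRates lam) (t : ℝ) (s : ℂ) {z : ι → ℕ × ℕ} (hz : ∀ j, (z j).1 ≤ N)
    {C C₀ : ℝ → ℂ} (hC : AdmissibleContours lam C C₀) :
    Tendsto (fun R => ∑ x ∈ patternsBelow N R, gtDensity lam N t x *
      ∏ p ∈ gtIndex N, (1 + s * ∑ i, if z i = (p.1, x.1 p.1 p.2) then 1 else 0)) atTop
      (𝓝 (1 + s • Matrix.of fun i j => corrKernel lam C C₀ t (z i) (z j)).det) := by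
  refine (tendsto_det_tiltedRowFun h t s hz hC).congr fun R => ?_
  rw [tiltedRowFun, ← sum_patternsBelow_lowerWeight_mul_det (fun i => taylorCoeff lam t i 0)
    (tiltedWeight lam s z) (fun i x => birthFun lam (N - 1 - i) t (x + 1)) R]
  refine Finset.sum_congr rfl fun x _ => ?_
  rw [lowerWeight_tiltedWeight, gtDensity, rowDet]
  ring

theorem BoundedRates.exists_admissibleContours (h : BoundedRates lam) :
    ∃ C C₀, AdmissibleContours lam C C₀ := by
  have hM := h.rateSup_pos
  have houter := h.encirclesAll_circleContour_three
  have hinner := h.encirclesAll_circleContour (show rateSup lam < 2 * rateSup lam by linarith)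
  refine ⟨_, _, houter.isContour, houter.encircles _ (zero_mem_poles lam),
    fun x => houter.encircles _ (rate_mem_poles lam x), hinner.isContour,
    hinner.encircles _ (zero_mem_poles lam), Set.disjoint_left.2 fun w hw hw' => ?_⟩
  have hnorm := image_circleContour_subset_sphere (by linarith) hw
  have hnorm' := image_circleContour_subset_sphere (by linarith) hw'
  simp only [mem_sphere_zero_iff_norm] at hnorm hnorm'
  linarith

theorem tendsto_sum_gtDensity (h : BoundedRates lam) (N : ℕ) (t : ℝ) :
    Tendsto (fun R => ∑ x ∈ patternsBelow N R, gtDensity lam N t x) atTop (𝓝 1) := by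
  obtain ⟨C, C₀, hC⟩ := h.exists_admissibleContours
  simpa using tendsto_sum_gtDensity_mul (N := N) h t 0 (z := Fin.elim0) (fun i => i.elim0) hC

theorem birthFun_natCast_apply_zero (h : BoundedRates lam) {n x : ℕ} (hx : n < x) :
    birthFun lam n 0 (x + 1) = 0 := by
  induction n generalizing x with
  | zero =>
    obtain ⟨x, rfl⟩ := Nat.exists_eq_add_of_lt hx
    have hrec := birthFun_succ h (-((0 : ℕ) : ℤ) - 1) 0 (0 + x + 1)
    rw [birthFun_neg_sub_one_apply_zero_succ h, birthFun_neg_sub_one_apply_zero_succ h] at hrec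
    simpa using hrec
  | succ n ih =>
    obtain ⟨x, rfl⟩ := Nat.exists_eq_add_of_lt hx
    have hrec := birthFun_succ h n 0 (n + 1 + x + 1)
    rw [ih (by omega), ih (by omega)] at hrec
    simpa using hrec

theorem gtDensity_zero_of_ne (h : BoundedRates lam) {x : GT N} (hx : x ≠ densePacked N) :
    gtDensity lam N 0 x = 0 := by
  obtain - | N := N
  · exact absurd (GT.ext fun n k hk hkn hn => by omega) hx
  have htop : N + 1 ≤ x.topRow (Fin.last N) := by
    by_contra! hlt
    exact hx (x.eq_densePacked hlt)
  rw [gtDensity, rowDet, Matrix.det_eq_zero_of_column_eq_zero (Fin.last N) fun i => ?_, mul_zero]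
  have hindex : ((N + 1 : ℕ) : ℤ) - 1 - i = ((N - i : ℕ) : ℤ) := by omega
  rw [Matrix.of_apply, hindex]
  exact birthFun_natCast_apply_zero h (by omega)

theorem gtDensity_zero (h : BoundedRates lam) (x : GT N) :
    gtDensity lam N 0 x = ((densePacked N).ind x : ℂ) := by
  by_cases hx : x = densePacked N
  · subst hx
    obtain ⟨R, hR⟩ := exists_mem_patternsBelow (densePacked N)
    have hsum : ∀ᶠ R' in atTop, ∑ x ∈ patternsBelow N R', gtDensity lam N 0 x =
        gtDensity lam N 0 (densePacked N) := by
      filter_upwards [eventually_ge_atTop R] with R' hR'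
      exact Finset.sum_eq_single_of_mem _ (patternsBelow_mono hR' hR)
        fun x _ hx => gtDensity_zero_of_ne h hx
    rw [GT.ind, if_pos rfl, Complex.ofReal_one]
    exact tendsto_nhds_unique (tendsto_const_nhds.congr' (hsum.mono fun _ h => h.symm))
      (tendsto_sum_gtDensity h N 0)
  · rw [gtDensity_zero_of_ne h hx, GT.ind, if_neg hx, Complex.ofReal_zero]

end Normalisation

/-! ### Uniqueness for the forward equation -/

section Uniqueness

variable {lam : ℕ → ℝ} {N : ℕ}

instance : DiscreteMeasurableSpace (GT N) := ⟨fun _ => trivial⟩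

theorem eq_zero_of_eq_integral_smul {E : Type*} [NormedAddCommGroup E] [NormedSpace ℝ E]
    [CompleteSpace E] {w : ℝ → E} {c : ℝ}
    (hw : ∀ t, 0 ≤ t → IntervalIntegrable w volume 0 t)
    (h : ∀ t, 0 ≤ t → w t = ∫ s in (0 : ℝ)..t, c • w s) {t : ℝ} (ht : 0 ≤ t) : w t = 0 := by
  have hcont : ContinuousOn w (Set.Icc 0 t) := by
    have hprimitive : ContinuousOn (fun r => ∫ s in (0 : ℝ)..r, c • w s) (Set.uIcc 0 t) :=
      intervalIntegral.continuousOn_primitive_interval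
        (((intervalIntegrable_iff' (by simp)).1 (hw t ht)).smul c)
    rw [Set.uIcc_of_le ht] at hprimitive
    exact hprimitive.congr fun s hs => h s hs.1
  have hderiv : ∀ s ∈ Set.Ico 0 t, HasDerivWithinAt w (c • w s) (Set.Ici s) s := by
    intro s hs
    have hright : Set.Ioc s t ∈ 𝓝[>] s := Ioc_mem_nhdsGT hs.2
    have hcontAt : ContinuousWithinAt (fun r => c • w r) (Set.Ioi s) s :=
      ((hcont.const_smul c) s ⟨hs.1, hs.2.le⟩).mono_of_mem_nhdsWithin <|
        mem_of_superset hright fun r hr => ⟨hs.1.trans hr.1.le, hr.2⟩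
    have hmeas : AEStronglyMeasurable (fun r => c • w r) (volume.restrict (Set.Ioc s t)) :=
      ((((intervalIntegrable_iff_integrableOn_Ioc_of_le ht).1 (hw t ht)).mono_set
        (Set.Ioc_subset_Ioc_left hs.1)).smul c).aestronglyMeasurable
    exact (intervalIntegral.integral_hasDerivWithinAt_right ((hw s hs.1).smul c)
      ⟨Set.Ioc s t, hright, hmeas⟩ hcontAt).congr (fun r hr => h r (hs.1.trans hr)) (h s hs.1)
  have hgronwall := norm_le_gronwallBound_of_norm_deriv_right_le (δ := 0) (K := |c|) (ε := 0)
    hcont hderiv (by rw [h 0 le_rfl]; simp) (fun s _ => by simp [norm_smul]) t ⟨ht, le_rfl⟩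
  rw [gronwallBound_ε0_δ0] at hgronwall
  exact norm_le_zero_iff.1 hgronwall

theorem eq_zero_of_forward {w : ℝ → GT N → ℝ}
    (hw : ∀ x t, 0 ≤ t → IntervalIntegrable (fun s => w s x) volume 0 t)
    (h : ∀ x R, x ∈ patternsBelow N R → ∀ t, 0 ≤ t →
      w t x = ∫ s in (0 : ℝ)..t, ∑ y ∈ patternsBelow N R, generator lam N x.ind y * w s y)
    (x : GT N) {t : ℝ} (ht : 0 ≤ t) : w t x = 0 := by
  induction hn : x.size using Nat.strong_induction_on generalizing x t with
  | _ n ih =>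
    obtain ⟨R, hR⟩ := exists_mem_patternsBelow x
    refine eq_zero_of_eq_integral_smul (c := generator lam N x.ind x) (hw x) (fun t ht => ?_) ht
    rw [h x R hR t ht]
    refine intervalIntegral.integral_congr fun s hs => ?_
    rw [Set.uIcc_of_le ht] at hs
    refine Finset.sum_eq_single_of_mem x hR fun y _ hne => ?_
    rcases le_or_gt x.size y.size with hle | hlt
    · rw [generator_ind_eq_zero hne hle, zero_mul]
    · rw [ih y.size (hn ▸ hlt) y hs.1 rfl, mul_zero]

theorem integral_eq_sum_of_forall_notMem {α : Type*} [MeasurableSpace α]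
    [MeasurableSingletonClass α] {ν : Measure α} [IsFiniteMeasure ν] {f : α → ℝ} {S : Finset α}
    (hf : ∀ y ∉ S, f y = 0) : ∫ y, f y ∂ν = ∑ y ∈ S, f y * ν.real {y} := by
  rw [← setIntegral_eq_integral_of_forall_compl_eq_zero (s := (S : Set α)) hf,
    setIntegral_finset S IntegrableOn.finset]
  simp only [smul_eq_mul, mul_comm]

theorem GT.abs_ind_le (x y : GT N) : |x.ind y| ≤ 1 := by
  rw [GT.ind]
  split_ifs <;> norm_num

theorem integral_ind (ν : Measure (GT N)) (x : GT N) : ∫ y, x.ind y ∂ν = ν.real {x} := by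
  have hind : x.ind = Set.indicator {x} 1 := by
    ext y
    by_cases hyx : y = x <;> simp [GT.ind, hyx]
  rw [hind]
  exact integral_indicator_one (MeasurableSet.singleton x)

theorem generator_ind_eq_zero_of_notMem {x y : GT N} {R : ℕ} (hx : x ∈ patternsBelow N R)
    (hy : y ∉ patternsBelow N R) : generator lam N x.ind y = 0 := by
  have hne : y ≠ x := fun hyx => hy (hyx ▸ hx)
  rw [generator_ind, if_neg hne, sub_zero]
  exact Finset.sum_eq_zero fun p _ =>
    if_neg fun hring => hy (mem_patternsBelow_of_ring hx hring.2)

/-- A family of probability measures on `GT N` which solves the forward equation of the push-block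
dynamics from the densely packed pattern. Measurability in time keeps the integrals in the
equation from being junk. -/
structure IsForwardSolution (lam : ℕ → ℝ) (N : ℕ) (ν : ℝ≥0 → Measure (GT N)) : Prop where
  isProbabilityMeasure : ∀ t, IsProbabilityMeasure (ν t)
  measurable_integral : ∀ f : GT N → ℝ, (∃ C, ∀ x, |f x| ≤ C) →
    Measurable fun s : ℝ => ∫ x, f x ∂(ν s.toNNReal)
  integral_eq : ∀ f : GT N → ℝ, (∃ C, ∀ x, |f x| ≤ C) → ∀ t : ℝ≥0, ∫ x, f x ∂(ν t) =
    f (densePacked N) + ∫ s in (0 : ℝ)..t, ∫ x, generator lam N f x ∂(ν s.toNNReal)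

namespace IsForwardSolution

variable {ν ν' : ℝ≥0 → Measure (GT N)}

theorem intervalIntegrable_real (hν : IsForwardSolution lam N ν) (x : GT N) (a b : ℝ) :
    IntervalIntegrable (fun s : ℝ => (ν s.toNNReal).real {x}) volume a b := by
  have hmeas := hν.measurable_integral x.ind ⟨1, x.abs_ind_le⟩
  simp only [integral_ind] at hmeas
  refine (intervalIntegrable_const (c := (1 : ℝ))).mono_fun hmeas.aestronglyMeasurable
    (ae_of_all _ fun s => ?_)
  have := hν.isProbabilityMeasure s.toNNReal
  simp [abs_of_nonneg]

theorem intervalIntegrable_sum (hν : IsForwardSolution lam N ν) (S : Finset (GT N))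
    (g : GT N → ℝ) (a b : ℝ) :
    IntervalIntegrable (fun s : ℝ => ∑ y ∈ S, g y * (ν s.toNNReal).real {y}) volume a b := by
  simpa only [Finset.sum_fn] using
    IntervalIntegrable.sum S fun y _ => (hν.intervalIntegrable_real y a b).const_mul (g y)

theorem real_eq (hν : IsForwardSolution lam N ν) {x : GT N} {R : ℕ}
    (hx : x ∈ patternsBelow N R) (t : ℝ≥0) :
    (ν t).real {x} = x.ind (densePacked N) + ∫ s in (0 : ℝ)..t,
      ∑ y ∈ patternsBelow N R, generator lam N x.ind y * (ν s.toNNReal).real {y} := by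
  rw [← integral_ind, hν.integral_eq x.ind ⟨1, x.abs_ind_le⟩ t]
  congr 1
  refine intervalIntegral.integral_congr fun s _ => ?_
  have := hν.isProbabilityMeasure s.toNNReal
  exact integral_eq_sum_of_forall_notMem fun y hy => generator_ind_eq_zero_of_notMem hx hy

theorem unique (hν : IsForwardSolution lam N ν) (hν' : IsForwardSolution lam N ν') (t : ℝ≥0) :
    ν t = ν' t := by
  have := hν.isProbabilityMeasure t
  have := hν'.isProbabilityMeasure t
  refine Measure.ext_of_singleton fun x => ?_
  rw [← measureReal_eq_measureReal_iff, ← sub_eq_zero]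
  have hdiff := eq_zero_of_forward (lam := lam) (N := N)
    (w := fun s x => (ν s.toNNReal).real {x} - (ν' s.toNNReal).real {x})
    (fun x t _ => (hν.intervalIntegrable_real x 0 t).sub (hν'.intervalIntegrable_real x 0 t))
    (fun x R hx t ht => ?_) x t.2
  · simpa using hdiff
  · lift t to ℝ≥0 using ht
    rw [Real.toNNReal_coe, hν.real_eq hx, hν'.real_eq hx, add_sub_add_left_eq_sub,
      ← intervalIntegral.integral_sub (hν.intervalIntegrable_sum _ _ _ _)
        (hν'.intervalIntegrable_sum _ _ _ _)]
    simp only [mul_sub, Finset.sum_sub_distrib]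

end IsForwardSolution

end Uniqueness

/-! ### The law of the finite patterns -/

section FiniteLaw

variable {lam : ℕ → ℝ} {N : ℕ}

theorem nonneg_of_hasDerivAt_forward (hlam : ∀ x, 0 ≤ lam x) {w : ℝ → GT N → ℝ}
    (hw : ∀ x R, x ∈ patternsBelow N R → ∀ t, HasDerivAt (fun t => w t x)
      (∑ y ∈ patternsBelow N R, generator lam N x.ind y * w t y) t)
    (hinit : ∀ x, 0 ≤ w 0 x) (x : GT N) {t : ℝ} (ht : 0 ≤ t) : 0 ≤ w t x := by
  induction hn : x.size using Nat.strong_induction_on generalizing x t with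
  | _ n ih =>
    classical
    obtain ⟨R, hR⟩ := exists_mem_patternsBelow x
    let c := generator lam N x.ind x
    have hderiv : ∀ s, HasDerivAt (fun s => Real.exp (-c * s) * w s x) (Real.exp (-c * s) *
        ∑ y ∈ (patternsBelow N R).erase x, generator lam N x.ind y * w s y) s := by
      intro s
      have hexp : HasDerivAt (fun s => Real.exp (-c * s)) (Real.exp (-c * s) * (-c)) s := by
        simpa using ((hasDerivAt_id s).const_mul (-c)).exp
      refine (hexp.mul (hw x R hR s)).congr_deriv ?_
      rw [← Finset.add_sum_erase _ _ hR]
      ring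
    have hmono : MonotoneOn (fun s => Real.exp (-c * s) * w s x) (Set.Ici 0) := by
      refine monotoneOn_of_deriv_nonneg (convex_Ici 0)
        (fun s _ => (hderiv s).continuousAt.continuousWithinAt)
        (fun s _ => (hderiv s).differentiableAt.differentiableWithinAt) fun s hs => ?_
      rw [interior_Ici, Set.mem_Ioi] at hs
      rw [(hderiv s).deriv]
      refine mul_nonneg (Real.exp_pos _).le (Finset.sum_nonneg fun y hy => ?_)
      have hne := (Finset.mem_erase.1 hy).1
      rcases le_or_gt x.size y.size with hle | hlt
      · rw [generator_ind_eq_zero hne hle, zero_mul]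
      · exact mul_nonneg (generator_ind_nonneg hlam hne) (ih y.size (hn ▸ hlt) y hs.le rfl)
    have hle := hmono (Set.mem_Ici.2 le_rfl) (Set.mem_Ici.2 ht) ht
    simp only [mul_zero, Real.exp_zero, one_mul] at hle
    exact nonneg_of_mul_nonneg_right ((hinit x).trans hle) (Real.exp_pos _)

theorem hasDerivAt_re_gtDensity (h : BoundedRates lam) {x : GT N} {R : ℕ}
    (hx : x ∈ patternsBelow N R) (t : ℝ) : HasDerivAt (fun t => (gtDensity lam N t x).re)
      (∑ y ∈ patternsBelow N R, generator lam N x.ind y * (gtDensity lam N t y).re) t := by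
  refine (Complex.reCLM.hasFDerivAt.comp_hasDerivAt t (hasDerivAt_gtDensity h hx t)).congr_deriv ?_
  rw [map_sum]
  exact Finset.sum_congr rfl fun y _ => Complex.re_ofReal_mul _ _

theorem hasDerivAt_im_gtDensity (h : BoundedRates lam) {x : GT N} {R : ℕ}
    (hx : x ∈ patternsBelow N R) (t : ℝ) : HasDerivAt (fun t => (gtDensity lam N t x).im)
      (∑ y ∈ patternsBelow N R, generator lam N x.ind y * (gtDensity lam N t y).im) t := by
  refine (Complex.imCLM.hasFDerivAt.comp_hasDerivAt t (hasDerivAt_gtDensity h hx t)).congr_deriv ?_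
  rw [map_sum]
  exact Finset.sum_congr rfl fun y _ => Complex.im_ofReal_mul _ _

theorem gtDensity_re_nonneg (h : BoundedRates lam) (x : GT N) {t : ℝ} (ht : 0 ≤ t) :
    0 ≤ (gtDensity lam N t x).re := by
  refine nonneg_of_hasDerivAt_forward (fun x => (h.pos x).le)
    (w := fun t x => (gtDensity lam N t x).re)
    (fun x R hx t => hasDerivAt_re_gtDensity h hx t) (fun x => ?_) x ht
  rw [gtDensity_zero h, Complex.ofReal_re, GT.ind]
  split_ifs <;> norm_num

theorem gtDensity_im (h : BoundedRates lam) (x : GT N) {t : ℝ} (ht : 0 ≤ t) :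
    (gtDensity lam N t x).im = 0 := by
  have hlam : ∀ x, 0 ≤ lam x := fun x => (h.pos x).le
  refine le_antisymm (neg_nonneg.1 ?_) ?_
  · refine nonneg_of_hasDerivAt_forward hlam (w := fun t x => -(gtDensity lam N t x).im)
      (fun x R hx t => ?_) (fun x => by rw [gtDensity_zero h, Complex.ofReal_im, neg_zero]) x ht
    simpa only [mul_neg, Finset.sum_neg_distrib] using (hasDerivAt_im_gtDensity h hx t).fun_neg
  · exact nonneg_of_hasDerivAt_forward hlam (w := fun t x => (gtDensity lam N t x).im)
      (fun x R hx t => hasDerivAt_im_gtDensity h hx t)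
      (fun x => by rw [gtDensity_zero h, Complex.ofReal_im]) x ht

theorem continuous_gtDensity_re (h : BoundedRates lam) (x : GT N) :
    Continuous fun t => (gtDensity lam N t x).re := by
  obtain ⟨R, hR⟩ := exists_mem_patternsBelow x
  exact continuous_iff_continuousAt.2 fun t => (hasDerivAt_re_gtDensity h hR t).continuousAt

theorem tendsto_patternsBelow (N : ℕ) : Tendsto (patternsBelow N) atTop atTop :=
  tendsto_atTop_finset_of_monotone patternsBelow_mono exists_mem_patternsBelow

theorem hasSum_gtDensity_re (h : BoundedRates lam) (N : ℕ) {t : ℝ} (ht : 0 ≤ t) :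
    HasSum (fun x : GT N => (gtDensity lam N t x).re) 1 := by
  have hnonneg := fun x : GT N => gtDensity_re_nonneg h x ht
  have hlim : Tendsto (fun R => ∑ x ∈ patternsBelow N R, (gtDensity lam N t x).re) atTop
      (𝓝 1) := by
    simpa [Function.comp_def] using
      (Complex.continuous_re.tendsto 1).comp (tendsto_sum_gtDensity h N t)
  have hmono : Monotone fun R => ∑ x ∈ patternsBelow N R, (gtDensity lam N t x).re :=
    fun R R' hR => Finset.sum_le_sum_of_subset_of_nonneg (patternsBelow_mono hR)
      fun x _ _ => hnonneg x
  have hsummable : Summable fun x : GT N => (gtDensity lam N t x).re := by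
    refine summable_of_sum_le (c := 1) hnonneg fun u => ?_
    obtain ⟨R, hR⟩ := (tendsto_atTop.1 (tendsto_patternsBelow N) u).exists
    exact (Finset.sum_le_sum_of_subset_of_nonneg hR fun x _ _ => hnonneg x).trans
      (hmono.ge_of_tendsto hlim R)
  rw [← tendsto_nhds_unique (hsummable.hasSum.comp (tendsto_patternsBelow N)) hlim]
  exact hsummable.hasSum

/-- The law at time `t` of the push-block dynamics on `GT N`. -/
noncomputable def gtLaw (lam : ℕ → ℝ) (N : ℕ) (t : ℝ≥0) : Measure (GT N) :=
  Measure.sum fun x => ENNReal.ofReal (gtDensity lam N t x).re • Measure.dirac x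

theorem isProbabilityMeasure_gtLaw (h : BoundedRates lam) (N : ℕ) (t : ℝ≥0) :
    IsProbabilityMeasure (gtLaw lam N t) := by
  constructor
  have hsum := hasSum_gtDensity_re h N t.coe_nonneg
  simp only [gtLaw, Measure.sum_apply _ MeasurableSet.univ, Measure.smul_apply, measure_univ,
    smul_eq_mul, mul_one]
  rw [← ENNReal.ofReal_tsum_of_nonneg (fun x => gtDensity_re_nonneg h x t.coe_nonneg)
    hsum.summable, hsum.tsum_eq, ENNReal.ofReal_one]

theorem gtLaw_real_singleton (h : BoundedRates lam) (t : ℝ≥0) (x : GT N) :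
    (gtLaw lam N t).real {x} = (gtDensity lam N t x).re := by
  rw [measureReal_def, gtLaw, Measure.sum_apply _ (MeasurableSet.singleton x), tsum_eq_single x]
  · simp [gtDensity_re_nonneg h x t.coe_nonneg]
  · intro y hne
    simp [hne]

theorem abs_generator_le (h : BoundedRates lam) {f : GT N → ℝ} {C : ℝ}
    (hf : ∀ x, |f x| ≤ C) (x : GT N) :
    |generator lam N f x| ≤ (gtIndex N).card • (rateSup lam * (C + C)) := by
  rw [generator_eq_sum_gtIndex]
  refine (Finset.abs_sum_le_sum_abs _ _).trans (Finset.sum_le_card_nsmul _ _ _ fun p _ => ?_)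
  rw [abs_mul, abs_of_pos (h.pos _)]
  exact mul_le_mul (h.le_rateSup _) ((abs_sub _ _).trans (add_le_add (hf _) (hf _)))
    (abs_nonneg _) h.rateSup_pos.le

open Classical in
/-- The restriction of a function to the patterns below `R`, extended by zero. -/
noncomputable def cutoff (f : GT N → ℝ) (R : ℕ) (y : GT N) : ℝ :=
  if y ∈ patternsBelow N R then f y else 0

theorem abs_cutoff_le {f : GT N → ℝ} {C : ℝ} (hf : ∀ x, |f x| ≤ C) (R : ℕ) (y : GT N) :
    |cutoff f R y| ≤ C := by
  unfold cutoff
  split_ifs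
  · exact hf y
  · exact abs_zero.trans_le ((abs_nonneg _).trans (hf y))

theorem tendsto_cutoff (f : GT N → ℝ) (y : GT N) :
    Tendsto (fun R => cutoff f R y) atTop (𝓝 (f y)) := by
  obtain ⟨R, hR⟩ := exists_mem_patternsBelow y
  refine tendsto_const_nhds.congr' ?_
  filter_upwards [eventually_ge_atTop R] with R' hR'
  exact (if_pos (patternsBelow_mono hR' hR)).symm

theorem cutoff_eq_sum (f : GT N → ℝ) (R : ℕ) (y : GT N) :
    cutoff f R y = ∑ x ∈ patternsBelow N R, f x * x.ind y := by
  classical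
  simp [cutoff, GT.ind]

theorem generator_cutoff (f : GT N → ℝ) (R : ℕ) (y : GT N) :
    generator lam N (cutoff f R) y =
      ∑ x ∈ patternsBelow N R, f x * generator lam N x.ind y := by
  simp only [generator_eq_sum_gtIndex, cutoff_eq_sum, Finset.mul_sum, ← Finset.sum_sub_distrib]
  rw [Finset.sum_comm]
  exact Finset.sum_congr rfl fun x _ => Finset.sum_congr rfl fun p _ => by ring

theorem generator_cutoff_eq_zero (f : GT N → ℝ) {R : ℕ} {y : GT N}
    (hy : y ∉ patternsBelow N R) : generator lam N (cutoff f R) y = 0 := by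
  rw [generator_cutoff]
  exact Finset.sum_eq_zero fun x hx => by rw [generator_ind_eq_zero_of_notMem hx hy, mul_zero]

theorem tendsto_generator_cutoff (f : GT N → ℝ) (y : GT N) :
    Tendsto (fun R => generator lam N (cutoff f R) y) atTop (𝓝 (generator lam N f y)) := by
  simp only [generator_eq_sum_gtIndex]
  exact tendsto_finsetSum _ fun p _ =>
    ((tendsto_cutoff f _).sub (tendsto_cutoff f y)).const_mul _

theorem integral_cutoff_gtLaw (h : BoundedRates lam) (f : GT N → ℝ) (R : ℕ) (t : ℝ≥0) :
    ∫ x, cutoff f R x ∂(gtLaw lam N t) =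
      ∑ x ∈ patternsBelow N R, f x * (gtDensity lam N t x).re := by
  have := isProbabilityMeasure_gtLaw h N t
  rw [integral_eq_sum_of_forall_notMem (f := cutoff f R) fun y hy => if_neg hy]
  refine Finset.sum_congr rfl fun x hx => ?_
  rw [cutoff, if_pos hx, gtLaw_real_singleton h]

theorem hasDerivAt_sum_mul_gtDensity (h : BoundedRates lam) (f : GT N → ℝ) (R : ℕ) (s : ℝ) :
    HasDerivAt (fun s => ∑ x ∈ patternsBelow N R, f x * (gtDensity lam N s x).re)
      (∑ y ∈ patternsBelow N R, generator lam N (cutoff f R) y * (gtDensity lam N s y).re) s := by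
  refine (HasDerivAt.fun_sum fun x hx =>
    (hasDerivAt_re_gtDensity h hx s).const_mul (f x)).congr_deriv ?_
  simp only [generator_cutoff, Finset.mul_sum, Finset.sum_mul]
  rw [Finset.sum_comm]
  exact Finset.sum_congr rfl fun x _ => Finset.sum_congr rfl fun p _ => by ring

theorem integral_cutoff_gtLaw_eq (h : BoundedRates lam) (f : GT N → ℝ) (R : ℕ) (t : ℝ≥0) :
    ∫ x, cutoff f R x ∂(gtLaw lam N t) = cutoff f R (densePacked N) + ∫ s in (0 : ℝ)..t,
      ∫ x, generator lam N (cutoff f R) x ∂(gtLaw lam N s.toNNReal) := by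
  have hinit : ∑ x ∈ patternsBelow N R, f x * (gtDensity lam N 0 x).re =
      cutoff f R (densePacked N) := by
    rw [cutoff_eq_sum]
    refine Finset.sum_congr rfl fun x _ => ?_
    rw [gtDensity_zero h, Complex.ofReal_re, GT.ind, GT.ind]
    rcases eq_or_ne x (densePacked N) with rfl | hne
    · rfl
    · rw [if_neg hne, if_neg hne.symm]
  have hgenerator : ∀ s ∈ Set.uIcc (0 : ℝ) t,
      ∫ x, generator lam N (cutoff f R) x ∂(gtLaw lam N s.toNNReal) =
        ∑ y ∈ patternsBelow N R, generator lam N (cutoff f R) y * (gtDensity lam N s y).re := by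
    intro s hs
    rw [Set.uIcc_of_le t.coe_nonneg] at hs
    have := isProbabilityMeasure_gtLaw h N s.toNNReal
    rw [integral_eq_sum_of_forall_notMem fun y hy => generator_cutoff_eq_zero f hy]
    simp only [gtLaw_real_singleton h, Real.coe_toNNReal s hs.1]
  rw [intervalIntegral.integral_congr hgenerator,
    intervalIntegral.integral_eq_sub_of_hasDerivAt
      (fun s _ => hasDerivAt_sum_mul_gtDensity h f R s)
      ((continuous_finsetSum _ fun y _ =>
        (continuous_gtDensity_re h y).const_mul _).intervalIntegrable _ _),
    hinit, integral_cutoff_gtLaw h, add_sub_cancel]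

theorem tendsto_integral_of_bounded {α : Type*} [MeasurableSpace α] [DiscreteMeasurableSpace α]
    {g : ℕ → α → ℝ} {f : α → ℝ} {C : ℝ} (hg : ∀ R x, |g R x| ≤ C)
    (hlim : ∀ x, Tendsto (fun R => g R x) atTop (𝓝 (f x))) (ν : Measure α) [IsFiniteMeasure ν] :
    Tendsto (fun R => ∫ x, g R x ∂ν) atTop (𝓝 (∫ x, f x ∂ν)) :=
  tendsto_integral_of_dominated_convergence (fun _ => C)
    (fun _ => Measurable.of_discrete.aestronglyMeasurable) (integrable_const C)
    (fun R => ae_of_all _ (hg R)) (ae_of_all _ hlim)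

theorem measurable_integral_gtLaw (h : BoundedRates lam) {f : GT N → ℝ} {C : ℝ}
    (hf : ∀ x, |f x| ≤ C) : Measurable fun s : ℝ => ∫ x, f x ∂(gtLaw lam N s.toNNReal) := by
  have := isProbabilityMeasure_gtLaw h N
  refine measurable_of_tendsto_metrizable (f := fun R (s : ℝ) =>
    ∫ x, cutoff f R x ∂(gtLaw lam N s.toNNReal)) (fun R => ?_)
    (tendsto_pi_nhds.2 fun s => tendsto_integral_of_bounded (abs_cutoff_le hf)
      (tendsto_cutoff f) _)
  simp only [integral_cutoff_gtLaw h]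
  refine Continuous.measurable (continuous_finsetSum _ fun x _ => Continuous.const_mul ?_ _)
  exact (continuous_gtDensity_re h x).comp (NNReal.continuous_coe.comp continuous_real_toNNReal)

theorem isForwardSolution_gtLaw (h : BoundedRates lam) (N : ℕ) :
    IsForwardSolution lam N (gtLaw lam N) := by
  have hprob := isProbabilityMeasure_gtLaw h N
  refine ⟨hprob, fun f ⟨C, hf⟩ => measurable_integral_gtLaw h hf, fun f ⟨C, hf⟩ t => ?_⟩
  have hgenerator := fun R => abs_generator_le h (abs_cutoff_le hf R)
  have hlim := tendsto_integral_of_bounded (abs_cutoff_le hf) (tendsto_cutoff f) (gtLaw lam N t)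
  simp only [integral_cutoff_gtLaw_eq h] at hlim
  refine tendsto_nhds_unique hlim ((tendsto_cutoff f _).add ?_)
  refine intervalIntegral.tendsto_integral_filter_of_dominated_convergence
    (fun _ => (gtIndex N).card • (rateSup lam * (C + C)))
    (Eventually.of_forall fun R =>
      (measurable_integral_gtLaw h (hgenerator R)).aestronglyMeasurable)
    (Eventually.of_forall fun R => ae_of_all _ fun s _ => ?_)
    intervalIntegrable_const (ae_of_all _ fun s _ =>
      tendsto_integral_of_bounded hgenerator (tendsto_generator_cutoff f) _)
  simpa using norm_integral_le_of_norm_le_const (μ := gtLaw lam N s.toNNReal)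
    (f := generator lam N (cutoff f R)) (ae_of_all _ (hgenerator R))

end FiniteLaw

/-! ### Consistency of the finite laws -/

section Consistency

variable {lam : ℕ → ℝ} {N : ℕ}

theorem Moves.level_le {x : ℕ → ℕ → ℕ} {n k m j : ℕ} (h : Moves N x n k m j) : n ≤ m := by
  induction h with
  | self => exact le_rfl
  | push _ _ _ ih => exact ih.trans (Nat.le_succ _)

theorem Moves.congr {N' : ℕ} {x x' : ℕ → ℕ → ℕ} {n k m j : ℕ} (h : Moves N x n k m j)
    (hm : m ≤ N') (hx : ∀ a b, a ≤ m → x a b = x' a b) : Moves N' x' n k m j := by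
  induction h with
  | self => exact .self
  | @push m j _ _ hpush ih =>
    rw [hx m j (Nat.le_succ m), hx (m + 1) (j + 1) le_rfl] at hpush
    exact (ih (Nat.le_of_succ_le hm) fun a b ha => hx a b (ha.trans (Nat.le_succ m))).push hm hpush

theorem moves_dropRow_iff (x : GT (N + 1)) {n k m j : ℕ} (hm : m ≤ N) :
    Moves N x.dropRow.1 n k m j ↔ Moves (N + 1) x.1 n k m j :=
  ⟨fun h => h.congr (hm.trans (Nat.le_succ N)) fun _ b ha => x.dropRow_apply (ha.trans hm) b,
    fun h => h.congr hm fun _ b ha => (x.dropRow_apply (ha.trans hm) b).symm⟩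

theorem blocked_dropRow_iff (x : GT (N + 1)) {n k : ℕ} (hn : n ≤ N) :
    Blocked x.dropRow.1 n k ↔ Blocked x.1 n k := by
  rw [Blocked, Blocked, x.dropRow_apply hn, x.dropRow_apply ((Nat.sub_le n 1).trans hn)]

theorem GT.val_ring_of_not_blocked (x : GT N) {n k : ℕ} (hk : 1 ≤ k) (hkn : k ≤ n) (hn : n ≤ N)
    (hb : ¬ Blocked x.1 n k) : (x.ring n k).1 = pushArray N x.1 n k :=
  congrArg Subtype.val (x.ring_of_not_blocked hk hkn hn hb)

theorem GT.dropRow_ring (x : GT (N + 1)) {n k : ℕ} (hk : 1 ≤ k) (hkn : k ≤ n) (hn : n ≤ N) :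
    (x.ring n k).dropRow = x.dropRow.ring n k := by
  by_cases hb : Blocked x.1 n k
  · rw [x.ring_of_blocked hb, x.dropRow.ring_of_blocked ((blocked_dropRow_iff x hn).2 hb)]
  · refine GT.ext fun m j _ _ hm => ?_
    rw [GT.dropRow_apply _ hm, x.val_ring_of_not_blocked hk hkn (hn.trans (Nat.le_succ N)) hb,
      x.dropRow.val_ring_of_not_blocked hk hkn hn (mt (blocked_dropRow_iff x hn).1 hb)]
    simp only [pushArray, x.dropRow_apply hm]
    by_cases hmoves : Moves (N + 1) x.1 n k m j
    · rw [if_pos hmoves, if_pos ((moves_dropRow_iff x hm).2 hmoves)]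
    · rw [if_neg hmoves, if_neg (mt (moves_dropRow_iff x hm).1 hmoves)]

theorem GT.dropRow_ring_top (x : GT (N + 1)) {k : ℕ} (hk : 1 ≤ k) (hkN : k ≤ N + 1) :
    (x.ring (N + 1) k).dropRow = x.dropRow := by
  by_cases hb : Blocked x.1 (N + 1) k
  · rw [x.ring_of_blocked hb]
  · refine GT.ext fun m j _ _ hm => ?_
    rw [GT.dropRow_apply _ hm, GT.dropRow_apply _ hm, x.val_ring_of_not_blocked hk hkN le_rfl hb]
    exact if_neg fun hmoves => (hmoves.level_le.trans hm).not_gt N.lt_succ_self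

theorem generator_comp_dropRow (f : GT N → ℝ) (x : GT (N + 1)) :
    generator lam (N + 1) (fun y => f y.dropRow) x = generator lam N f x.dropRow := by
  have htop : ∑ k ∈ Finset.Icc 1 (N + 1), lam (x.1 (N + 1) k) *
      (f (x.ring (N + 1) k).dropRow - f x.dropRow) = 0 := by
    refine Finset.sum_eq_zero fun k hk => ?_
    obtain ⟨hk, hkN⟩ := Finset.mem_Icc.1 hk
    rw [x.dropRow_ring_top hk hkN, sub_self, mul_zero]
  rw [generator, Finset.sum_Icc_succ_top (Nat.le_add_left 1 N), htop, add_zero, generator]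
  refine Finset.sum_congr rfl fun n hn => Finset.sum_congr rfl fun k hk => ?_
  obtain ⟨hk, hkn⟩ := Finset.mem_Icc.1 hk
  have hn := (Finset.mem_Icc.1 hn).2
  rw [x.dropRow_ring hk hkn hn, x.dropRow_apply hn]

theorem dropRow_densePacked (N : ℕ) : (densePacked (N + 1)).dropRow = densePacked N := by
  refine GT.ext fun n k hk hkn hn => ?_
  rw [GT.dropRow_apply _ hn]
  simp [densePacked, hk, hkn, hn, hn.trans (Nat.le_succ N)]

theorem IsForwardSolution.map_dropRow {ν : ℝ≥0 → Measure (GT (N + 1))}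
    (hν : IsForwardSolution lam (N + 1) ν) :
    IsForwardSolution lam N fun t => (ν t).map GT.dropRow := by
  have hintegral : ∀ (f : GT N → ℝ) t,
      ∫ x, f x ∂((ν t).map GT.dropRow) = ∫ x, f x.dropRow ∂(ν t) := fun f t =>
    integral_map Measurable.of_discrete.aemeasurable Measurable.of_discrete.aestronglyMeasurable
  refine ⟨fun t => ?_, fun f ⟨C, hf⟩ => ?_, fun f ⟨C, hf⟩ t => ?_⟩
  · have := hν.isProbabilityMeasure t
    exact Measure.isProbabilityMeasure_map Measurable.of_discrete.aemeasurable
  · simp only [hintegral]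
    exact hν.measurable_integral (fun x => f x.dropRow) ⟨C, fun x => hf _⟩
  · simp only [hintegral, ← generator_comp_dropRow f, ← dropRow_densePacked N]
    exact hν.integral_eq (fun x => f x.dropRow) ⟨C, fun x => hf _⟩ t

theorem map_dropRow_gtLaw (h : BoundedRates lam) (N : ℕ) (t : ℝ≥0) :
    (gtLaw lam (N + 1) t).map GT.dropRow = gtLaw lam N t :=
  (isForwardSolution_gtLaw h (N + 1)).map_dropRow.unique (isForwardSolution_gtLaw h N) t

end Consistency

/-! ### Projective limits -/

section ProjectiveLimit

variable {X : ℕ → Type*} [∀ n, MeasurableSpace (X n)]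

theorem map_eval_zero_trajMeasure {μ₀ : Measure (X 0)}
    {κ : (n : ℕ) → Kernel (Π i : Finset.Iic n, X i) (X (n + 1))} [∀ n, IsMarkovKernel (κ n)] :
    (Kernel.trajMeasure μ₀ κ).map (fun x => x 0) = μ₀ := by
  have eval_zero_eq : (fun x : Π n, X n => x 0) =
      (fun y : (Π i : Finset.Iic 0, X i) => y ⟨0, Finset.mem_Iic.2 le_rfl⟩) ∘
        Preorder.frestrictLe 0 := rfl
  rw [eval_zero_eq, ← Measure.map_map (by fun_prop) (by fun_prop), Kernel.trajMeasure,
    Measure.map_comp _ _ (by fun_prop), Kernel.traj_map_frestrictLe, Kernel.partialTraj_self,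
    Measure.id_comp]
  exact (Measure.map_map (measurable_pi_apply _) (MeasurableEquiv.measurable _)).trans
    Measure.map_id

variable [∀ n, StandardBorelSpace (X n)] [∀ n, Nonempty (X n)]
  (ν : ∀ n, Measure (X n)) [∀ n, IsProbabilityMeasure (ν n)] (r : ∀ n, X (n + 1) → X n)

/-- The conditional law, under `ν (n + 1)`, of a point of `X (n + 1)` given its projection to
`X n`, regarded as a transition kernel which only looks at the last coordinate of the past. -/
noncomputable def liftKernel (n : ℕ) : Kernel (Π i : Finset.Iic n, X i) (X (n + 1)) :=
  (condDistrib id (r n) (ν (n + 1))).comap (fun y => y ⟨n, Finset.mem_Iic.2 le_rfl⟩)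
    (measurable_pi_apply _)

instance (n : ℕ) : IsMarkovKernel (liftKernel ν r n) := Kernel.IsMarkovKernel.comap _ _

variable {ν r}

theorem map_eval_pair_trajMeasure {n : ℕ} (hν : (ν (n + 1)).map (r n) = ν n)
    (hn : (Kernel.trajMeasure (ν 0) (liftKernel ν r)).map (fun x => x n) = ν n) :
    (Kernel.trajMeasure (ν 0) (liftKernel ν r)).map (fun x => (x n, x (n + 1))) =
      (ν (n + 1)).map fun y => (r n y, y) := by
  set P := Kernel.trajMeasure (ν 0) (liftKernel ν r)
  let last : (Π i : Finset.Iic n, X i) → X n := fun y => y ⟨n, Finset.mem_Iic.2 le_rfl⟩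
  have map_pair : P.map (fun x => (x n, x (n + 1))) =
      (P.map (Preorder.frestrictLe n) ⊗ₘ liftKernel ν r n).map (Prod.map last id) := by
    rw [Kernel.map_frestrictLe_trajMeasure_compProd_eq_map_trajMeasure,
      Measure.map_map (by fun_prop) (by fun_prop)]
    rfl
  have disintegration : ν n ⊗ₘ condDistrib id (r n) (ν (n + 1)) =
      (ν (n + 1)).map fun y => (r n y, y) := by
    rw [← hν]
    exact compProd_map_condDistrib measurable_id.aemeasurable
  rw [map_pair, ← disintegration, ← hn]
  ext s hs
  rw [Measure.map_apply (by fun_prop) hs,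
    Measure.compProd_apply ((show Measurable (Prod.map last id) by fun_prop) hs),
    Measure.compProd_apply hs, lintegral_map _ (by fun_prop), lintegral_map _ (by fun_prop)]
  · rfl
  · exact Kernel.measurable_kernel_prodMk_left hs
  · exact Kernel.measurable_kernel_prodMk_left
      ((show Measurable (Prod.map last id) by fun_prop) hs)

theorem map_eval_trajMeasure (hr : ∀ n, Measurable (r n)) (hν : ∀ n, (ν (n + 1)).map (r n) = ν n)
    (n : ℕ) : (Kernel.trajMeasure (ν 0) (liftKernel ν r)).map (fun x => x n) = ν n := by
  induction n with
  | zero => exact map_eval_zero_trajMeasure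
  | succ n ih =>
    have map_snd := congrArg (fun μ => μ.map Prod.snd)
      (map_eval_pair_trajMeasure (hν n) ih)
    rw [Measure.map_map (by fun_prop) (by fun_prop),
      Measure.map_map (by fun_prop) (by fun_prop)] at map_snd
    simpa [Function.comp_def] using map_snd

theorem exists_measure_map_eval (hr : ∀ n, Measurable (r n))
    (hν : ∀ n, (ν (n + 1)).map (r n) = ν n) :
    ∃ P : Measure (∀ n, X n), IsProbabilityMeasure P ∧ (∀ n, P.map (fun x => x n) = ν n) ∧
      ∀ᵐ x ∂P, ∀ n, r n (x (n + 1)) = x n := by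
  refine ⟨Kernel.trajMeasure (ν 0) (liftKernel ν r), inferInstance, map_eval_trajMeasure hr hν,
    ae_all_iff.2 fun n => ?_⟩
  set P := Kernel.trajMeasure (ν 0) (liftKernel ν r)
  have compatible_pair : ∀ᵐ p ∂(P.map fun x => (x n, x (n + 1))), r n p.2 = p.1 := by
    rw [map_eval_pair_trajMeasure (hν n) (map_eval_trajMeasure hr hν n),
      ae_map_iff (by fun_prop)]
    · exact ae_of_all _ fun y => rfl
    · exact measurableSet_eq_fun (by fun_prop) (by fun_prop)
  exact ae_of_ae_map (by fun_prop) compatible_pair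

end ProjectiveLimit

/-! ### Measures on infinite patterns -/

section InfinitePatterns

variable {lam : ℕ → ℝ} {N : ℕ}

theorem GTInf.trunc_apply (x : GTInf) {n : ℕ} (hn : n ≤ N) (k : ℕ) :
    (x.trunc N).1 n k = x.1 n k := if_pos hn

theorem GTInf.measurable_entry (n k : ℕ) : Measurable fun x : GTInf => x.1 n k :=
  (measurable_pi_apply k).comp ((measurable_pi_apply n).comp (comap_measurable _))

theorem GTInf.measurable_of_entry {α : Type*} {m : MeasurableSpace α} {g : α → GTInf}
    (hg : ∀ n k, Measurable fun a => (g a).1 n k) : Measurable g :=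
  measurable_comap_iff.2 (measurable_pi_lambda _ fun n => measurable_pi_lambda _ fun k => hg n k)

theorem GTInf.measurable_trunc (N : ℕ) : Measurable (GTInf.trunc N) := by
  refine measurable_to_countable' fun y => ?_
  have preimage_eq : GTInf.trunc N ⁻¹' {y} =
      ⋂ p ∈ gtIndex N, {x : GTInf | x.1 p.1 p.2 = y.1 p.1 p.2} := by
    ext x
    simp only [Set.mem_preimage, Set.mem_singleton_iff, Set.mem_iInter]
    constructor
    · rintro rfl p hp
      exact (x.trunc_apply (mem_gtIndex.1 hp).2.2 _).symm
    · intro hxy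
      refine GT.ext fun n k hk hkn hn => ?_
      rw [x.trunc_apply hn]
      exact hxy (n, k) (mem_gtIndex.2 ⟨hk, hkn, hn⟩)
  rw [preimage_eq]
  exact Finset.measurableSet_biInter _ fun p _ =>
    GTInf.measurable_entry p.1 p.2 (MeasurableSet.singleton _)

theorem GTInf.trunc_eq_trunc_of_le {M : ℕ} (hNM : N ≤ M) {x y : GTInf}
    (hxy : x.trunc M = y.trunc M) : x.trunc N = y.trunc N := by
  refine GT.ext fun n k _ _ hn => ?_
  rw [x.trunc_apply hn, y.trunc_apply hn, ← x.trunc_apply (hn.trans hNM), hxy,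
    y.trunc_apply (hn.trans hNM)]

theorem GTInf.exists_preimage_trunc_eq_of_le {M : ℕ} (hNM : N ≤ M) (S : Set (GT N)) :
    ∃ T : Set (GT M), GTInf.trunc N ⁻¹' S = GTInf.trunc M ⁻¹' T := by
  refine ⟨GTInf.trunc M '' (GTInf.trunc N ⁻¹' S), (Set.subset_preimage_image _ _).antisymm ?_⟩
  rintro x ⟨y, hy, hxy⟩
  rwa [Set.mem_preimage, ← GTInf.trunc_eq_trunc_of_le hNM hxy]

theorem GTInf.isPiSystem_preimage_trunc :
    IsPiSystem {A | ∃ N, ∃ S : Set (GT N), A = GTInf.trunc N ⁻¹' S} := by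
  rintro _ ⟨N₁, S₁, rfl⟩ _ ⟨N₂, S₂, rfl⟩ _
  obtain ⟨T₁, hT₁⟩ := GTInf.exists_preimage_trunc_eq_of_le (le_max_left N₁ N₂) S₁
  obtain ⟨T₂, hT₂⟩ := GTInf.exists_preimage_trunc_eq_of_le (le_max_right N₁ N₂) S₂
  exact ⟨max N₁ N₂, T₁ ∩ T₂, by rw [hT₁, hT₂, Set.preimage_inter]⟩

theorem GTInf.measurableSpace_eq_generateFrom :
    (inferInstance : MeasurableSpace GTInf) =
      MeasurableSpace.generateFrom {A | ∃ N, ∃ S : Set (GT N), A = GTInf.trunc N ⁻¹' S} := by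
  refine le_antisymm (fun A hA => ?_) (MeasurableSpace.generateFrom_le ?_)
  · refine GTInf.measurable_of_entry (m := MeasurableSpace.generateFrom _) (g := id)
      (fun n k s _ => ?_) hA
    refine MeasurableSpace.measurableSet_generateFrom ⟨n, {y | y.1 n k ∈ s}, ?_⟩
    ext x
    simp only [Set.mem_preimage, Set.mem_ofPred_eq, x.trunc_apply le_rfl, id_eq]
  · rintro _ ⟨N, S, rfl⟩
    exact GTInf.measurable_trunc N MeasurableSet.of_discrete

theorem GTInf.measure_ext {P Q : Measure GTInf} [IsFiniteMeasure P]
    (hPQ : ∀ N, P.map (GTInf.trunc N) = Q.map (GTInf.trunc N)) : P = Q := by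
  have preimage_eq : ∀ N (S : Set (GT N)),
      P (GTInf.trunc N ⁻¹' S) = Q (GTInf.trunc N ⁻¹' S) := fun N S => by
    rw [← Measure.map_apply (GTInf.measurable_trunc N) MeasurableSet.of_discrete, hPQ N,
      Measure.map_apply (GTInf.measurable_trunc N) MeasurableSet.of_discrete]
  refine ext_of_generate_finite _ GTInf.measurableSpace_eq_generateFrom
    GTInf.isPiSystem_preimage_trunc ?_ (preimage_eq 0 Set.univ)
  rintro _ ⟨N, S, rfl⟩
  exact preimage_eq N S

/-- The densely packed infinite pattern: level `n` is `(0, 1, …, n - 1)`. -/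
def densePackedInf : GTInf :=
  ⟨fun n k => if 1 ≤ k ∧ k ≤ n then k - 1 else 0, by
    refine ⟨fun n k h => if_neg h, fun n k hk hkn => ?_, fun n k hk hkn => ?_⟩
    · rw [if_pos (by omega), if_pos (by omega)]; omega
    · rw [if_pos (by omega), if_pos (by omega), if_pos (by omega)]; omega⟩

theorem GT.apply_eq_of_compatible {x : ∀ n, GT n} (hx : ∀ n, (x (n + 1)).dropRow = x n) {n m : ℕ}
    (hnm : n ≤ m) (k : ℕ) : (x m).1 n k = (x n).1 n k := by
  induction m, hnm using Nat.le_induction with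
  | base => rfl
  | succ m hm ih => rw [← ih, ← hx m, GT.dropRow_apply _ hm]

theorem isGTInf_of_compatible {x : ∀ n, GT n} (hx : ∀ n, (x (n + 1)).dropRow = x n) :
    IsGTInf fun n k => (x n).1 n k := by
  refine ⟨fun n k hnk => (x n).2.support n k fun ⟨hk, hkn, _⟩ => hnk ⟨hk, hkn⟩,
    fun n k hk hkn => (x n).2.strict n k hk hkn le_rfl, fun n k hk hkn => ?_⟩
  have interlace := (x (n + 1)).2.interlace n k hk hkn le_rfl
  rwa [GT.apply_eq_of_compatible hx n.le_succ] at interlace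

open Classical in
/-- The infinite pattern with a given compatible sequence of truncations; an incompatible
sequence is sent to the densely packed pattern. -/
noncomputable def gtGlue (x : ∀ n, GT n) : GTInf :=
  if hx : ∀ n, (x (n + 1)).dropRow = x n then ⟨fun n k => (x n).1 n k, isGTInf_of_compatible hx⟩
  else densePackedInf

theorem gtGlue_apply_of_compatible {x : ∀ n, GT n} (hx : ∀ n, (x (n + 1)).dropRow = x n)
    (n k : ℕ) : (gtGlue x).1 n k = (x n).1 n k := by
  have glue_eq : gtGlue x = ⟨fun n k => (x n).1 n k, isGTInf_of_compatible hx⟩ := by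
    unfold gtGlue
    exact dif_pos hx
  rw [glue_eq]

theorem gtGlue_of_not_compatible {x : ∀ n, GT n} (hx : ¬ ∀ n, (x (n + 1)).dropRow = x n) :
    gtGlue x = densePackedInf := by
  unfold gtGlue
  exact dif_neg hx

theorem trunc_gtGlue {x : ∀ n, GT n} (hx : ∀ n, (x (n + 1)).dropRow = x n) (N : ℕ) :
    (gtGlue x).trunc N = x N := by
  refine GT.ext fun n k _ _ hn => ?_
  rw [GTInf.trunc_apply _ hn, gtGlue_apply_of_compatible hx, GT.apply_eq_of_compatible hx hn]

theorem measurable_gtGlue : Measurable gtGlue := by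
  classical
  refine GTInf.measurable_of_entry fun n k => ?_
  have apply_eq_ite : (fun x => (gtGlue x).1 n k) = fun x : ∀ n, GT n =>
      if ∀ n, (x (n + 1)).dropRow = x n then (x n).1 n k else densePackedInf.1 n k := by
    ext x
    split_ifs with hx
    · exact gtGlue_apply_of_compatible hx n k
    · rw [gtGlue_of_not_compatible hx]
  rw [apply_eq_ite]
  refine Measurable.ite ?_ ?_ measurable_const
  · rw [Set.ofPred_forall]
    refine MeasurableSet.iInter fun n => measurableSet_eq_fun ?_ (measurable_pi_apply n)
    exact (Measurable.of_discrete (f := GT.dropRow (N := n))).comp (measurable_pi_apply (n + 1))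
  · exact (Measurable.of_discrete (f := fun y : GT n => y.1 n k)).comp (measurable_pi_apply n)

theorem exists_measure_map_trunc_eq_gtLaw (h : BoundedRates lam) (t : ℝ≥0) :
    ∃ P : Measure GTInf, IsProbabilityMeasure P ∧ ∀ N, P.map (GTInf.trunc N) = gtLaw lam N t := by
  have _ := fun N => isProbabilityMeasure_gtLaw h N t
  have _ : ∀ N, Nonempty (GT N) := fun N => ⟨densePacked N⟩
  obtain ⟨P, _, map_eval, compatible⟩ := exists_measure_map_eval (ν := fun N => gtLaw lam N t)
    (r := fun N => GT.dropRow) (fun N => Measurable.of_discrete) fun N => map_dropRow_gtLaw h N t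
  refine ⟨P.map gtGlue, Measure.isProbabilityMeasure_map measurable_gtGlue.aemeasurable,
    fun N => ?_⟩
  rw [Measure.map_map (GTInf.measurable_trunc N) measurable_gtGlue, ← map_eval N]
  refine Measure.map_congr ?_
  filter_upwards [compatible] with x hx using trunc_gtGlue hx N

theorem solvesForwardEquation_of_map_trunc_eq_gtLaw (h : BoundedRates lam)
    {P : ℝ≥0 → Measure GTInf} (hP : ∀ t N, (P t).map (GTInf.trunc N) = gtLaw lam N t) :
    SolvesForwardEquation lam P := by
  intro N f hf t
  have integral_trunc : ∀ (g : GT N → ℝ) s,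
      ∫ x, g (x.trunc N) ∂(P s) = ∫ x, g x ∂(gtLaw lam N s) := fun g s => by
    rw [← hP s N, integral_map (GTInf.measurable_trunc N).aemeasurable
      Measurable.of_discrete.aestronglyMeasurable]
  simp only [integral_trunc]
  exact (isForwardSolution_gtLaw h N).integral_eq f hf t

end InfinitePatterns

/-! ### Laws of push-block processes -/

section ProcessLaws

variable {lam : ℕ → ℝ} {N : ℕ} {Ω : Type*} [mΩ : MeasurableSpace Ω]

/-- The first point of the grid of mesh `1 / (n + 1)` strictly to the right of `s`; it
approximates `s` from the right, by a function of `s` with countable range. -/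
noncomputable def gridSucc (n : ℕ) (s : ℝ≥0) : ℝ≥0 := (⌊s * (n + 1)⌋₊ + 1) / (n + 1)

theorem lt_gridSucc (n : ℕ) (s : ℝ≥0) : s < gridSucc n s := by
  rw [gridSucc, lt_div_iff₀ (by positivity)]
  exact Nat.lt_floor_add_one _

theorem gridSucc_le (n : ℕ) (s : ℝ≥0) : gridSucc n s ≤ s + 1 / (n + 1) := by
  rw [gridSucc, div_le_iff₀ (by positivity), add_mul, one_div, inv_mul_cancel₀ (by positivity)]
  gcongr
  exact Nat.floor_le (by positivity)

theorem tendsto_gridSucc (s : ℝ≥0) : Tendsto (fun n => gridSucc n s) atTop (𝓝[≥] s) := by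
  refine tendsto_nhdsWithin_iff.2 ⟨?_, Eventually.of_forall fun n => (lt_gridSucc n s).le⟩
  refine tendsto_of_tendsto_of_tendsto_of_le_of_le tendsto_const_nhds ?_
    (fun n => (lt_gridSucc n s).le) fun n => gridSucc_le n s
  have mesh_tendsto : Tendsto (fun n : ℕ => 1 / ((n : ℝ≥0) + 1)) atTop (𝓝 0) :=
    tendsto_one_div_add_atTop_nhds_zero_nat
  simpa using mesh_tendsto.const_add s

theorem measurable_uncurry_of_right_constant {α : Type*} [MeasurableSpace α]
    [DiscreteMeasurableSpace α] {X : ℝ≥0 → Ω → α} (hX : ∀ t, Measurable (X t))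
    (hr : ∀ ω t, ∀ᶠ s in 𝓝[≥] t, X s ω = X t ω) (f : α → ℝ) :
    Measurable fun p : ℝ≥0 × Ω => f (X p.1 p.2) := by
  refine measurable_of_tendsto_metrizable
    (f := fun n (p : ℝ≥0 × Ω) => f (X (gridSucc n p.1) p.2)) (fun n => ?_) ?_
  · have grid : Measurable fun p : ℕ × Ω => f (X ((p.1 + 1) / (n + 1)) p.2) :=
      measurable_from_prod_countable_right fun k =>
        (Measurable.of_discrete (f := f)).comp (hX ((k + 1) / (n + 1)))
    have floor : Measurable fun p : ℝ≥0 × Ω => (⌊p.1 * (n + 1)⌋₊, p.2) :=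
      (Nat.measurable_floor.comp (measurable_fst.mul_const _)).prodMk measurable_snd
    simpa only [gridSucc, Function.comp_def] using grid.comp floor
  · refine tendsto_pi_nhds.2 fun p => tendsto_const_nhds.congr' ?_
    filter_upwards [(tendsto_gridSucc p.1).eventually (hr p.2 p.1)] with n hn
    rw [hn]

namespace IsPushBlockProcess

variable {μ : Measure Ω} {ℱ : Filtration ℝ≥0 mΩ} {X : ℝ≥0 → Ω → GT N}

theorem measurable (hX : IsPushBlockProcess lam N μ ℱ X) (t : ℝ≥0) : Measurable (X t) :=
  (hX.adapted t).mono (ℱ.le t) le_rfl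

theorem measurable_uncurry (hX : IsPushBlockProcess lam N μ ℱ X) (f : GT N → ℝ) :
    Measurable fun p : ℝ × Ω => f (X p.1.toNNReal p.2) :=
  (measurable_uncurry_of_right_constant hX.measurable hX.right_continuous f).comp
    ((measurable_real_toNNReal.comp measurable_fst).prodMk measurable_snd)

variable [IsProbabilityMeasure μ]

theorem integrable_generator (hX : IsPushBlockProcess lam N μ ℱ X) (h : BoundedRates lam)
    {f : GT N → ℝ} (hf : ∃ C, ∀ x, |f x| ≤ C) (t : ℝ≥0) :
    Integrable (Function.uncurry fun (s : ℝ) ω => generator lam N f (X s.toNNReal ω))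
      ((volume.restrict (Set.uIoc 0 (t : ℝ))).prod μ) := by
  obtain ⟨C, hC⟩ := hf
  have _ : IsFiniteMeasure (volume.restrict (Set.uIoc 0 (t : ℝ))) :=
    ⟨by rw [Measure.restrict_apply_univ, Set.uIoc_of_le t.coe_nonneg]; exact measure_Ioc_lt_top⟩
  exact Integrable.of_bound (hX.measurable_uncurry (generator lam N f)).aestronglyMeasurable _
    (ae_of_all _ fun p => abs_generator_le h hC _)

theorem integral_martingale (hX : IsPushBlockProcess lam N μ ℱ X)
    {f : GT N → ℝ} (hf : ∃ C, ∀ x, |f x| ≤ C) (t : ℝ≥0) :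
    ∫ ω, (f (X t ω) - ∫ s in (0 : ℝ)..t, generator lam N f (X s.toNNReal ω)) ∂μ =
      f (densePacked N) := by
  have integral_eq := (hX.martingale f hf).setIntegral_eq (zero_le (a := t)) MeasurableSet.univ
  rw [setIntegral_univ, setIntegral_univ] at integral_eq
  have initial : ∀ᵐ ω ∂μ, f (X 0 ω) - ∫ s in (0 : ℝ)..((0 : ℝ≥0) : ℝ),
      generator lam N f (X s.toNNReal ω) = f (densePacked N) := by
    filter_upwards [hX.start] with ω hω
    rw [hω, NNReal.coe_zero, intervalIntegral.integral_same, sub_zero]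
  rw [← integral_eq, integral_congr_ae initial, integral_const, probReal_univ, one_smul]

theorem integral_eq (hX : IsPushBlockProcess lam N μ ℱ X) (h : BoundedRates lam)
    {f : GT N → ℝ} (hf : ∃ C, ∀ x, |f x| ≤ C) (t : ℝ≥0) :
    ∫ ω, f (X t ω) ∂μ = f (densePacked N) +
      ∫ s in (0 : ℝ)..t, ∫ ω, generator lam N f (X s.toNNReal ω) ∂μ := by
  have generator_integrable := hX.integrable_generator h hf t
  have drift_integrable : Integrable
      (fun ω => ∫ s in (0 : ℝ)..t, generator lam N f (X s.toNNReal ω)) μ := by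
    have iterated := generator_integrable.integral_prod_right
    rw [Set.uIoc_of_le t.coe_nonneg] at iterated
    simpa only [intervalIntegral.integral_of_le t.coe_nonneg, Function.uncurry_apply_pair]
      using iterated
  have value_integrable : Integrable (fun ω => f (X t ω)) μ := by
    obtain ⟨C, hC⟩ := hf
    exact Integrable.of_bound
      (Measurable.of_discrete.comp (hX.measurable t)).aestronglyMeasurable C
      (ae_of_all _ fun ω => hC _)
  rw [intervalIntegral_integral_swap generator_integrable, ← hX.integral_martingale hf t,
    integral_sub value_integrable drift_integrable, sub_add_cancel]

theorem isForwardSolution (hX : IsPushBlockProcess lam N μ ℱ X) (h : BoundedRates lam) :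
    IsForwardSolution lam N fun t => μ.map (X t) := by
  have integral_map_eq : ∀ (f : GT N → ℝ) t, ∫ x, f x ∂(μ.map (X t)) = ∫ ω, f (X t ω) ∂μ :=
    fun f t => integral_map (hX.measurable t).aemeasurable
      Measurable.of_discrete.aestronglyMeasurable
  refine ⟨fun t => Measure.isProbabilityMeasure_map (hX.measurable t).aemeasurable,
    fun f _ => ?_, fun f hf t => ?_⟩
  · simp only [integral_map_eq]
    exact (hX.measurable_uncurry f).stronglyMeasurable.integral_prod_right'.measurable
  · simpa only [integral_map_eq] using hX.integral_eq h hf t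

theorem map_eq_gtLaw (hX : IsPushBlockProcess lam N μ ℱ X) (h : BoundedRates lam) (t : ℝ≥0) :
    μ.map (X t) = gtLaw lam N t :=
  (hX.isForwardSolution h).unique (isForwardSolution_gtLaw h N) t

end IsPushBlockProcess

theorem IsPushBlockProcessInf.map_eq_of_map_trunc_eq_gtLaw {μ : Measure Ω}
    [IsProbabilityMeasure μ] {ℱ : Filtration ℝ≥0 mΩ} {X : ℝ≥0 → Ω → GTInf}
    (hX : IsPushBlockProcessInf lam μ ℱ X) (h : BoundedRates lam) {t : ℝ≥0} {P : Measure GTInf}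
    (hP : ∀ N, P.map (GTInf.trunc N) = gtLaw lam N t) : μ.map (X t) = P := by
  have measurable_X : Measurable (X t) := by
    refine GTInf.measurable_of_entry fun n k => ?_
    have entry := (Measurable.of_discrete (f := fun y : GT n => y.1 n k)).comp
      ((hX n).measurable t)
    simpa only [Function.comp_def, GTInf.trunc_apply _ le_rfl] using entry
  refine GTInf.measure_ext fun N => ?_
  rw [hP N, Measure.map_map (GTInf.measurable_trunc N) measurable_X]
  exact (hX N).map_eq_gtLaw h t

end ProcessLaws

/-! ### Correlation functions -/

section CorrelationFunctions

variable {lam : ℕ → ℝ} {N : ℕ} {ι : Type*} [Fintype ι]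

/-- The particle configuration of a finite pattern: the set of pairs (level, position). -/
def GT.points (x : GT N) : Finset (ℕ × ℕ) := (gtIndex N).image fun p => (p.1, x.1 p.1 p.2)

theorem GTInf.mem_particles_iff (x : GTInf) {v : ℕ × ℕ} (hv : v.1 ≤ N) :
    v ∈ x.particles ↔ v ∈ (x.trunc N).points := by
  simp only [GTInf.particles, GT.points, Set.mem_ofPred_eq, Finset.mem_image, mem_gtIndex]
  constructor
  · rintro ⟨k, hk, hkn, hkv⟩
    exact ⟨(v.1, k), ⟨hk, hkn, hv⟩, by rw [GTInf.trunc_apply x hv, hkv]⟩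
  · rintro ⟨p, ⟨hk, hkn, hn⟩, rfl⟩
    exact ⟨p.2, hk, hkn, (x.trunc_apply hn p.2).symm⟩

theorem GT.apply_lt_apply (x : GT N) {n k l : ℕ} (hn : n ≤ N) (hk : 1 ≤ k) (hkl : k < l)
    (hl : l ≤ n) : x.1 n k < x.1 n l := by
  induction l, hkl using Nat.le_induction with
  | base => exact x.2.strict n k hk hl hn
  | succ l hkl ih =>
    exact (ih (by omega)).trans (x.2.strict n l (by omega) hl hn)

theorem GT.injOn_points (x : GT N) :
    Set.InjOn (fun p : ℕ × ℕ => (p.1, x.1 p.1 p.2)) (gtIndex N : Set (ℕ × ℕ)) := by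
  rintro ⟨n, k⟩ hp ⟨n', l⟩ hq heq
  simp only [Finset.mem_coe, mem_gtIndex] at hp hq
  simp only [Prod.mk.injEq] at heq
  obtain ⟨rfl, heq⟩ := heq
  rcases lt_trichotomy k l with hkl | rfl | hlk
  · exact absurd heq (x.apply_lt_apply hp.2.2 hp.1 hkl hq.2.1).ne
  · rfl
  · exact absurd heq (x.apply_lt_apply hp.2.2 hq.1 hlk hp.2.1).ne'

theorem prod_one_add_mul_ite_mem {α R : Type*} [DecidableEq α] [CommSemiring R] (A B : Finset α)
    (s : R) : ∏ v ∈ A, (1 + s * if v ∈ B then 1 else 0) = (1 + s) ^ (A ∩ B).card := by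
  rw [← Finset.prod_const, ← Finset.filter_mem_eq_inter, Finset.prod_filter]
  refine Finset.prod_congr rfl fun v _ => ?_
  split_ifs <;> simp

theorem GT.prod_gtIndex_eq_prod (x : GT N) {R : Type*} [CommSemiring R] {z : ι → ℕ × ℕ}
    (hz : Function.Injective z) (s : R) :
    ∏ p ∈ gtIndex N, (1 + s * ∑ i, if z i = (p.1, x.1 p.1 p.2) then 1 else 0) =
      ∏ i, (1 + s * if z i ∈ x.points then 1 else 0) := by
  have sum_eq_ite : ∀ v, (∑ i, if z i = v then (1 : R) else 0) =
      if v ∈ Finset.univ.image z then 1 else 0 := by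
    intro v
    classical
    split_ifs with hv
    · obtain ⟨i, -, rfl⟩ := Finset.mem_image.1 hv
      simp [hz.eq_iff]
    · refine Finset.sum_eq_zero fun i _ => if_neg fun hi => hv ?_
      exact Finset.mem_image.2 ⟨i, Finset.mem_univ i, hi⟩
  -- Both products are `(1 + s) ^ #(x.points ∩ range z)`.
  calc ∏ p ∈ gtIndex N, (1 + s * ∑ i, if z i = (p.1, x.1 p.1 p.2) then 1 else 0)
      = ∏ v ∈ x.points, (1 + s * if v ∈ Finset.univ.image z then 1 else 0) := by
        rw [GT.points, Finset.prod_image x.injOn_points]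
        simp only [sum_eq_ite]
    _ = ∏ v ∈ Finset.univ.image z, (1 + s * if v ∈ x.points then 1 else 0) := by
        rw [prod_one_add_mul_ite_mem, Finset.inter_comm, ← prod_one_add_mul_ite_mem]
    _ = ∏ i, (1 + s * if z i ∈ x.points then 1 else 0) := Finset.prod_image hz.injOn

/-- For `ε = 0` the indicator of the event that all points `z i` are occupied, for general `ε` a
polynomial in `ε` whose expectation is the determinant of `ε + K`. -/
noncomputable def occupation (z : ι → ℕ × ℕ) (ε : ℝ) (x : GT N) : ℝ :=
  ∏ i, (ε + if z i ∈ x.points then 1 else 0)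

theorem occupation_zero (z : ι → ℕ × ℕ) :
    occupation (N := N) z 0 = Set.indicator {x | ∀ i, z i ∈ x.points} 1 := by
  ext x
  simp only [occupation, zero_add]
  by_cases hx : ∀ i, z i ∈ x.points
  · rw [Set.indicator_of_mem (by exact hx), Pi.one_apply]
    exact Finset.prod_eq_one fun i _ => if_pos (hx i)
  · rw [Set.indicator_of_notMem (by exact hx)]
    obtain ⟨i, hi⟩ := not_forall.1 hx
    exact Finset.prod_eq_zero (Finset.mem_univ i) (if_neg hi)

theorem abs_occupation_le (z : ι → ℕ × ℕ) {ε : ℝ} (h0 : 0 ≤ ε) (h1 : ε ≤ 1) (x : GT N) :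
    |occupation z ε x| ≤ 2 ^ Fintype.card ι := by
  rw [occupation, Finset.abs_prod, ← Finset.card_univ, ← Finset.prod_const]
  refine Finset.prod_le_prod (fun i _ => abs_nonneg _) fun i _ => ?_
  rw [abs_of_nonneg (by split_ifs <;> linarith)]
  split_ifs <;> linarith

theorem GT.ofReal_occupation (x : GT N) {z : ι → ℕ × ℕ} (hz : Function.Injective z) {ε : ℝ}
    (hε : ε ≠ 0) : (occupation z ε x : ℂ) = (ε : ℂ) ^ Fintype.card ι *
      ∏ p ∈ gtIndex N, (1 + (ε : ℂ)⁻¹ * ∑ i, if z i = (p.1, x.1 p.1 p.2) then 1 else 0) := by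
  have hε' : (ε : ℂ) ≠ 0 := Complex.ofReal_ne_zero.2 hε
  rw [x.prod_gtIndex_eq_prod hz, occupation, Complex.ofReal_prod, ← Finset.card_univ,
    ← Finset.prod_const, ← Finset.prod_mul_distrib]
  refine Finset.prod_congr rfl fun i _ => ?_
  split_ifs <;> push_cast <;> field_simp

theorem integral_occupation [DecidableEq ι] (h : BoundedRates lam) (t : ℝ≥0) {z : ι → ℕ × ℕ}
    (hz : Function.Injective z) (hN : ∀ i, (z i).1 ≤ N) {C C₀ : ℝ → ℂ}
    (hC : AdmissibleContours lam C C₀) {ε : ℝ} (h0 : 0 < ε) (h1 : ε ≤ 1) :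
    ((∫ x, occupation z ε x ∂(gtLaw lam N t) : ℝ) : ℂ) =
      ((ε : ℂ) • 1 + Matrix.of fun i j => corrKernel lam C C₀ t (z i) (z j)).det := by
  have _ := isProbabilityMeasure_gtLaw h N t
  have cutoff_limit := tendsto_integral_of_bounded
    (abs_cutoff_le (abs_occupation_le (N := N) z h0.le h1)) (tendsto_cutoff (occupation z ε))
    (gtLaw lam N t)
  simp only [integral_cutoff_gtLaw h] at cutoff_limit
  have det_limit := (tendsto_sum_gtDensity_mul h t (ε : ℂ)⁻¹ hN hC).const_mul
    ((ε : ℂ) ^ Fintype.card ι)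
  rw [← Matrix.det_smul, smul_add, smul_inv_smul₀ (Complex.ofReal_ne_zero.2 h0.ne')] at det_limit
  refine tendsto_nhds_unique ((Complex.continuous_ofReal.tendsto _).comp cutoff_limit)
    (det_limit.congr fun R => ?_)
  rw [Function.comp_apply, Complex.ofReal_sum, Finset.mul_sum]
  refine Finset.sum_congr rfl fun x _ => ?_
  have density_real : ((gtDensity lam N t x).re : ℂ) = gtDensity lam N t x :=
    Complex.ext rfl (by simp [gtDensity_im h x t.coe_nonneg])
  rw [Complex.ofReal_mul, x.ofReal_occupation hz h0.ne', density_real]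
  ring

theorem gtLaw_real_forall_mem_points [DecidableEq ι] (h : BoundedRates lam) (t : ℝ≥0)
    {z : ι → ℕ × ℕ} (hz : Function.Injective z) (hN : ∀ i, (z i).1 ≤ N) {C C₀ : ℝ → ℂ}
    (hC : AdmissibleContours lam C C₀) :
    (((gtLaw lam N t).real {x | ∀ i, z i ∈ x.points} : ℝ) : ℂ) =
      (Matrix.of fun i j => corrKernel lam C C₀ t (z i) (z j)).det := by
  have _ := isProbabilityMeasure_gtLaw h N t
  let ε : ℕ → ℝ := fun n => 1 / ((n : ℝ) + 1)
  have ε_tendsto : Tendsto ε atTop (𝓝 0) := tendsto_one_div_add_atTop_nhds_zero_nat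
  have ε_pos : ∀ n, 0 < ε n := fun n => by positivity
  have ε_le_one : ∀ n, ε n ≤ 1 := fun n => by
    rw [div_le_one (by positivity)]
    linarith [n.cast_nonneg (α := ℝ)]
  have integral_limit := tendsto_integral_of_bounded (f := occupation z 0)
    (fun n => abs_occupation_le (N := N) z (ε_pos n).le (ε_le_one n))
    (fun x => tendsto_finsetProd _ fun i _ => ε_tendsto.add_const _) (gtLaw lam N t)
  rw [occupation_zero, integral_indicator_one MeasurableSet.of_discrete] at integral_limit
  have det_continuous : Continuous fun e : ℝ =>
      ((e : ℂ) • 1 + Matrix.of fun i j => corrKernel lam C C₀ t (z i) (z j)).det :=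
    ((Complex.continuous_ofReal.smul continuous_const).add continuous_const).matrix_det
  have det_limit := (det_continuous.tendsto 0).comp ε_tendsto
  simp only [Complex.ofReal_zero, zero_smul, zero_add] at det_limit
  refine tendsto_nhds_unique ((Complex.continuous_ofReal.tendsto _).comp integral_limit)
    (det_limit.congr fun n => ?_)
  exact (integral_occupation h t hz hN hC (ε_pos n) (ε_le_one n)).symm

theorem real_forall_mem_particles [DecidableEq ι] (h : BoundedRates lam) {t : ℝ≥0}
    {P : Measure GTInf} (hP : ∀ N, P.map (GTInf.trunc N) = gtLaw lam N t) {z : ι → ℕ × ℕ}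
    (hz : Function.Injective z) {C C₀ : ℝ → ℂ} (hC : AdmissibleContours lam C C₀) :
    ((P.real {x | ∀ i, z i ∈ x.particles} : ℝ) : ℂ) =
      (Matrix.of fun i j => corrKernel lam C C₀ t (z i) (z j)).det := by
  have level_le : ∀ i, (z i).1 ≤ Finset.univ.sup fun i => (z i).1 := fun i =>
    Finset.le_sup (f := fun i => (z i).1) (Finset.mem_univ i)
  rw [← gtLaw_real_forall_mem_points h t hz level_le hC, ← hP,
    map_measureReal_apply (GTInf.measurable_trunc _) MeasurableSet.of_discrete]
  congr 2
  ext x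
  exact forall_congr' fun i => x.mem_particles_iff (level_le i)

end CorrelationFunctions

theorem mainTheorem1_general {lam : ℕ → ℝ} (h : BoundedRates lam) :
    ∃ P : ℝ≥0 → Measure GTInf,
      (∀ t, IsProbabilityMeasure (P t)) ∧
      SolvesForwardEquation lam P ∧
      (∀ (Ω : Type*) [mΩ : MeasurableSpace Ω] (μ : Measure Ω) [IsProbabilityMeasure μ]
        (ℱ : Filtration ℝ≥0 mΩ),
        (∀ (N : ℕ) (X : ℝ≥0 → Ω → GT N), IsPushBlockProcess lam N μ ℱ X →
          ∀ t, μ.map (X t) = (P t).map (GTInf.trunc N)) ∧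
        (∀ X : ℝ≥0 → Ω → GTInf, IsPushBlockProcessInf lam μ ℱ X → ∀ t, μ.map (X t) = P t)) ∧
      ∀ C C₀ : ℝ → ℂ, AdmissibleContours lam C C₀ →
        ∀ (t : ℝ≥0) (k : ℕ) (z : Fin k → ℕ × ℕ), Function.Injective z →
          (((P t).real {x | ∀ i, z i ∈ x.particles} : ℝ) : ℂ) =
            (Matrix.of fun i j => corrKernel lam C C₀ t (z i) (z j)).det := by
  choose P isProbability map_trunc using exists_measure_map_trunc_eq_gtLaw h
  refine ⟨P, isProbability, solvesForwardEquation_of_map_trunc_eq_gtLaw h map_trunc,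
    fun Ω _ μ _ ℱ => ⟨fun N X hX t => ?_, fun X hX t => ?_⟩, fun C C₀ hC t k z hz => ?_⟩
  · rw [map_trunc t N]
    exact hX.map_eq_gtLaw h t
  · exact hX.map_eq_of_map_trunc_eq_gtLaw h (map_trunc t)
  · exact real_forall_mem_particles h (map_trunc t) hz hC

theorem mainTheorem1 (lam : ℕ → ℝ) (hlam : UniformlyBounded lam) :
    ∃ P : ℝ≥0 → Measure GTInf,
      (∀ t, IsProbabilityMeasure (P t)) ∧
      SolvesForwardEquation lam P ∧
      (∀ (Ω : Type*) [mΩ : MeasurableSpace Ω] (μ : Measure Ω) [IsProbabilityMeasure μ]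
        (ℱ : Filtration ℝ≥0 mΩ),
        (∀ (N : ℕ) (X : ℝ≥0 → Ω → GT N), IsPushBlockProcess lam N μ ℱ X →
          ∀ t, μ.map (X t) = (P t).map (GTInf.trunc N)) ∧
        (∀ X : ℝ≥0 → Ω → GTInf, IsPushBlockProcessInf lam μ ℱ X → ∀ t, μ.map (X t) = P t)) ∧
      ∀ C C₀ : ℝ → ℂ, AdmissibleContours lam C C₀ →
        ∀ (t : ℝ≥0) (k : ℕ) (z : Fin k → ℕ × ℕ), Function.Injective z → (∀ i, 1 ≤ (z i).1) →
          (((P t).real {x | ∀ i, z i ∈ x.particles} : ℝ) : ℂ) =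
            (Matrix.of fun i j => corrKernel lam C C₀ t (z i) (z j)).det := by
  obtain ⟨P, hP, hforward, hlaw, hdet⟩ := mainTheorem1_general hlam.boundedRates
  exact ⟨P, hP, hforward, hlaw, fun C C₀ hC t k z hz _ => hdet C C₀ hC t k z hz⟩
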